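/- **Sommerfeld surface.** Let $S$ be a connected Sommerfeld surface: $M$ copies (sheets) of the real plane $\mathbb{R}^2$, cut along finitely many non-intersecting simple curves that connect distinct points $P_1,\dots,P_N\in\mathbb{R}^2$ with each other or with infinity, and glued along the sides of the cuts, so that the natural projection $\psi:S\to\mathbb{R}^2$ is a finite branched covering with $M$ points over each point of $\mathbb{R}^2\setminus\{P_1,\dots,P_N\}$, and branches over the $P_j=(X_1^{(j)},X_2^{(j)})$ only. We say that $P_j$ is a branch point of order $p$ if $p$ is the least common multiple of the orders of branching of $\psi$ at all the points of $\psi^{-1}(P_j)$. **Diffraction problem.** Let $\mathrm{Re}\,k>0$, $\mathrm{Im}\,k>0$, and let $u:S\to\mathbb{C}$ be a solution of the diffraction problem on $S$: $u$ is continuous on $S$; on each sample of each plane domain that contains no $P_j$ it satisfies $(\partial_{x_1}^2+\partial_{x_2}^2+k^2)u=0$; it satisfies the Meixner condition, i.e. the integral of $|\nabla u|^2+|u|^2$ is finite near the branch points; and $u-u^{\rm in}$ decays exponentially as $|x|\to\infty$, where $u^{\rm in}=\exp\{-ik(x_1\cos\varphi^{\rm in}+x_2\sin\varphi^{\rm in})\}$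 on one chosen sheet and $u^{\rm in}=0$ on the others. **Analytic continuation.** Let $$L_1^{(j)}=\{x\in\mathbb{C}^2: x_1+ix_2=X_1^{(j)}+iX_2^{(j)}\},\qquad L_2^{(j)}=\{x\in\mathbb{C}^2: x_1-ix_2=X_1^{(j)}-iX_2^{(j)}\},$$ and let $T$ be the union of all these 2-lines. Let $u_{\rm c}$ be the multivalued analytic continuation of $u$: its branches at $B\in\mathbb{C}^2\setminus T$ are the germs at $B$ obtained by analytic continuation, along paths in $\mathbb{C}^2\setminus T$ from real points, of the analytic germs that coincide on $\mathbb{R}^2$ with $u$ near some point $A_0\in S$ with $\psi(A_0)\notin\{P_1,\dots,P_N\}$. The 2-line $L_\ell^{(j)}$ is called a branch 2-line of $u_{\rm c}$ of order $p$ if, for each point $C\in L_\ell^{(j)}$ that lies on no other 2-line of $T$, $p$ is the smallest integer $n\ge 1$ with the following property: in some neighbourhood $U$ of $C$, each branch of $u_{\rm c}$ at each $B\in U\setminus T$ returns to itself after continuation along each closed path in $U\setminus T$ based at $B$ whose projection on the transversal coordinate ($x_1+ix_2-X_1^{(j)}-iX_2^{(j)}$ for $\ell=1$, $x_1-ix_2-X_1^{(j)}+iX_2^{(j)}$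 for $\ell=2$) has winding number $n$ about $0$. (Order $1$ means that there is no branching.) **Theorem.** If $P_j$ is a branch point of $S$ of order $p$, then both $L_1^{(j)}$ and $L_2^{(j)}$ are branch 2-lines of $u_{\rm c}$ of order (exactly) $p$. -/

import Mathlib

open Set Filter Topology Complex

/-! ## Sommerfeld surfaces

The real plane is identified with `ℂ`: the point with Cartesian coordinates `(x₁, x₂)` is
`x₁ + i x₂`. -/

/-- `c` is a simple arc joining `a` and `b`. -/
def IsArcJoining (a b : ℂ) (c : Set ℂ) : Prop :=
  ∃ γ : Path a b, Function.Injective γ ∧ range γ = c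

/-- `c` is a simple curve going from `a` to infinity. -/
def IsArcToInfinity (a : ℂ) (c : Set ℂ) : Prop :=
  ∃ γ : NNReal → ℂ, Continuous γ ∧ Function.Injective γ ∧ γ 0 = a ∧
    Tendsto γ atTop (cocompact ℂ) ∧ range γ = c

/-- The projection `ψ` has order of branching `m` at `Q`: in a suitable chart `h` centred at `Q` it
is `h ↦ ψ Q + h ^ m`. -/
def HasBranchingOrder {S : Type*} [TopologicalSpace S] (ψ : S → ℂ) (Q : S) (m : ℕ) : Prop :=
  0 < m ∧ ∃ h : OpenPartialHomeomorph S ℂ, Q ∈ h.source ∧ h Q = 0 ∧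
    ∀ y ∈ h.source, ψ y = ψ Q + h y ^ m

/-- A Sommerfeld surface on the space `S`, with `N` branch point affixes and `M` sheets, together
with the cuts and the sheets (planes with cuts) it is assembled from. -/
structure SommerfeldSurface (S : Type*) [TopologicalSpace S] (N M : ℕ) where
  /-- the affixes of the branch points -/
  P : Fin N → ℂ
  P_injective : Function.Injective P
  /-- the natural projection to the real plane -/
  ψ : S → ℂ
  isProperMap : IsProperMap ψ
  /-- `ψ` is a branched covering ... -/
  exists_order : ∀ Q, ∃ m, HasBranchingOrder ψ Q m
  /-- ... which can branch over the points `P j` only ... -/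
  order_one : ∀ Q, ψ Q ∉ range P → HasBranchingOrder ψ Q 1
  /-- ... and has `M` samples over the other points. -/
  card_fiber : ∀ x, x ∉ range P → (ψ ⁻¹' {x}).ncard = M
  /-- the number of cuts -/
  numCuts : ℕ
  /-- the cuts connect the points `P j` with each other or with infinity -/
  cut : Fin numCuts → Set ℂ
  cut_arc : ∀ i,
    (∃ j j', j ≠ j' ∧ IsArcJoining (P j) (P j') (cut i) ∧ cut i ∩ range P = {P j, P j'}) ∨
    (∃ j, IsArcToInfinity (P j) (cut i) ∧ cut i ∩ range P = {P j})
  /-- the cuts do not intersect (except that they may have common endpoints) -/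
  cut_inter : ∀ i i', i ≠ i' → cut i ∩ cut i' ⊆ range P
  /-- `sheet s x` is the point of the sheet `s` with the affix `x` (for `x` on no cut) -/
  sheet : Fin M → ℂ → S
  ψ_sheet : ∀ s x, x ∉ (⋃ i, cut i) → ψ (sheet s x) = x
  continuousOn_sheet : ∀ s, ContinuousOn (sheet s) (⋃ i, cut i)ᶜ
  sheet_ne : ∀ s s', s ≠ s' → ∀ x, x ∉ (⋃ i, cut i) → sheet s x ≠ sheet s' x

namespace SommerfeldSurface

variable {S : Type*} [TopologicalSpace S] {N M : ℕ} (X : SommerfeldSurface S N M)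

/-- `P j` is a branch point of order `p`: `p` is the least common multiple of the orders of
branching at all the points of `S` over `P j`. -/
def IsBranchPointOfOrder (j : Fin N) (p : ℕ) : Prop :=
  IsLeast {n : ℕ | 0 < n ∧ ∀ Q, X.ψ Q = X.P j → ∀ m, HasBranchingOrder X.ψ Q m → m ∣ n} p

/-- `g` parametrises a sample, on `S`, of the plane domain `U`. -/
def IsSample (U : Set ℂ) (g : ℂ → S) : Prop :=
  ContinuousOn g U ∧ ∀ x ∈ U, X.ψ (g x) = x

/-! ## The diffraction problem -/

/-- The real Helmholtz equation on each sample of each domain free of the points `P j`. -/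
def SolvesHelmholtz (k : ℂ) (u : S → ℂ) : Prop :=
  ∀ (U : Set ℂ) (g : ℂ → S), IsOpen U → Disjoint U (range X.P) → X.IsSample U g →
    ContDiffOn ℝ 2 (u ∘ g) U ∧
      ∀ x ∈ U, iteratedFDeriv ℝ 2 (u ∘ g) x ![1, 1] + iteratedFDeriv ℝ 2 (u ∘ g) x ![I, I]
        + k ^ 2 * u (g x) = 0

/-- The Meixner condition: the energy integral of `|∇u|² + |u|²` is finite near each branch point.
A disc around `P j` is slit along a radius, so that its samples cover its preimage on `S` up to a
set of measure zero. -/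
def SatisfiesMeixner (u : S → ℂ) : Prop :=
  ∀ j : Fin N, ∃ r > 0, ∀ g : ℂ → S,
    X.IsSample {x | x ∈ Metric.ball (X.P j) r ∧ x - X.P j ∈ slitPlane} g →
      MeasureTheory.IntegrableOn
        (fun x => ‖fderiv ℝ (u ∘ g) x 1‖ ^ 2 + ‖fderiv ℝ (u ∘ g) x I‖ ^ 2 + ‖u (g x)‖ ^ 2)
        {x | x ∈ Metric.ball (X.P j) r ∧ x - X.P j ∈ slitPlane}

/-- The incident field: a plane wave on the sheet `s₀`, zero on the other sheets. -/
noncomputable def incident (k : ℂ) (φ : ℝ) (s₀ s : Fin M) (x : ℂ) : ℂ :=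
  if s = s₀ then exp (-I * k * (x.re * Real.cos φ + x.im * Real.sin φ)) else 0

/-- `u` is a (total) field solving the diffraction problem on the Sommerfeld surface. -/
structure IsDiffractionSolution (k : ℂ) (φ : ℝ) (s₀ : Fin M) (u : S → ℂ) : Prop where
  continuous : Continuous u
  helmholtz : X.SolvesHelmholtz k u
  meixner : X.SatisfiesMeixner u
  /-- the scattered field is exponentially decaying -/
  scattered_decay : ∃ δ > 0, ∃ K : ℝ, ∀ s x, x ∉ (⋃ i, X.cut i) →
    ‖u (X.sheet s x) - incident k φ s₀ s x‖ ≤ K * Real.exp (-δ * ‖x‖)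

end SommerfeldSurface

/-! ## Analytic continuation in `ℂ²` -/

/-- The embedding of the real plane into `ℂ²`. -/
def realPoint (x : ℂ) : ℂ × ℂ := ((x.re : ℂ), (x.im : ℂ))

/-- The characteristic coordinates of `ℂ²`: `x₁ + i x₂` (index `0`) and `x₁ - i x₂` (index `1`). -/
def charCoord (l : Fin 2) (A : ℂ × ℂ) : ℂ :=
  if l = 0 then A.1 + I * A.2 else A.1 - I * A.2

/-- Analytic continuation of the germ at `σ 0` of `f` along the path `σ` exists and ends with the
germ at `σ 1` of `g`. -/
def ContinuesAlong (σ : C(unitInterval, ℂ × ℂ)) (f g : ℂ × ℂ → ℂ) : Prop :=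
  ∃ F : unitInterval → ℂ × ℂ → ℂ,
    F 0 =ᶠ[𝓝 (σ 0)] f ∧ F 1 =ᶠ[𝓝 (σ 1)] g ∧
    (∀ t, AnalyticAt ℂ (F t) (σ t)) ∧
    ∀ t, ∀ᶠ s in 𝓝 t, F s =ᶠ[𝓝 (σ s)] F t

/-- The closed path `c` in `ℂ \ {0}` has winding number `n` about `0`. -/
def HasWindingNumber (c : unitInterval → ℂ) (n : ℤ) : Prop :=
  ∃ θ : C(unitInterval, ℂ), (∀ t, c t = exp (θ t)) ∧ θ 1 - θ 0 = 2 * Real.pi * I * n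

namespace SommerfeldSurface

variable {S : Type*} [TopologicalSpace S] {N M : ℕ} (X : SommerfeldSurface S N M)

/-- The characteristic 2-line through the point `P j`: `L₁` for `l = 0` and `L₂` for `l = 1`. -/
def twoLine (l : Fin 2) (j : Fin N) : Set (ℂ × ℂ) :=
  {A | charCoord l A = charCoord l (realPoint (X.P j))}

/-- The singularity set `T`, the union of all the 2-lines. -/
def T : Set (ℂ × ℂ) := ⋃ l, ⋃ j, X.twoLine l j

/-- The germ of `f` at `B` is a branch at `B` of the analytic continuation `u_c` of `u`: it is
obtained, along a path outside of `T`, from an analytic germ at a real point that coincides on the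
real plane with `u`, near some point `A₀` of `S` that is not a branch point. -/
def IsBranch (u : S → ℂ) (B : ℂ × ℂ) (f : ℂ × ℂ → ℂ) : Prop :=
  ∃ A₀ : S, X.ψ A₀ ∉ range X.P ∧
    ∃ f₀ : ℂ × ℂ → ℂ, AnalyticAt ℂ f₀ (realPoint (X.ψ A₀)) ∧
      (∀ᶠ A in 𝓝 A₀, f₀ (realPoint (X.ψ A)) = u A) ∧
      ∃ σ : C(unitInterval, ℂ × ℂ), σ 0 = realPoint (X.ψ A₀) ∧ σ 1 = B ∧ (∀ t, σ t ∉ X.T) ∧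
        ContinuesAlong σ f₀ f

/-- Bypasses with winding number `n` of the 2-line, in some neighbourhood of its point `C`, bring
each branch of `u_c` back to itself. -/
def BypassReturns (u : S → ℂ) (l : Fin 2) (j : Fin N) (C : ℂ × ℂ) (n : ℕ) : Prop :=
  ∃ U ∈ 𝓝 C, ∀ B f, X.IsBranch u B f →
    ∀ σ : C(unitInterval, ℂ × ℂ), σ 0 = B → σ 1 = B → (∀ t, σ t ∈ U \ X.T) →
      HasWindingNumber (fun t => charCoord l (σ t) - charCoord l (realPoint (X.P j))) n →
      ContinuesAlong σ f f

/-- The 2-line is a branch 2-line of `u_c` of order `p`: near each of its points that is not a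
crossing point with another 2-line, `p` is the smallest positive number of bypasses that brings all
branches of `u_c` back to themselves. -/
def IsBranchTwoLineOfOrder (u : S → ℂ) (l : Fin 2) (j : Fin N) (p : ℕ) : Prop :=
  ∀ C ∈ X.twoLine l j, (∀ l' j', (l', j') ≠ (l, j) → C ∉ X.twoLine l' j') →
    IsLeast {n : ℕ | 0 < n ∧ X.BypassReturns u l j C n} p

end SommerfeldSurface

/-! In the coordinates z = x₁ + ix₂, w = x₁ − ix₂ the real plane is w = z̄, and the equation reads
u_{z z̄} = −κu with κ = k²/4. Its Riemann function R (`riem`) is entire in the pole A ∈ ℂ², and the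
form R ∂_z u dz + u R_{z̄} dz̄ (`green`) is closed wherever u is a solution. Let p(·, A) be a
primitive of it, entire in A (`Sol.exists_PF`). The continuation of u is then p(z, (z, w)) + [u(w̄)
− p(w̄, (z, w))]. The first term is holomorphic because R_{z̄} = 0 when the pole has first
coordinate z (`PF.analyticOnNhd_hol`), the second because R = 1 when the pole has second coordinate
z̄ (`PF.analyticOnNhd_anti`), and on w = z̄ the primitives cancel. So the first term branches in z
only and the second in w only. Every branch of the continuation is such a sum, the two terms
possibly coming from different points of S (`ScatteringData.exists_isGlued`). A reflection of the
plane exchanges z and w, so it is enough to study the lines z = P_j.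

Order at most p. Near a point of S over P_j with branching order m, put z = P_j + e^τ; then u has
period 2πim in τ, and n turns about the line replace p(τ, A) by p(τ + 2πin, A). If m divides n, the
difference is a period J(A) of the closed form over a small loop. Since u is bounded near the point,
the mean of R u over the loop is bounded, whereas it would grow linearly in Re τ if J were not zero
(`PF.periodic`).

Order at least p. Suppose that n turns act trivially although m does not divide n. Let v be the
difference of the germs of u at τ + 2πin and τ, which belong to distinct points of one fibre. Its
branching part in z vanishes, so its continuation is entire in z (`Ent`). This property survives
transport of the pair of points over the connected surface (`ScatteringData.entPair_iff`,
`ScatteringData.exists_pair`), so it may be exploited near infinity. There v becomes V(z, s) with w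
= e^s, entire in z and periodic in s. The field is close to the plane wave or to zero, the
alternative depending on the point; therefore V is compared with its own translate: V translated by
h, minus the multiplier of the plane wave times V, decays exponentially on the real plane
(`ScatteringData.exists_shift_bound`). Such a function vanishes (`eq_zero_of_decay`): its Fourier
coefficients along the curves z e^s = t are entire solutions of tφ'' + (1 − μ)φ' + κφ = 0 that decay
faster than every power, and an energy identity with Im κ > 0 leaves only φ = 0 (`eq_zero_of_ode`).
Hence v is a constant e times the plane wave (`eq_wave_of_shift`), and this is transported back to
the branch point. Making the n turns m times over closes up, so m e = 0 and v = 0. Transported once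
more, to a distant point of the illuminated sheet where the incident wave is not small, v = 0 says
that u takes the same value on another sheet, where it is exponentially small: a contradiction
(`ScatteringData.not_ent`). -/

/-! ## Functions of two complex variables -/

section Osgood

open scoped BoundedContinuousFunction

/-- The circle of radius `r` about `c`, parametrised by the first or second coordinate of `ℝ × ℝ`,
as a bounded function. -/
noncomputable def circleBCF (c : ℂ) (r : ℝ) (π : C(ℝ × ℝ, ℝ)) : (ℝ × ℝ) →ᵇ ℂ :=
  BoundedContinuousFunction.ofNormedAddCommGroup (fun θ => circleMap c r (π θ))
    ((continuous_circleMap c r).comp π.continuous) (‖c‖ + |r|) fun θ => by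
      simpa [circleMap] using norm_add_le c (r * exp (π θ * I))

/-- Integration over a square against a continuous weight, as a continuous linear functional. -/
noncomputable def squareIntegral (g : ℝ × ℝ → ℂ) (hg : Continuous g) : ((ℝ × ℝ) →ᵇ ℂ) →L[ℂ] ℂ := by
  refine LinearMap.mkContinuous
    { toFun := fun φ => ∫ s in (0:ℝ)..2 * Real.pi, ∫ t in (0:ℝ)..2 * Real.pi, g (s, t) * φ (s, t)
      map_add' := ?_
      map_smul' := ?_ } (∫ s in (0:ℝ)..2 * Real.pi, ∫ t in (0:ℝ)..2 * Real.pi, ‖g (s, t)‖) ?_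
  · intro φ ψ
    rw [← intervalIntegral.integral_add]
    · congr 1; ext s
      rw [← intervalIntegral.integral_add]
      · simp [mul_add]
      all_goals exact Continuous.intervalIntegrable (by fun_prop) _ _
    all_goals
      apply Continuous.intervalIntegrable
      apply intervalIntegral.continuous_parametric_intervalIntegral_of_continuous'
      fun_prop
  · intro a φ
    simp [← intervalIntegral.integral_const_mul, mul_left_comm]
  · intro φ
    have h2 : (0:ℝ) ≤ 2 * Real.pi := by positivity
    simp only [LinearMap.coe_mk, AddHom.coe_mk]
    rw [← intervalIntegral.integral_mul_const]
    refine intervalIntegral.norm_integral_le_of_norm_le h2 ?_ ?_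
    · refine Eventually.of_forall fun s _ => ?_
      rw [← intervalIntegral.integral_mul_const]
      refine intervalIntegral.norm_integral_le_of_norm_le h2 ?_ ?_
      · refine Eventually.of_forall fun t _ => ?_
        rw [norm_mul]
        gcongr
        exact φ.norm_coe_le_norm _
      · exact Continuous.intervalIntegrable (by fun_prop) _ _
    · apply Continuous.intervalIntegrable
      apply Continuous.mul _ continuous_const
      apply intervalIntegral.continuous_parametric_intervalIntegral_of_continuous'
      fun_prop

theorem squareIntegral_apply (g : ℝ × ℝ → ℂ) (hg : Continuous g) (φ : (ℝ × ℝ) →ᵇ ℂ) :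
    squareIntegral g hg φ =
      ∫ s in (0:ℝ)..2 * Real.pi, ∫ t in (0:ℝ)..2 * Real.pi, g (s, t) * φ (s, t) := rfl

/-- The difference is r e^{iθ}, with inverse r⁻¹ e^{−iθ}. This makes the denominator of the Cauchy
kernel a unit of the Banach algebra of bounded continuous functions at the centre of the bidisc. -/
theorem isUnit_circleBCF_sub (c : ℂ) {r : ℝ} (hr : 0 < r) (π : C(ℝ × ℝ, ℝ)) :
    IsUnit (circleBCF c r π - c • 1) := by
  refine IsUnit.of_mul_eq_one (BoundedContinuousFunction.ofNormedAddCommGroup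
    (fun θ => (r : ℂ)⁻¹ * exp (-(π θ * I))) (by fun_prop) r⁻¹ fun θ => ?_) ?_
  · simp [norm_exp, abs_of_pos hr]
  · ext θ
    have : (r : ℂ) ≠ 0 := by exact_mod_cast hr.ne'
    simp [circleBCF, circleMap, exp_neg]
    field_simp

/-- The iterated Cauchy formula expresses f near p as a continuous linear functional of the kernel
1/((ζ − z)(ω − w)), regarded as an element of a Banach algebra of functions of the two angles.
Inversion is analytic at units, so the kernel, and with it f, is analytic in (z, w). -/
theorem osgood_at {f : ℂ × ℂ → ℂ} {U : Set (ℂ × ℂ)} (hU : IsOpen U) (hc : ContinuousOn f U)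
    (h1 : ∀ p ∈ U, DifferentiableAt ℂ (fun z => f (z, p.2)) p.1)
    (h2 : ∀ p ∈ U, DifferentiableAt ℂ (fun w => f (p.1, w)) p.2) {p : ℂ × ℂ} (hp : p ∈ U) :
    AnalyticAt ℂ f p := by
  obtain ⟨a, b⟩ := p
  obtain ⟨r, hr, hrU⟩ : ∃ r > 0, Metric.closedBall a r ×ˢ Metric.closedBall b r ⊆ U := by
    obtain ⟨r, hr, h⟩ := Metric.nhds_basis_closedBall.mem_iff.1 (hU.mem_nhds hp)
    refine ⟨r, hr, fun q hq => h ?_⟩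
    rw [mem_prod, Metric.mem_closedBall, Metric.mem_closedBall] at hq
    rw [Metric.mem_closedBall, Prod.dist_eq]
    exact max_le hq.1 hq.2
  have hm1 : ∀ s, circleMap a r s ∈ Metric.closedBall a r := circleMap_mem_closedBall a hr.le
  have hm2 : ∀ s, circleMap b r s ∈ Metric.closedBall b r := circleMap_mem_closedBall b hr.le
  let π1 : C(ℝ × ℝ, ℝ) := ⟨Prod.fst, continuous_fst⟩
  let π2 : C(ℝ × ℝ, ℝ) := ⟨Prod.snd, continuous_snd⟩
  -- The weight holds everything in the double Cauchy integral that does not depend on (z, w):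
  -- constants, dζ dω and the boundary values of f.
  let g : ℝ × ℝ → ℂ := fun θ => (2 * Real.pi * I)⁻¹ * (2 * Real.pi * I)⁻¹ *
    (deriv (circleMap a r) θ.1 * deriv (circleMap b r) θ.2 *
      f (circleMap a r θ.1, circleMap b r θ.2))
  have hg : Continuous g := by
    have : Continuous fun θ : ℝ × ℝ => f (circleMap a r θ.1, circleMap b r θ.2) :=
      hc.comp_continuous (by fun_prop) fun θ => hrU ⟨hm1 _, hm2 _⟩
    have c1 := (continuous_circleMap 0 r).comp (continuous_fst (X := ℝ) (Y := ℝ))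
    have c2 := (continuous_circleMap 0 r).comp (continuous_snd (X := ℝ) (Y := ℝ))
    simp only [g, deriv_circleMap]
    exact continuous_const.mul (((c1.mul continuous_const).mul (c2.mul continuous_const)).mul this)
  let k : ℂ × ℂ → (ℝ × ℝ) →ᵇ ℂ := fun q =>
    (circleBCF a r π1 - q.1 • 1) * (circleBCF b r π2 - q.2 • 1)
  have hk : AnalyticAt ℂ k (a, b) := by
    exact (analyticAt_const.sub (analyticAt_fst.smul analyticAt_const)).mul
      (analyticAt_const.sub (analyticAt_snd.smul analyticAt_const))
  have hu : IsUnit (k (a, b)) := (isUnit_circleBCF_sub a hr π1).mul (isUnit_circleBCF_sub b hr π2)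
  have hki : AnalyticAt ℂ (fun q => Ring.inverse (k q)) (a, b) := by
    obtain ⟨v, hv⟩ := hu
    have := analyticAt_inverse (𝕜 := ℂ) v
    rw [hv] at this
    exact this.comp hk
  have hL := ((squareIntegral g hg).analyticAt (Ring.inverse (k (a, b)))).comp_of_eq hki rfl
  refine hL.congr ?_
  have hunit : ∀ᶠ q in 𝓝 (a, b), IsUnit (k q) :=
    hk.continuousAt.eventually (Units.isOpen.mem_nhds hu)
  have hball : Metric.ball a r ×ˢ Metric.ball b r ∈ 𝓝 (a, b) :=
    prod_mem_nhds (Metric.ball_mem_nhds a hr) (Metric.ball_mem_nhds b hr)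
  filter_upwards [hunit, hball] with q hq hqb
  obtain ⟨z, w⟩ := q
  have hval : ∀ θ, Ring.inverse (k (z, w)) θ =
      (circleMap a r θ.1 - z)⁻¹ * (circleMap b r θ.2 - w)⁻¹ := by
    intro θ
    have := congrArg (fun φ : (ℝ × ℝ) →ᵇ ℂ => φ θ) (Ring.inverse_mul_cancel _ hq)
    simp only [BoundedContinuousFunction.coe_mul, Pi.mul_apply, k,
      BoundedContinuousFunction.coe_one, Pi.one_apply] at this
    rw [← mul_inv]
    refine eq_inv_of_mul_eq_one_left ?_
    simpa [circleBCF, π1, π2, k] using this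
  have hin : ∀ s, (∮ ω in C(b, r), (ω - w)⁻¹ • f (circleMap a r s, ω)) =
      (2 * Real.pi * I) • f (circleMap a r s, w) := fun s =>
    DifferentiableOn.circleIntegral_sub_inv_smul
      (fun ω hω => (h2 (circleMap a r s, ω) (hrU ⟨hm1 _, hω⟩)).differentiableWithinAt) hqb.2
  have hout : (∮ ζ in C(a, r), (ζ - z)⁻¹ • f (ζ, w)) = (2 * Real.pi * I) • f (z, w) :=
    DifferentiableOn.circleIntegral_sub_inv_smul
      (fun ζ hζ => (h1 (ζ, w) (hrU ⟨hζ, Metric.ball_subset_closedBall hqb.2⟩)).differentiableWithinAt)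
      hqb.1
  have hpi : (2 * Real.pi * I : ℂ) ≠ 0 := two_pi_I_ne_zero
  have e1 : ∀ s, (∫ t in (0:ℝ)..2 * Real.pi, g (s, t) * Ring.inverse (k (z, w)) (s, t)) =
      (2 * Real.pi * I)⁻¹ * (deriv (circleMap a r) s * ((circleMap a r s - z)⁻¹ *
        f (circleMap a r s, w))) := by
    intro s
    have := hin s
    rw [circleIntegral, smul_eq_mul] at this
    have h3 : f (circleMap a r s, w) = (2 * Real.pi * I)⁻¹ * ∫ θ in (0:ℝ)..2 * Real.pi,
        deriv (circleMap b r) θ • (circleMap b r θ - w)⁻¹ •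
          f (circleMap a r s, circleMap b r θ) := by
      rw [this]; field_simp
    rw [h3, ← intervalIntegral.integral_const_mul, ← intervalIntegral.integral_const_mul,
      ← intervalIntegral.integral_const_mul, ← intervalIntegral.integral_const_mul]
    congr 1; ext t
    rw [hval]
    simp only [g, smul_eq_mul]
    ring
  show squareIntegral g hg (Ring.inverse (k (z, w))) = f (z, w)
  rw [squareIntegral_apply]
  simp only [e1]
  rw [intervalIntegral.integral_const_mul]
  rw [circleIntegral, smul_eq_mul] at hout
  simp only [smul_eq_mul] at hout
  rw [hout]
  field_simp

/-- **Osgood's lemma**: a continuous separately holomorphic function of two variables is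
analytic. -/
theorem osgood {f : ℂ × ℂ → ℂ} {U : Set (ℂ × ℂ)} (hU : IsOpen U) (hc : ContinuousOn f U)
    (h1 : ∀ p ∈ U, DifferentiableAt ℂ (fun z => f (z, p.2)) p.1)
    (h2 : ∀ p ∈ U, DifferentiableAt ℂ (fun w => f (p.1, w)) p.2) : AnalyticOnNhd ℂ f U :=
  fun _ hp => osgood_at hU hc h1 h2 hp

theorem DifferentiableOn.analyticOnNhd_prod {f : ℂ × ℂ → ℂ} {U : Set (ℂ × ℂ)} (hU : IsOpen U)
    (hf : DifferentiableOn ℂ f U) : AnalyticOnNhd ℂ f U := by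
  refine osgood hU hf.continuousOn (fun p hp => ?_) fun p hp => ?_
  · exact (hf.differentiableAt (hU.mem_nhds hp)).comp p.1
      (differentiableAt_id.prodMk (differentiableAt_const _))
  · exact (hf.differentiableAt (hU.mem_nhds hp)).comp p.2
      ((differentiableAt_const _).prodMk differentiableAt_id)

end Osgood

/-! ### Sets of uniqueness for analytic functions -/

section Identity

/-- An analytic function of one variable that vanishes at the real points near a real point
vanishes near that point. -/
theorem AnalyticAt.eventually_eq_zero_of_real {f : ℂ → ℂ} {a : ℝ} (hf : AnalyticAt ℂ f a)
    (h : ∀ᶠ x : ℝ in 𝓝 a, f x = 0) : ∀ᶠ z in 𝓝 (a : ℂ), f z = 0 := by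
  rw [← hf.frequently_zero_iff_eventually_zero]
  have h1 : ∃ᶠ x : ℝ in 𝓝[≠] a, f x = 0 :=
    (h.filter_mono nhdsWithin_le_nhds).frequently
  have ht : Tendsto (fun x : ℝ => (x : ℂ)) (𝓝[≠] a) (𝓝[≠] (a : ℂ)) := by
    refine tendsto_nhdsWithin_of_tendsto_nhds_of_eventually_within _
      (continuous_ofReal.continuousAt.tendsto.mono_left nhdsWithin_le_nhds) ?_
    filter_upwards [self_mem_nhdsWithin] with x hx
    simpa using hx
  exact ht.frequently h1

/-- The real plane is a set of uniqueness for analytic functions in `ℂ²`. -/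
theorem AnalyticAt.eventually_eq_zero_of_diag {f : ℂ × ℂ → ℂ} {x : ℂ}
    (hf : AnalyticAt ℂ f (x, (starRingEnd ℂ) x))
    (h : ∀ᶠ y in 𝓝 x, f (y, (starRingEnd ℂ) y) = 0) :
    ∀ᶠ q in 𝓝 (x, (starRingEnd ℂ) x), f q = 0 := by
  -- In these coordinates the points (y, ȳ) become ℝ². One-variable uniqueness on the real line is
  -- applied twice: in the first coordinate with the second one real, then in the second with the
  -- first one complex.
  let e : ℂ × ℂ → ℂ × ℂ := fun p => (p.1 + I * p.2, p.1 - I * p.2)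
  have he : e ((x.re : ℂ), (x.im : ℂ)) = (x, (starRingEnd ℂ) x) := by
    refine Prod.ext ?_ ?_
    · simp only [e]; rw [mul_comm]; exact re_add_im x
    · simp only [e]; apply Complex.ext <;> simp
  have hfe : AnalyticAt ℂ (f ∘ e) ((x.re : ℂ), (x.im : ℂ)) := by
    refine AnalyticAt.comp (by rw [he]; exact hf) ?_
    exact (analyticAt_fst.add (analyticAt_const.mul analyticAt_snd)).prod
      (analyticAt_fst.sub (analyticAt_const.mul analyticAt_snd))
  suffices hs : ∀ᶠ p in 𝓝 ((x.re : ℂ), (x.im : ℂ)), (f ∘ e) p = 0 by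
    let e' : ℂ × ℂ → ℂ × ℂ := fun q => ((q.1 + q.2) / 2, (q.1 - q.2) / (2 * I))
    have hee : ∀ q, e (e' q) = q := by
      intro q
      refine Prod.ext ?_ ?_ <;> simp only [e, e'] <;> field_simp <;> ring
    have he' : e' (x, (starRingEnd ℂ) x) = ((x.re : ℂ), (x.im : ℂ)) := by
      rw [← he]
      refine Prod.ext ?_ ?_ <;> simp only [e, e'] <;> field_simp <;> ring
    have hc : Continuous e' := by simp only [e']; fun_prop
    have := (hc.continuousAt (x := (x, (starRingEnd ℂ) x))).eventually
      (p := fun p => (f ∘ e) p = 0) (by rw [he']; exact hs)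
    filter_upwards [this] with q hq
    simpa [hee] using hq
  have hreal : ∀ᶠ p : ℝ × ℝ in 𝓝 (x.re, x.im), f (e ((p.1 : ℂ), (p.2 : ℂ))) = 0 := by
    have hc : Continuous fun p : ℝ × ℝ => (p.1 : ℂ) + I * p.2 := by fun_prop
    have h0 : (fun p : ℝ × ℝ => (p.1 : ℂ) + I * p.2) (x.re, x.im) = x := by
      simp only; rw [mul_comm]; exact re_add_im x
    have := (hc.continuousAt (x := (x.re, x.im))).eventually
      (p := fun y => f (y, (starRingEnd ℂ) y) = 0) (by rw [h0]; exact h)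
    filter_upwards [this] with p hp
    have : e ((p.1 : ℂ), (p.2 : ℂ)) =
        ((p.1 : ℂ) + I * p.2, (starRingEnd ℂ) ((p.1 : ℂ) + I * p.2)) := by
      simp [e, sub_eq_add_neg]
    rw [this, hp]
  obtain ⟨U, hU, hUan⟩ := hfe.exists_mem_nhds_analyticOnNhd
  obtain ⟨V1, hV1, V2, hV2, hV⟩ := mem_nhds_prod_iff.1 hU
  obtain ⟨r1, hr1, hb1⟩ := Metric.mem_nhds_iff.1 hV1
  obtain ⟨r2, hr2, hb2⟩ := Metric.mem_nhds_iff.1 hV2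
  obtain ⟨W1, hW1, W2, hW2, hW⟩ := mem_nhds_prod_iff.1 hreal
  have han : ∀ a ∈ Metric.ball (x.re : ℂ) r1, ∀ b ∈ Metric.ball (x.im : ℂ) r2,
      AnalyticAt ℂ (f ∘ e) (a, b) := fun a ha b hb => hUan _ (hV ⟨hb1 ha, hb2 hb⟩)
  have step1 : ∀ b ∈ W2, (b : ℂ) ∈ Metric.ball (x.im : ℂ) r2 →
      ∀ a ∈ Metric.ball (x.re : ℂ) r1, (f ∘ e) (a, b) = 0 := by
    intro b hb hbr
    have hA : AnalyticOnNhd ℂ (fun a => (f ∘ e) (a, (b : ℂ))) (Metric.ball (x.re : ℂ) r1) :=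
      fun a ha => (han a ha b hbr).comp (f := fun a : ℂ => (a, (b : ℂ))) (by fun_prop)
    refine hA.eqOn_zero_of_preconnected_of_eventuallyEq_zero
      (convex_ball _ _).isPreconnected (Metric.mem_ball_self hr1) ?_
    refine (hA _ (Metric.mem_ball_self hr1)).eventually_eq_zero_of_real ?_
    filter_upwards [hW1] with a ha
    exact hW (mk_mem_prod ha hb)
  have hball : Metric.ball (x.re : ℂ) r1 ×ˢ Metric.ball (x.im : ℂ) r2 ∈
      𝓝 ((x.re : ℂ), (x.im : ℂ)) :=
    prod_mem_nhds (Metric.ball_mem_nhds _ hr1) (Metric.ball_mem_nhds _ hr2)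
  filter_upwards [hball] with p hp
  obtain ⟨a, b⟩ := p
  have hA : AnalyticOnNhd ℂ (fun b => (f ∘ e) (a, b)) (Metric.ball (x.im : ℂ) r2) :=
    fun b hb => (han a hp.1 b hb).comp (f := fun b : ℂ => (a, b)) (by fun_prop)
  refine hA.eqOn_zero_of_preconnected_of_eventuallyEq_zero
      (convex_ball _ _).isPreconnected (Metric.mem_ball_self hr2) ?_ hp.2
  refine (hA _ (Metric.mem_ball_self hr2)).eventually_eq_zero_of_real ?_
  have hbr : ∀ᶠ t : ℝ in 𝓝 x.im, (t : ℂ) ∈ Metric.ball (x.im : ℂ) r2 :=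
    continuous_ofReal.continuousAt.eventually (Metric.ball_mem_nhds _ hr2)
  filter_upwards [hW2, hbr] with t ht htr
  exact step1 t ht htr a hp.1

end Identity

/-! ### Integrals depending on a parameter -/

section ParametricIntegral

/-- Differentiation under the integral sign. -/
theorem hasDerivAt_intervalIntegral_of_continuousOn {𝕜 : Type*} [RCLike 𝕜] {a b : ℝ} (hab : a ≤ b)
    {F F' : 𝕜 → ℝ → ℂ} [NormedSpace 𝕜 ℂ] {s : Set 𝕜} (hs : IsOpen s)
    (hF : ContinuousOn (Function.uncurry F) (s ×ˢ Icc a b))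
    (hF' : ContinuousOn (Function.uncurry F') (s ×ˢ Icc a b))
    (hd : ∀ x ∈ s, ∀ t ∈ Icc a b, HasDerivAt (fun x => F x t) (F' x t) x) {x : 𝕜} (hx : x ∈ s) :
    HasDerivAt (fun x => ∫ t in a..b, F x t) (∫ t in a..b, F' x t) x := by
  obtain ⟨r, hr, hrs⟩ := Metric.nhds_basis_closedBall.mem_iff.1 (hs.mem_nhds hx)
  have hK : IsCompact (Metric.closedBall x r ×ˢ Icc a b) :=
    (isCompact_closedBall x r).prod isCompact_Icc
  obtain ⟨C, hC⟩ := hK.exists_bound_of_continuousOn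
    (hF'.mono (prod_mono hrs Subset.rfl))
  have hslice : ∀ {G : 𝕜 → ℝ → ℂ}, ContinuousOn (Function.uncurry G) (s ×ˢ Icc a b) →
      ∀ y ∈ s, ContinuousOn (G y) (Icc a b) := fun hG y hy =>
    hG.comp (f := fun t => (y, t)) (by fun_prop) fun t ht => ⟨hy, ht⟩
  have huI : uIoc a b ⊆ Icc a b := by rw [uIoc_of_le hab]; exact Ioc_subset_Icc_self
  have hint : ∀ {G : 𝕜 → ℝ → ℂ}, ContinuousOn (Function.uncurry G) (s ×ˢ Icc a b) →
      ∀ y ∈ s, IntervalIntegrable (G y) MeasureTheory.volume a b := fun hG y hy => by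
    apply ContinuousOn.intervalIntegrable
    rw [uIcc_of_le hab]
    exact hslice hG y hy
  refine (intervalIntegral.hasDerivAt_integral_of_dominated_loc_of_deriv_le
    (bound := fun _ => C) (Metric.closedBall_mem_nhds x hr) ?_ (hint hF x hx) ?_ ?_ ?_ ?_).2
  · filter_upwards [hs.mem_nhds hx] with y hy
    exact (intervalIntegrable_iff.1 (hint hF y hy)).aestronglyMeasurable
  · exact (intervalIntegrable_iff.1 (hint hF' x hx)).aestronglyMeasurable
  · exact Eventually.of_forall fun t ht y hy => hC (y, t) ⟨hy, huI ht⟩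
  · exact intervalIntegrable_const
  · exact Eventually.of_forall fun t ht y hy => hd y (hrs hy) t (huI ht)

end ParametricIntegral

/-! ## The Riemann function of the Helmholtz equation -/

/-- The entire functions `∑ (-t)^l / (l! (l+n)!)`, i.e. `t^(-n/2) J_n(2√t)`. -/
noncomputable def bess (n : ℕ) (t : ℂ) : ℂ :=
  ∑' l : ℕ, (-t) ^ l / ((l.factorial : ℂ) * ((l + n).factorial : ℂ))

theorem norm_bess_term_le (n l : ℕ) {t : ℂ} {r : ℝ} (ht : ‖t‖ ≤ r) :
    ‖(-t) ^ l / ((l.factorial : ℂ) * ((l + n).factorial : ℂ))‖ ≤ r ^ l / l.factorial := by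
  rw [norm_div, norm_pow, norm_neg, norm_mul, Complex.norm_natCast, Complex.norm_natCast]
  have h1 : (1 : ℝ) ≤ ((l + n).factorial : ℝ) := by exact_mod_cast Nat.succ_le_of_lt (Nat.factorial_pos _)
  have h2 : (0 : ℝ) < (l.factorial : ℝ) := by exact_mod_cast Nat.factorial_pos _
  have h3 : (l.factorial : ℝ) ≤ l.factorial * (l + n).factorial := le_mul_of_one_le_right h2.le h1
  have : ‖t‖ ^ l ≤ r ^ l := by gcongr
  exact div_le_div₀ ((pow_nonneg (norm_nonneg t) l).trans this) this h2 h3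

theorem summable_bess (n : ℕ) (t : ℂ) :
    Summable fun l : ℕ => (-t) ^ l / ((l.factorial : ℂ) * ((l + n).factorial : ℂ)) :=
  Summable.of_norm_bounded (Real.summable_pow_div_factorial ‖t‖)
    fun l => norm_bess_term_le n l le_rfl

theorem hasDerivAt_bess (n : ℕ) (t : ℂ) : HasDerivAt (bess n) (-bess (n + 1) t) t := by
  let F : ℕ → ℂ → ℂ := fun l t => (-t) ^ l / ((l.factorial : ℂ) * ((l + n).factorial : ℂ))
  have hd : ∀ l, DifferentiableOn ℂ (F l) (Metric.ball 0 (‖t‖ + 1)) := fun l => by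
    simp only [F]; fun_prop
  have hb : ∀ l w, w ∈ Metric.ball (0 : ℂ) (‖t‖ + 1) → ‖F l w‖ ≤ (‖t‖ + 1) ^ l / l.factorial :=
    fun l w hw => norm_bess_term_le n l (mem_ball_zero_iff.1 hw).le
  have hs := Real.summable_pow_div_factorial (‖t‖ + 1)
  have ht : t ∈ Metric.ball (0 : ℂ) (‖t‖ + 1) := mem_ball_zero_iff.2 (by linarith)
  have h1 : DifferentiableAt ℂ (bess n) t :=
    (differentiableOn_tsum_of_summable_norm hs hd Metric.isOpen_ball hb).differentiableAt
      (Metric.isOpen_ball.mem_nhds ht)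
  have h2 : HasSum (fun l => deriv (F l) t) (deriv (bess n) t) :=
    hasSum_deriv_of_summable_norm hs hd Metric.isOpen_ball hb ht
  have h3 : HasSum (fun l => deriv (F l) t) (-bess (n + 1) t) := by
    rw [← hasSum_nat_add_iff' 1]
    have h4 := (summable_bess (n + 1) t).hasSum.neg
    convert h4 using 1
    · ext l
      have : HasDerivAt (F (l + 1)) (((l + 1 : ℕ) * (-t) ^ l * (-1)) /
          (((l + 1).factorial : ℂ) * ((l + 1 + n).factorial : ℂ))) t := by
        have := ((hasDerivAt_neg t).pow (l + 1)).div_const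
          (((l + 1).factorial : ℂ) * ((l + 1 + n).factorial : ℂ))
        simpa using this
      rw [this.deriv, show l + (n + 1) = l + 1 + n by ring, Nat.factorial_succ l]
      push_cast
      have h5 : ((l : ℂ) + 1) ≠ 0 := by exact_mod_cast Nat.succ_ne_zero l
      have h6 : (l.factorial : ℂ) ≠ 0 := by exact_mod_cast Nat.factorial_ne_zero l
      have h7 : ((l + 1 + n).factorial : ℂ) ≠ 0 := by exact_mod_cast Nat.factorial_ne_zero _
      field_simp
    · have : F 0 = fun _ => 1 / ((n.factorial : ℂ)) := by ext; simp [F]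
      simp [this, bess]
  rw [← h2.unique h3]
  exact h1.hasDerivAt

@[simp] theorem bess_zero_zero : bess 0 0 = 1 := by
  rw [bess, tsum_eq_single 0]
  · simp
  · intro l hl
    simp [hl]

/-- This is Bessel's equation tJ'' + J' + J = 0 for J = `bess 0`, as J' = −`bess 1` and J'' = `bess
2`. It is the reason why the Riemann function solves the Helmholtz equation. -/
theorem bess_rec (t : ℂ) : bess 0 t = bess 1 t - t * bess 2 t := by
  have h0 := summable_bess 0 t
  have h1 := summable_bess 1 t
  have h2 := summable_bess 2 t
  have e1 := h1.tsum_eq_zero_add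
  have e0 := h0.tsum_eq_zero_add
  unfold bess
  rw [e0, e1, ← tsum_mul_left, add_sub_assoc, ← Summable.tsum_sub ((summable_nat_add_iff 1).2 h1)
    (h2.mul_left t)]
  simp only [pow_zero, Nat.factorial_zero, zero_add, Nat.factorial_one, add_zero]
  congr 1
  · congr 1; ext l
    rw [Nat.factorial_succ (l + 1), Nat.factorial_succ l, pow_succ]
    push_cast
    have h5 : ((l : ℂ) + 1) ≠ 0 := by exact_mod_cast Nat.succ_ne_zero l
    have h5' : ((l : ℂ) + 1 + 1) ≠ 0 := by exact_mod_cast Nat.succ_ne_zero (l + 1)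
    have h6 : (l.factorial : ℂ) ≠ 0 := by exact_mod_cast Nat.factorial_ne_zero l
    field_simp
    ring

@[fun_prop]
theorem continuous_bess (n : ℕ) : Continuous (bess n) :=
  continuous_iff_continuousAt.2 fun t => (hasDerivAt_bess n t).continuousAt

/-! ## Wirtinger derivatives -/

/-- The real-linear map `v ↦ a v + b v̄`. -/
noncomputable def wirt (a b : ℂ) : ℂ →L[ℝ] ℂ :=
  a • ContinuousLinearMap.id ℝ ℂ + b • (conjCLE : ℂ →L[ℝ] ℂ)

@[simp] theorem wirt_apply (a b v : ℂ) : wirt a b v = a * v + b * (starRingEnd ℂ) v := by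
  simp [wirt]

theorem wirt_comp (a b c d : ℂ) : (wirt a b).comp (wirt c d) =
    wirt (a * c + b * (starRingEnd ℂ) d) (a * d + b * (starRingEnd ℂ) c) := by
  ext1 v; simp; ring

theorem ContinuousAt.wirt {X : Type*} [TopologicalSpace X] {a b : X → ℂ} {x : X}
    (ha : ContinuousAt a x) (hb : ContinuousAt b x) : ContinuousAt (fun x => wirt (a x) (b x)) x := by
  unfold _root_.wirt; fun_prop

theorem hasFDerivAt_wirt_fun {E : Type*} [NormedAddCommGroup E] [NormedSpace ℝ E] {a b : E → ℂ}
    {a' b' : E →L[ℝ] ℂ} {x : E} (ha : HasFDerivAt a a' x) (hb : HasFDerivAt b b' x) :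
    HasFDerivAt (fun x => wirt (a x) (b x)) (a'.smulRight (ContinuousLinearMap.id ℝ ℂ) +
      b'.smulRight (conjCLE : ℂ →L[ℝ] ℂ)) x := by
  have h1 := ha.smul_const (ContinuousLinearMap.id ℝ ℂ)
  have h2 := hb.smul_const (conjCLE : ℂ →L[ℝ] ℂ)
  exact h1.add h2

theorem HasDerivAt.hasFDerivAt_wirt {f : ℂ → ℂ} {c τ : ℂ} (h : HasDerivAt f c τ) :
    HasFDerivAt f (wirt c 0) τ :=
  (h.hasFDerivAt.restrictScalars ℝ).congr_fderiv (by ext1 v; simp [mul_comm])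

theorem hasDerivAt_of_wirt {f : ℂ → ℂ} {c τ : ℂ} (h : HasFDerivAt f (wirt c 0) τ) :
    HasDerivAt f c τ := by
  rw [hasDerivAt_iff_hasFDerivAt]
  refine hasFDerivAt_of_restrictScalars ℝ h ?_
  ext1 v; simp [mul_comm]

theorem hasFDerivAt_conj (y : ℂ) :
    HasFDerivAt (fun s : ℂ => (starRingEnd ℂ) s) (wirt 0 1) y :=
  (conjCLE : ℂ →L[ℝ] ℂ).hasFDerivAt.congr_fderiv (by ext1 v; simp)

theorem hasDerivAt_conj_of_wirt {f : ℂ → ℂ} {c s : ℂ}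
    (h : HasFDerivAt f (wirt 0 c) ((starRingEnd ℂ) s)) :
    HasDerivAt (fun s => f ((starRingEnd ℂ) s)) c s :=
  hasDerivAt_of_wirt ((HasFDerivAt.comp s h (hasFDerivAt_conj s)).congr_fderiv (by
    rw [wirt_comp]; simp))

theorem HasDerivAt.hasFDerivAt_conj {f : ℂ → ℂ} {c τ : ℂ} (h : HasDerivAt f c τ) :
    HasFDerivAt (fun s => (starRingEnd ℂ) (f s)) (wirt 0 ((starRingEnd ℂ) c)) τ :=
  ((conjCLE : ℂ →L[ℝ] ℂ).hasFDerivAt.comp τ h.hasFDerivAt_wirt).congr_fderiv (by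
    ext1 v; simp)

/-- The Wirtinger derivative `∂f/∂z`. -/
noncomputable def dz (f : ℂ → ℂ) (τ : ℂ) : ℂ := (fderiv ℝ f τ 1 - I * fderiv ℝ f τ I) / 2

/-- The Wirtinger derivative `∂f/∂z̄`. -/
noncomputable def dzb (f : ℂ → ℂ) (τ : ℂ) : ℂ := (fderiv ℝ f τ 1 + I * fderiv ℝ f τ I) / 2

theorem eq_wirt (L : ℂ →L[ℝ] ℂ) : L = wirt ((L 1 - I * L I) / 2) ((L 1 + I * L I) / 2) := by
  ext1 v
  have : v = v.re • (1 : ℂ) + v.im • I := by simp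
  have h2 : (starRingEnd ℂ) v = v.re - v.im * I := by
    apply Complex.ext <;> simp
  have h3 : v = v.re + v.im * I := (re_add_im v).symm
  conv_lhs => rw [this, map_add, map_smul, map_smul]
  rw [wirt_apply, h2]
  conv_rhs => enter [1, 2]; rw [h3]
  simp only [real_smul]
  ring_nf
  simp

theorem DifferentiableAt.hasFDerivAt_wirt {f : ℂ → ℂ} {τ : ℂ} (h : DifferentiableAt ℝ f τ) :
    HasFDerivAt f (wirt (dz f τ) (dzb f τ)) τ := by
  have := h.hasFDerivAt
  rwa [eq_wirt (fderiv ℝ f τ)] at this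

theorem dz_eq_of_hasFDerivAt {f : ℂ → ℂ} {a b τ : ℂ} (h : HasFDerivAt f (wirt a b) τ) :
    dz f τ = a := by
  rw [dz, h.fderiv]; simp; ring_nf; simp; ring

theorem dzb_eq_of_hasFDerivAt {f : ℂ → ℂ} {a b τ : ℂ} (h : HasFDerivAt f (wirt a b) τ) :
    dzb f τ = b := by
  rw [dzb, h.fderiv]; simp; ring_nf; simp; ring

theorem Filter.EventuallyEq.dz_eq {f g : ℂ → ℂ} {τ : ℂ} (h : f =ᶠ[𝓝 τ] g) : dz f τ = dz g τ := by
  rw [dz, dz, h.fderiv_eq]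

/-! ## Solutions, in a holomorphic parameter -/

/-- A convex domain `Ω` mapped to the plane by a holomorphic function `x` with derivative `dx`. -/
structure Dev (x dx : ℂ → ℂ) (Ω : Set ℂ) : Prop where
  isOpen : IsOpen Ω
  convex : Convex ℝ Ω
  hasDerivAt : ∀ τ ∈ Ω, HasDerivAt x (dx τ) τ
  differentiableAt : ∀ τ ∈ Ω, DifferentiableAt ℂ dx τ

/-- `f` is a solution of the Helmholtz equation `f_{z z̄} = -κ f`, written in the parameter `τ`
with `dz = dx(τ) dτ`. -/
def Sol (κ : ℂ) (dx : ℂ → ℂ) (Ω : Set ℂ) (f : ℂ → ℂ) : Prop :=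
  ∀ τ ∈ Ω, DifferentiableAt ℝ f τ ∧
    ∃ e, HasFDerivAt (dz f) (wirt e (-κ * (dx τ * (starRingEnd ℂ) (dx τ)) * f τ)) τ

/-- The Riemann function. -/
noncomputable def riem (κ x : ℂ) (A : ℂ × ℂ) : ℂ :=
  bess 0 (κ * (x - A.1) * ((starRingEnd ℂ) x - A.2))

/-- The derivative of the Riemann function with respect to `x̄`. -/
noncomputable def riemBar (κ x : ℂ) (A : ℂ × ℂ) : ℂ :=
  -κ * (x - A.1) * bess 1 (κ * (x - A.1) * ((starRingEnd ℂ) x - A.2))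

/-- The derivative of the Riemann function with respect to `x`. -/
noncomputable def riemHol (κ x : ℂ) (A : ℂ × ℂ) : ℂ :=
  -κ * ((starRingEnd ℂ) x - A.2) * bess 1 (κ * (x - A.1) * ((starRingEnd ℂ) x - A.2))

@[fun_prop]
theorem continuous_riem (κ : ℂ) : Continuous fun q : ℂ × (ℂ × ℂ) => riem κ q.1 q.2 := by
  unfold riem
  have : Continuous fun q : ℂ × (ℂ × ℂ) => (starRingEnd ℂ) q.1 := continuous_conj.comp continuous_fst
  fun_prop

@[fun_prop]
theorem continuous_riemBar (κ : ℂ) : Continuous fun q : ℂ × (ℂ × ℂ) => riemBar κ q.1 q.2 := by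
  unfold riemBar
  have : Continuous fun q : ℂ × (ℂ × ℂ) => (starRingEnd ℂ) q.1 := continuous_conj.comp continuous_fst
  fun_prop

@[fun_prop]
theorem continuous_riemHol (κ : ℂ) : Continuous fun q : ℂ × (ℂ × ℂ) => riemHol κ q.1 q.2 := by
  unfold riemHol
  have : Continuous fun q : ℂ × (ℂ × ℂ) => (starRingEnd ℂ) q.1 := continuous_conj.comp continuous_fst
  fun_prop

theorem hasFDerivAt_id_wirt (y : ℂ) : HasFDerivAt (fun s : ℂ => s) (wirt 1 0) y :=
  (hasFDerivAt_id (𝕜 := ℝ) y).congr_fderiv (by ext1 v; simp)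

theorem hasFDerivAt_riem_arg (κ y : ℂ) (A : ℂ × ℂ) :
    HasFDerivAt (fun y => κ * (y - A.1) * ((starRingEnd ℂ) y - A.2))
      (wirt (κ * ((starRingEnd ℂ) y - A.2)) (κ * (y - A.1))) y :=
  ((((hasFDerivAt_id_wirt y).sub_const A.1).const_mul κ).mul
    ((hasFDerivAt_conj y).sub_const A.2)).congr_fderiv (by ext1 v; simp; ring)

theorem hasFDerivAt_bess_comp (n : ℕ) (κ y : ℂ) (A : ℂ × ℂ) :
    HasFDerivAt (fun y => bess n (κ * (y - A.1) * ((starRingEnd ℂ) y - A.2)))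
      (wirt (-bess (n + 1) (κ * (y - A.1) * ((starRingEnd ℂ) y - A.2)) *
          (κ * ((starRingEnd ℂ) y - A.2)))
        (-bess (n + 1) (κ * (y - A.1) * ((starRingEnd ℂ) y - A.2)) * (κ * (y - A.1)))) y :=
  (HasFDerivAt.comp y (hasDerivAt_bess n _).hasFDerivAt_wirt
    (hasFDerivAt_riem_arg κ y A)).congr_fderiv (by rw [wirt_comp]; simp)

theorem hasFDerivAt_riem (κ y : ℂ) (A : ℂ × ℂ) :
    HasFDerivAt (fun y => riem κ y A) (wirt (riemHol κ y A) (riemBar κ y A)) y :=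
  (hasFDerivAt_bess_comp 0 κ y A).congr_fderiv (by
    unfold riemHol riemBar
    congr 1 <;> ring_nf)

/-- The dz coefficient is the equation R_{z z̄} = −κR. The dz̄ coefficient is left unspecified
because it plays no role in the closedness of the Green form. -/
theorem hasFDerivAt_riemBar (κ y : ℂ) (A : ℂ × ℂ) :
    ∃ e, HasFDerivAt (fun y => riemBar κ y A) (wirt (-κ * riem κ y A) e) y := by
  refine ⟨(κ * (y - A.1)) * (κ * (y - A.1)) *
    bess 2 (κ * (y - A.1) * ((starRingEnd ℂ) y - A.2)),
    ((((hasFDerivAt_id_wirt y).sub_const A.1).const_mul (-κ)).mul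
    (hasFDerivAt_bess_comp 1 κ y A)).congr_fderiv ?_⟩
  unfold riem
  rw [bess_rec]
  ext1 v
  simp
  ring

/-- The closed 1-form of a solution `f` and of the Riemann function. -/
noncomputable def green (κ : ℂ) (x dx f : ℂ → ℂ) (A : ℂ × ℂ) (τ : ℂ) : ℂ →L[ℝ] ℂ :=
  wirt (riem κ (x τ) A * dz f τ) (f τ * riemBar κ (x τ) A * (starRingEnd ℂ) (dx τ))

/-- The form a dτ + b dτ̄ is closed as soon as ∂a/∂τ̄ = ∂b/∂τ; this common value is c. -/
theorem hasFDerivAt_wirt_symm {a b : ℂ → ℂ} {τ a1 c b2 : ℂ} (ha : HasFDerivAt a (wirt a1 c) τ)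
    (hb : HasFDerivAt b (wirt c b2) τ) : ∃ ω' : ℂ →L[ℝ] ℂ →L[ℝ] ℂ,
      HasFDerivAt (fun τ => wirt (a τ) (b τ)) ω' τ ∧ ∀ u v, ω' u v = ω' v u := by
  refine ⟨_, hasFDerivAt_wirt_fun ha hb, fun u v => ?_⟩
  simp
  ring

/-- Both cross derivatives equal −κ|dx|² R f + R_{z̄} (∂f/∂τ) times the conjugate of dx: one uses
the equation for f, the other the equation for R. The pole may be any point of ℂ², not only a real
one. -/
theorem Sol.hasFDerivAt_green {κ : ℂ} {x dx f : ℂ → ℂ} {Ω : Set ℂ} (hx : Dev x dx Ω)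
    (hf : Sol κ dx Ω f) (A : ℂ × ℂ) {τ : ℂ} (hτ : τ ∈ Ω) : ∃ ω' : ℂ →L[ℝ] ℂ →L[ℝ] ℂ,
      HasFDerivAt (green κ x dx f A) ω' τ ∧ ∀ u v, ω' u v = ω' v u := by
  obtain ⟨h1, e, h2⟩ := hf τ hτ
  have hxw := (hx.hasDerivAt τ hτ).hasFDerivAt_wirt
  have hR := HasFDerivAt.comp τ (hasFDerivAt_riem κ (x τ) A) hxw
  obtain ⟨e', hB'⟩ := hasFDerivAt_riemBar κ (x τ) A
  have hB := HasFDerivAt.comp τ hB' hxw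
  have hdx := (hx.differentiableAt τ hτ).hasDerivAt.hasFDerivAt_conj
  rw [wirt_comp] at hR hB
  have ha := hR.mul h2
  have hb := (h1.hasFDerivAt_wirt.mul hB).mul hdx
  exact hasFDerivAt_wirt_symm (a := fun τ => riem κ (x τ) A * dz f τ)
    (b := fun τ => f τ * riemBar κ (x τ) A * (starRingEnd ℂ) (dx τ))
    (a1 := riem κ (x τ) A * e + dz f τ * (riemHol κ (x τ) A * dx τ))
    (c := riem κ (x τ) A * (-κ * (dx τ * (starRingEnd ℂ) (dx τ)) * f τ) +
        dz f τ * (riemBar κ (x τ) A * (starRingEnd ℂ) (dx τ)))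
    (b2 := dzb f τ * riemBar κ (x τ) A * (starRingEnd ℂ) (dx τ) +
        f τ * (e' * (starRingEnd ℂ) (dx τ)) * (starRingEnd ℂ) (dx τ) +
        f τ * riemBar κ (x τ) A * (starRingEnd ℂ) (deriv dx τ))
    (ha.congr_fderiv (by ext1 v; simp; ring)) (hb.congr_fderiv (by ext1 v; simp; ring))

/-! ## Primitives of the Green form -/

/-- `p τ A` is a primitive, with respect to `τ`, of the Green form with pole `A`, and is entire in
`A`. -/
structure PF (κ : ℂ) (x dx : ℂ → ℂ) (Ω : Set ℂ) (f : ℂ → ℂ) (p : ℂ → ℂ × ℂ → ℂ) : Prop where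
  deriv : ∀ A, ∀ τ ∈ Ω, HasFDerivAt (fun τ => p τ A) (green κ x dx f A τ) τ
  entire : ∀ τ ∈ Ω, Differentiable ℂ (p τ)

/-- The pole enters the integrand through the entire functions `bess` and polynomials only.
Differentiation under the integral in each coordinate of the pole, combined with Osgood's lemma,
makes the primitives of the Green form entire in the pole. -/
theorem differentiable_integral_riem (κ : ℂ) {y a b : ℝ → ℂ} (hy : Continuous y)
    (ha : Continuous a) (hb : Continuous b) : Differentiable ℂ fun A : ℂ × ℂ =>
      ∫ t in (0:ℝ)..1, (riem κ (y t) A * a t + riemBar κ (y t) A * b t) := by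
  have hcy : Continuous fun t => (starRingEnd ℂ) (y t) := continuous_conj.comp hy
  have han : AnalyticOnNhd ℂ (fun A : ℂ × ℂ =>
      ∫ t in (0:ℝ)..1, (riem κ (y t) A * a t + riemBar κ (y t) A * b t)) univ := by
    refine osgood isOpen_univ ?_ (fun p _ => ?_) fun p _ => ?_
    · apply Continuous.continuousOn
      apply intervalIntegral.continuous_parametric_intervalIntegral_of_continuous'
      unfold Function.uncurry riem riemBar
      fun_prop
    · obtain ⟨-, w⟩ := p
      refine (hasDerivAt_intervalIntegral_of_continuousOn (𝕜 := ℂ) zero_le_one isOpen_univ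
        (F := fun z t => riem κ (y t) (z, w) * a t + riemBar κ (y t) (z, w) * b t)
        (F' := fun z t =>
          (-bess 1 (κ * (y t - z) * ((starRingEnd ℂ) (y t) - w)) *
            (κ * (-1) * ((starRingEnd ℂ) (y t) - w))) * a t +
          ((-κ * (-1)) * bess 1 (κ * (y t - z) * ((starRingEnd ℂ) (y t) - w)) +
            (-κ * (y t - z)) * (-bess 2 (κ * (y t - z) * ((starRingEnd ℂ) (y t) - w)) *
            (κ * (-1) * ((starRingEnd ℂ) (y t) - w)))) * b t)
        ?_ ?_ ?_ (mem_univ _)).differentiableAt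
      · apply Continuous.continuousOn
        unfold Function.uncurry riem riemBar
        fun_prop
      · apply Continuous.continuousOn
        unfold Function.uncurry
        fun_prop
      · intro z _ t _
        have h0 : HasDerivAt (fun z => κ * (y t - z) * ((starRingEnd ℂ) (y t) - w))
            (κ * (-1) * ((starRingEnd ℂ) (y t) - w)) z :=
          (((hasDerivAt_id z).const_sub (y t)).const_mul κ).mul_const _
        have h1 := (hasDerivAt_bess 0 _).comp z h0
        have h2 := (((hasDerivAt_id z).const_sub (y t)).const_mul (-κ)).mul
          ((hasDerivAt_bess 1 _).comp z h0)
        exact (h1.mul_const (a t)).add (h2.mul_const (b t))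
    · obtain ⟨z, -⟩ := p
      refine (hasDerivAt_intervalIntegral_of_continuousOn (𝕜 := ℂ) zero_le_one isOpen_univ
        (F := fun w t => riem κ (y t) (z, w) * a t + riemBar κ (y t) (z, w) * b t)
        (F' := fun w t =>
          (-bess 1 (κ * (y t - z) * ((starRingEnd ℂ) (y t) - w)) *
            (κ * (y t - z) * (-1))) * a t +
          ((-κ * (y t - z)) * (-bess 2 (κ * (y t - z) * ((starRingEnd ℂ) (y t) - w)) *
            (κ * (y t - z) * (-1)))) * b t)
        ?_ ?_ ?_ (mem_univ _)).differentiableAt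
      · apply Continuous.continuousOn
        unfold Function.uncurry riem riemBar
        fun_prop
      · apply Continuous.continuousOn
        unfold Function.uncurry
        fun_prop
      · intro w _ t _
        have h0 : HasDerivAt (fun w => κ * (y t - z) * ((starRingEnd ℂ) (y t) - w))
            (κ * (y t - z) * (-1)) w :=
          ((hasDerivAt_id w).const_sub ((starRingEnd ℂ) (y t))).const_mul _
        have h1 := (hasDerivAt_bess 0 _).comp w h0
        have h2 := ((hasDerivAt_bess 1 _).comp w h0).const_mul (-κ * (y t - z))
        exact (h1.mul_const (a t)).add (h2.mul_const (b t))
  exact fun A => (han A (mem_univ _)).differentiableAt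

theorem Sol.continuousOn {κ : ℂ} {dx f : ℂ → ℂ} {Ω : Set ℂ} (hf : Sol κ dx Ω f) :
    ContinuousOn f Ω := fun τ hτ => (hf τ hτ).1.continuousAt.continuousWithinAt

theorem Sol.continuousOn_dz {κ : ℂ} {dx f : ℂ → ℂ} {Ω : Set ℂ} (hf : Sol κ dx Ω f) :
    ContinuousOn (dz f) Ω := fun τ hτ =>
  (hf τ hτ).2.choose_spec.continuousAt.continuousWithinAt

theorem Dev.continuousOn {x dx : ℂ → ℂ} {Ω : Set ℂ} (hx : Dev x dx Ω) : ContinuousOn x Ω :=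
  fun τ hτ => (hx.hasDerivAt τ hτ).continuousAt.continuousWithinAt

theorem Dev.continuousOn_dx {x dx : ℂ → ℂ} {Ω : Set ℂ} (hx : Dev x dx Ω) : ContinuousOn dx Ω :=
  fun τ hτ => (hx.differentiableAt τ hτ).continuousAt.continuousWithinAt

/-- Primitives of the Green form exist on convex domains. -/
theorem Sol.exists_PF {κ : ℂ} {x dx f : ℂ → ℂ} {Ω : Set ℂ} (hx : Dev x dx Ω)
    (hf : Sol κ dx Ω f) : ∃ p, PF κ x dx Ω f p := by
  rcases Ω.eq_empty_or_nonempty with rfl | ⟨τ₀, h0⟩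
  · exact ⟨fun _ _ => 0, by simp, by simp⟩
  refine ⟨fun τ A => curveIntegral (green κ x dx f A) (.segment τ₀ τ), fun A τ hτ => ?_,
    fun τ hτ => ?_⟩
  · choose! ω' h1 h2 using fun τ (hτ : τ ∈ Ω) => hf.hasFDerivAt_green hx A hτ
    exact (hx.convex.hasFDerivWithinAt_curveIntegral_segment_of_hasFDerivWithinAt_symmetric
      (ω := green κ x dx f A) (dω := ω')
      (fun τ hτ => (h1 τ hτ).hasFDerivWithinAt) (fun a ha u _ v _ => h2 a ha u v) h0 hτ).hasFDerivAt
      (hx.isOpen.mem_nhds hτ)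
  -- Clamping the parameter to [0, 1] keeps the curve in Ω for all real t, so that the integrand is
  -- continuous on the whole line.
  · let c : ℝ → ℂ := fun t => AffineMap.lineMap τ₀ τ ((projIcc (0:ℝ) 1 zero_le_one t : ℝ))
    have hc : Continuous c := by
      have : Continuous fun t => ((projIcc (0:ℝ) 1 zero_le_one t : ℝ)) :=
        continuous_subtype_val.comp continuous_projIcc
      exact (AffineMap.lineMap_continuous (R := ℝ)).comp this
    have hcΩ : ∀ t, c t ∈ Ω := fun t => hx.convex.lineMap_mem h0 hτ (projIcc _ _ _ t).2
    have key := differentiable_integral_riem κ (y := fun t => x (c t))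
      (a := fun t => dz f (c t) * (τ - τ₀))
      (b := fun t => f (c t) * (starRingEnd ℂ) (dx (c t)) * (starRingEnd ℂ) (τ - τ₀))
      (hx.continuousOn.comp_continuous hc hcΩ)
      ((hf.continuousOn_dz.comp_continuous hc hcΩ).mul continuous_const)
      (((hf.continuousOn.comp_continuous hc hcΩ).mul
        (continuous_conj.comp (hx.continuousOn_dx.comp_continuous hc hcΩ))).mul continuous_const)
    convert key using 2 with A
    rw [curveIntegral_segment]
    refine intervalIntegral.integral_congr fun t ht => ?_
    rw [uIcc_of_le zero_le_one] at ht
    have : c t = AffineMap.lineMap τ₀ τ t := by simp only [c]; rw [projIcc_of_mem _ ht]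
    simp only [this, green, wirt_apply]
    ring

/-- Differentiability in the product space, from a continuous partial derivative in the first
variable and differentiability at a point in the second variable. -/
theorem hasFDerivAt_of_partial {E F G : Type*} [NormedAddCommGroup E] [NormedSpace ℝ E]
    [NormedAddCommGroup F] [NormedSpace ℝ F] [NormedAddCommGroup G] [NormedSpace ℝ G]
    {φ : E → F → G} {η : E → F → E →L[ℝ] G} {d : F →L[ℝ] G} {a : E} {b : F}
    (h1 : ∀ᶠ q : E × F in 𝓝 (a, b), HasFDerivAt (fun τ => φ τ q.2) (η q.1 q.2) q.1)
    (hc : ContinuousAt (fun q : E × F => η q.1 q.2) (a, b)) (h2 : HasFDerivAt (φ a) d b) :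
    HasFDerivAt (fun q : E × F => φ q.1 q.2) ((η a b).coprod d) (a, b) := by
  rw [hasFDerivAt_iff_isLittleO]
  have e : (fun q : E × F => φ q.1 q.2 - φ a b - ((η a b).coprod d) (q - (a, b))) = fun q =>
      (φ q.1 q.2 - φ a q.2 - η a b (q.1 - a)) + (φ a q.2 - φ a b - d (q.2 - b)) := by
    ext q; simp; abel
  rw [e]
  refine Asymptotics.IsLittleO.add ?_ ?_
  · rw [Asymptotics.isLittleO_iff]
    intro ε hε
    have h3 : ∀ᶠ q : E × F in 𝓝 (a, b), ‖η q.1 q.2 - η a b‖ ≤ ε := by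
      have := (Metric.tendsto_nhds.1 hc ε hε)
      filter_upwards [this] with q hq
      rw [← dist_eq_norm]; exact hq.le
    obtain ⟨r, hr, hb⟩ := Metric.eventually_nhds_iff_ball.1 (h1.and h3)
    filter_upwards [Metric.ball_mem_nhds _ hr] with q hq
    rw [Metric.mem_ball, Prod.dist_eq, max_lt_iff] at hq
    have hmem : ∀ τ ∈ Metric.ball a r, (τ, q.2) ∈ Metric.ball (a, b) r := fun τ hτ => by
      rw [Metric.mem_ball, Prod.dist_eq]; exact max_lt hτ hq.2
    have := (convex_ball a r).norm_image_sub_le_of_norm_hasFDerivWithin_le' (𝕜 := ℝ)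
      (f := fun τ => φ τ q.2) (f' := fun τ => η τ q.2) (φ := η a b) (C := ε)
      (fun τ hτ => (hb _ (hmem τ hτ)).1.hasFDerivWithinAt) (fun τ hτ => (hb _ (hmem τ hτ)).2)
      (Metric.mem_ball_self hr) (show q.1 ∈ Metric.ball a r from hq.1)
    refine this.trans ?_
    gcongr
    exact norm_fst_le (q - (a, b))
  · have h3 : (fun y => φ a y - φ a b - d (y - b)) =o[𝓝 b] fun y => y - b :=
      hasFDerivAt_iff_isLittleO.1 h2
    have h4 := h3.comp_tendsto (continuous_snd.tendsto (a, b))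
    refine h4.trans_isBigO (Asymptotics.isBigO_of_le _ fun q => norm_snd_le (q - (a, b)))

/-! ### Regularity of the primitives and splitting of the continuation -/

section PFLemmas

variable {κ : ℂ} {x dx f : ℂ → ℂ} {Ω : Set ℂ} {p : ℂ → ℂ × ℂ → ℂ}

theorem ContinuousAt.comp_fst {X Y Z : Type*} [TopologicalSpace X] [TopologicalSpace Y]
    [TopologicalSpace Z] {g : X → Z} {a : X} {b : Y} (hg : ContinuousAt g a) :
    ContinuousAt (fun q : X × Y => g q.1) (a, b) :=
  ContinuousAt.comp (g := g) (f := Prod.fst) (x := (a, b)) hg continuousAt_fst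

theorem ContinuousAt.star_comp {X : Type*} [TopologicalSpace X] {g : X → ℂ} {a : X}
    (hg : ContinuousAt g a) : ContinuousAt (fun q => (starRingEnd ℂ) (g q)) a :=
  ContinuousAt.comp (g := fun z : ℂ => (starRingEnd ℂ) z) continuous_conj.continuousAt hg

theorem continuousAt_green (hx : Dev x dx Ω) (hf : Sol κ dx Ω f) {τ : ℂ} (hτ : τ ∈ Ω)
    (A : ℂ × ℂ) : ContinuousAt (fun q : ℂ × (ℂ × ℂ) => green κ x dx f q.2 q.1) (τ, A) := by
  have hΩ := hx.isOpen.mem_nhds hτ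
  have c1 : ContinuousAt (fun q : ℂ × (ℂ × ℂ) => x q.1) (τ, A) :=
    (hx.continuousOn.continuousAt hΩ).comp_fst
  have c2 : ContinuousAt (fun q : ℂ × (ℂ × ℂ) => (starRingEnd ℂ) (dx q.1)) (τ, A) :=
    (hx.continuousOn_dx.continuousAt hΩ).comp_fst.star_comp
  have c3 : ContinuousAt (fun q : ℂ × (ℂ × ℂ) => f q.1) (τ, A) :=
    (hf.continuousOn.continuousAt hΩ).comp_fst
  have c4 : ContinuousAt (fun q : ℂ × (ℂ × ℂ) => dz f q.1) (τ, A) :=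
    (hf.continuousOn_dz.continuousAt hΩ).comp_fst
  have c0 : ContinuousAt (fun q : ℂ × (ℂ × ℂ) => (x q.1, q.2)) (τ, A) := c1.prodMk continuousAt_snd
  have c5 : ContinuousAt (fun q : ℂ × (ℂ × ℂ) => riem κ (x q.1) q.2) (τ, A) :=
    ContinuousAt.comp (f := fun q : ℂ × (ℂ × ℂ) => (x q.1, q.2))
      (continuous_riem κ).continuousAt c0
  have c6 : ContinuousAt (fun q : ℂ × (ℂ × ℂ) => riemBar κ (x q.1) q.2) (τ, A) :=
    ContinuousAt.comp (f := fun q : ℂ × (ℂ × ℂ) => (x q.1, q.2))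
      (continuous_riemBar κ).continuousAt c0
  unfold green
  exact ContinuousAt.wirt (c5.mul c4) ((c3.mul c6).mul c2)

/-- Joint differentiability is needed because the continuation evaluates p at poles, such as (x τ,
w), that move together with τ. -/
theorem PF.hasFDerivAt (hx : Dev x dx Ω) (hf : Sol κ dx Ω f) (hp : PF κ x dx Ω f p) {τ : ℂ}
    (hτ : τ ∈ Ω) (A : ℂ × ℂ) : HasFDerivAt (fun q : ℂ × (ℂ × ℂ) => p q.1 q.2)
      ((green κ x dx f A τ).coprod ((fderiv ℂ (p τ) A).restrictScalars ℝ)) (τ, A) := by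
  refine hasFDerivAt_of_partial (η := fun τ A => green κ x dx f A τ) ?_
    (continuousAt_green hx hf hτ A) ((hp.entire τ hτ A).hasFDerivAt.restrictScalars ℝ)
  filter_upwards [(hx.isOpen.preimage continuous_fst).mem_nhds (show (τ, A).1 ∈ Ω from hτ)]
    with q hq
  exact hp.deriv q.2 q.1 hq

theorem PF.continuousAt (hx : Dev x dx Ω) (hf : Sol κ dx Ω f) (hp : PF κ x dx Ω f p) {τ : ℂ}
    (hτ : τ ∈ Ω) (A : ℂ × ℂ) : ContinuousAt (fun q : ℂ × (ℂ × ℂ) => p q.1 q.2) (τ, A) :=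
  (hp.hasFDerivAt hx hf hτ A).continuousAt

/-- The part of the continuation of a solution that branches in the first variable only. -/
theorem PF.analyticOnNhd_hol (hx : Dev x dx Ω) (hf : Sol κ dx Ω f) (hp : PF κ x dx Ω f p) :
    AnalyticOnNhd ℂ (fun q : ℂ × ℂ => p q.1 (x q.1, q.2)) {q | q.1 ∈ Ω} := by
  refine osgood (hx.isOpen.preimage continuous_fst) (fun q hq => ?_) (fun q hq => ?_)
    fun q hq => ?_
  · have c1 : ContinuousAt (fun q : ℂ × ℂ => (q.1, (x q.1, q.2))) q :=
      continuousAt_fst.prodMk (((hx.continuousOn.continuousAt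
        (hx.isOpen.mem_nhds hq)).comp continuousAt_fst).prodMk continuousAt_snd)
    exact (ContinuousAt.comp (f := fun q : ℂ × ℂ => (q.1, (x q.1, q.2)))
      (hp.continuousAt hx hf hq _) c1).continuousWithinAt
  · obtain ⟨τ, w⟩ := q
    have h1 : HasFDerivAt (fun τ => (τ, (x τ, w)))
        ((wirt 1 0).prod ((wirt (dx τ) 0).prod 0)) τ :=
      (hasFDerivAt_id_wirt τ).prodMk (((hx.hasDerivAt τ hq).hasFDerivAt_wirt).prodMk
        (hasFDerivAt_const w τ))
    have h2 := HasFDerivAt.comp τ (hp.hasFDerivAt hx hf hq (x τ, w)) h1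
    -- At a pole with first coordinate x τ the factor x − A.1 kills `riemBar`, and `riem` equals 1:
    -- the dτ̄ component of the Green form disappears.
    refine (hasDerivAt_of_wirt (c := dz f τ + fderiv ℂ (p τ) (x τ, w) (dx τ, 0))
      (h2.congr_fderiv ?_)).differentiableAt
    ext1 v
    have e : fderiv ℂ (p τ) (x τ, w) (dx τ * v, 0) = v * fderiv ℂ (p τ) (x τ, w) (dx τ, 0) := by
      rw [← smul_eq_mul v, ← map_smul]; simp [mul_comm]
    simp [green, riem, riemBar, e]
    ring
  · exact ((hp.entire q.1 hq).comp (f := fun w => (x q.1, w))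
      ((differentiable_const _).prodMk differentiable_id)).differentiableAt

/-- The part of the continuation of a solution that branches in the second variable only. -/
theorem PF.analyticOnNhd_anti (hx : Dev x dx Ω) (hf : Sol κ dx Ω f) (hp : PF κ x dx Ω f p) :
    AnalyticOnNhd ℂ (fun q : ℂ × ℂ => f ((starRingEnd ℂ) q.2) -
      p ((starRingEnd ℂ) q.2) (q.1, (starRingEnd ℂ) (x ((starRingEnd ℂ) q.2))))
      {q | (starRingEnd ℂ) q.2 ∈ Ω} := by
  refine osgood (hx.isOpen.preimage (continuous_conj.comp continuous_snd)) (fun q hq => ?_)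
    (fun q hq => ?_) fun q hq => ?_
  · have c0 : ContinuousAt (fun q : ℂ × ℂ => (starRingEnd ℂ) q.2) q :=
      (continuous_conj.comp continuous_snd).continuousAt
    have c2 : ContinuousAt (fun q : ℂ × ℂ => (starRingEnd ℂ) (x ((starRingEnd ℂ) q.2))) q :=
      ContinuousAt.star_comp (ContinuousAt.comp (g := x)
        (f := fun q : ℂ × ℂ => (starRingEnd ℂ) q.2)
        (hx.continuousOn.continuousAt (hx.isOpen.mem_nhds hq)) c0)
    have c1 : ContinuousAt (fun q : ℂ × ℂ => ((starRingEnd ℂ) q.2,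
        (q.1, (starRingEnd ℂ) (x ((starRingEnd ℂ) q.2))))) q :=
      c0.prodMk (continuousAt_fst.prodMk c2)
    have c3 : ContinuousAt (fun q : ℂ × ℂ => f ((starRingEnd ℂ) q.2)) q :=
      ContinuousAt.comp (g := f) (f := fun q : ℂ × ℂ => (starRingEnd ℂ) q.2)
        (hf.continuousOn.continuousAt (hx.isOpen.mem_nhds hq)) c0
    exact (c3.sub (ContinuousAt.comp (g := fun q : ℂ × (ℂ × ℂ) => p q.1 q.2) (f := fun q : ℂ × ℂ => ((starRingEnd ℂ) q.2,
        (q.1, (starRingEnd ℂ) (x ((starRingEnd ℂ) q.2)))))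
      (hp.continuousAt hx hf hq _) c1)).continuousWithinAt
  · show DifferentiableAt ℂ (fun z : ℂ => f ((starRingEnd ℂ) q.2) -
        p ((starRingEnd ℂ) q.2) (z, (starRingEnd ℂ) (x ((starRingEnd ℂ) q.2)))) q.1
    refine DifferentiableAt.fun_sub (differentiableAt_const _) ?_
    have h1 := hp.entire _ hq (q.1, (starRingEnd ℂ) (x ((starRingEnd ℂ) q.2)))
    exact DifferentiableAt.comp (g := p ((starRingEnd ℂ) q.2))
      (f := fun z : ℂ => (z, (starRingEnd ℂ) (x ((starRingEnd ℂ) q.2)))) q.1 h1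
      (differentiableAt_id.prodMk (differentiableAt_const _))
  · obtain ⟨z, s⟩ := q
    obtain ⟨τ, rfl⟩ : ∃ τ, s = (starRingEnd ℂ) τ := ⟨(starRingEnd ℂ) s, by simp⟩
    have hq : τ ∈ Ω := by simpa using hq
    have h1 : HasFDerivAt (fun τ => (τ, (z, (starRingEnd ℂ) (x τ))))
        ((wirt 1 0).prod ((0 : ℂ →L[ℝ] ℂ).prod (wirt 0 ((starRingEnd ℂ) (dx τ))))) τ :=
      (hasFDerivAt_id_wirt τ).prodMk ((hasFDerivAt_const z τ).prodMk
        (hx.hasDerivAt τ hq).hasFDerivAt_conj)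
    have h2 := HasFDerivAt.comp τ (hp.hasFDerivAt hx hf hq (z, (starRingEnd ℂ) (x τ))) h1
    have h3 := (hf τ hq).1.hasFDerivAt_wirt.sub h2
    -- At a pole whose second coordinate is the conjugate of x τ, `riem` equals 1, so the dτ
    -- components of f and of its primitive cancel. What remains is antiholomorphic in τ, hence
    -- holomorphic in its conjugate.
    refine (hasDerivAt_conj_of_wirt (f := fun τ => f τ - p τ (z, (starRingEnd ℂ) (x τ)))
      (c := dzb f τ - f τ * riemBar κ (x τ) (z, (starRingEnd ℂ) (x τ)) * (starRingEnd ℂ) (dx τ) -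
        fderiv ℂ (p τ) (z, (starRingEnd ℂ) (x τ)) (0, (starRingEnd ℂ) (dx τ)))
      ?_).differentiableAt
    rw [Complex.conj_conj]
    refine h3.congr_fderiv ?_
    ext1 v
    have e : fderiv ℂ (p τ) (z, (starRingEnd ℂ) (x τ))
        (0, (starRingEnd ℂ) (dx τ) * (starRingEnd ℂ) v) =
        (starRingEnd ℂ) v * fderiv ℂ (p τ) (z, (starRingEnd ℂ) (x τ))
          (0, (starRingEnd ℂ) (dx τ)) := by
      rw [← smul_eq_mul ((starRingEnd ℂ) v), ← map_smul]; simp [mul_comm]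
    simp [green, riem, e]
    ring

/-- Two families of primitives differ by an entire function. -/
theorem PF.exists_entire {p' : ℂ → ℂ × ℂ → ℂ} {Ω' : Set ℂ} {f' : ℂ → ℂ} (hΩ' : IsOpen Ω')
    (hcΩ' : IsPreconnected Ω') (hp : PF κ x dx Ω f p) (hp' : PF κ x dx Ω' f' p') (hs : Ω' ⊆ Ω)
    (hff : EqOn f f' Ω') :
    ∃ J : ℂ × ℂ → ℂ, Differentiable ℂ J ∧ ∀ τ ∈ Ω', ∀ A, p' τ A = p τ A + J A := by
  rcases Ω'.eq_empty_or_nonempty with rfl | ⟨τ₀, h0⟩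
  · exact ⟨fun _ => 0, differentiable_const _, by simp⟩
  refine ⟨fun A => p' τ₀ A - p τ₀ A, (hp'.entire τ₀ h0).sub (hp.entire τ₀ (hs h0)),
    fun τ hτ A => ?_⟩
  have hd : ∀ τ ∈ Ω', HasFDerivAt (fun τ => p' τ A - p τ A) (0 : ℂ →L[ℝ] ℂ) τ := fun τ hτ => by
    have h1 := (hp'.deriv A τ hτ).sub (hp.deriv A τ (hs hτ))
    refine h1.congr_fderiv ?_
    have : dz f τ = dz f' τ := Filter.EventuallyEq.dz_eq (hff.eventuallyEq_of_mem (hΩ'.mem_nhds hτ))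
    rw [green, green, this, hff hτ, sub_self]
  have := hΩ'.is_const_of_fderiv_eq_zero (𝕜 := ℝ) hcΩ'
    (fun τ hτ => (hd τ hτ).differentiableAt.differentiableWithinAt)
    (fun τ hτ => (hd τ hτ).fderiv) hτ h0
  simp only at this ⊢
  linear_combination this

theorem PF.add_entire {J : ℂ × ℂ → ℂ} (hp : PF κ x dx Ω f p) (hJ : Differentiable ℂ J) :
    PF κ x dx Ω f fun τ A => p τ A + J A where
  deriv A τ hτ := (hp.deriv A τ hτ).add_const _
  entire τ hτ := (hp.entire τ hτ).add hJ

theorem PF.sub {g : ℂ → ℂ} {q : ℂ → ℂ × ℂ → ℂ} (hf : Sol κ dx Ω f) (hg : Sol κ dx Ω g)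
    (hp : PF κ x dx Ω f p) (hq : PF κ x dx Ω g q) :
    PF κ x dx Ω (fun τ => f τ - g τ) fun τ A => p τ A - q τ A where
  deriv A τ hτ := by
    refine ((hp.deriv A τ hτ).sub (hq.deriv A τ hτ)).congr_fderiv ?_
    have : dz (fun τ => f τ - g τ) τ = dz f τ - dz g τ := by
      rw [dz_eq_of_hasFDerivAt (a := dz f τ - dz g τ) (b := dzb f τ - dzb g τ)]
      refine ((hf τ hτ).1.hasFDerivAt_wirt.sub (hg τ hτ).1.hasFDerivAt_wirt).congr_fderiv ?_
      ext1 v; simp; ring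
    rw [green, green, green, this]
    ext1 v; simp; ring
  entire τ hτ := (hp.entire τ hτ).sub (hq.entire τ hτ)

end PFLemmas

/-! ## Decaying solutions of a Bessel-type equation -/

section ODE

variable {κ : ℂ} {μ t₀ : ℝ} {φ : ℂ → ℂ}

/-- The equation says (tφ' − μφ)' = −κφ. If φ is bounded, tφ' − μφ grows at most linearly, and
division by t bounds φ'. -/
theorem deriv_bounded_of_ode (ht₀ : 1 ≤ t₀) (hφ : Differentiable ℂ φ)
    (hode : ∀ t, t * deriv (deriv φ) t + (1 - μ) * deriv φ t + κ * φ t = 0)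
    {C₀ : ℝ} (hC : ∀ t : ℝ, t₀ ≤ t → ‖φ t‖ ≤ C₀) : ∃ C, ∀ t : ℝ, t₀ ≤ t → ‖deriv φ t‖ ≤ C := by
  have hφ' : Differentiable ℂ (deriv φ) := hφ.deriv
  let g : ℝ → ℂ := fun t => t * deriv φ t - μ * φ t
  have hg : ∀ t : ℝ, HasDerivAt g (-κ * φ t) t := fun t => by
    have h1 : HasDerivAt (fun z : ℂ => z * deriv φ z - μ * φ z) (-κ * φ t) (t : ℂ) := by
      have := ((hasDerivAt_id (t : ℂ)).mul (hφ' t).hasDerivAt).sub ((hφ t).hasDerivAt.const_mul (μ : ℂ))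
      refine this.congr_deriv ?_
      simp only [id]
      linear_combination hode t
    exact h1.comp_ofReal
  have hC₀ : 0 ≤ C₀ := (norm_nonneg _).trans (hC t₀ le_rfl)
  refine ⟨‖g t₀‖ + ‖κ‖ * C₀ + |μ| * C₀, fun t ht => ?_⟩
  have h2 : ‖g t - g t₀‖ ≤ ‖κ‖ * C₀ * ‖t - t₀‖ := by
    refine (convex_Ici t₀).norm_image_sub_le_of_norm_hasDerivWithin_le
      (fun s _ => (hg s).hasDerivWithinAt) (fun s hs => ?_) self_mem_Ici ht
    rw [norm_mul, norm_neg]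
    gcongr
    exact hC s hs
  have h0 : 0 < t := by linarith
  have h3 : t * ‖deriv φ t‖ ≤ t * (‖g t₀‖ + ‖κ‖ * C₀ + |μ| * C₀) := by
    calc t * ‖deriv φ t‖ = ‖g t + μ * φ t‖ := by
          simp only [g]; rw [sub_add_cancel, norm_mul, norm_real, Real.norm_of_nonneg h0.le]
      _ ≤ ‖g t₀‖ + ‖g t - g t₀‖ + |μ| * C₀ := by
          refine (norm_add_le _ _).trans (add_le_add ?_ ?_)
          · simpa using norm_add_le (g t₀) (g t - g t₀)
          · rw [norm_mul, norm_real, Real.norm_eq_abs]; gcongr; exact hC t ht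
      _ ≤ ‖g t₀‖ + ‖κ‖ * C₀ * t + |μ| * C₀ := by
          gcongr
          refine h2.trans ?_
          gcongr
          rw [Real.norm_of_nonneg (by linarith)]; linarith
      _ ≤ _ := by
          have h1t : 1 ≤ t := ht₀.trans ht
          have : 0 ≤ ‖g t₀‖ + |μ| * C₀ := by positivity
          nlinarith
  exact le_of_mul_le_mul_left h3 h0

/-- An interpolation inequality between φ and φ''. The equation bounds φ'', so a difference quotient
of step h gives |φ'| ≤ 2 sup|φ|/h + Ch. With h = t^{−N}, and the decay of φ used to order 2N, both
terms are O(t^{−N}). -/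
theorem deriv_decay_of_ode (ht₀ : 1 ≤ t₀) (hφ : Differentiable ℂ φ)
    (hode : ∀ t, t * deriv (deriv φ) t + (1 - μ) * deriv φ t + κ * φ t = 0)
    (hC : ∀ N : ℕ, ∃ C, ∀ t : ℝ, t₀ ≤ t → ‖φ t‖ * t ^ N ≤ C) (N : ℕ) :
    ∃ C, ∀ t : ℝ, t₀ ≤ t → ‖deriv φ t‖ * t ^ N ≤ C := by
  have hφ' : Differentiable ℂ (deriv φ) := hφ.deriv
  obtain ⟨C₀, h0⟩ := hC 0
  simp only [pow_zero, mul_one] at h0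
  obtain ⟨C₁, h1⟩ := deriv_bounded_of_ode ht₀ hφ hode h0
  have hC0 : 0 ≤ C₀ := (norm_nonneg _).trans (h0 t₀ le_rfl)
  have hC1 : 0 ≤ C₁ := (norm_nonneg _).trans (h1 t₀ le_rfl)
  set C₂ := ‖(1 - μ : ℂ)‖ * C₁ + ‖κ‖ * C₀ with hC₂
  have h2 : ∀ t : ℝ, t₀ ≤ t → ‖deriv (deriv φ) t‖ ≤ C₂ := fun t ht => by
    have h3 : (t : ℂ) * deriv (deriv φ) t = -((1 - μ) * deriv φ t + κ * φ t) := by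
      linear_combination hode t
    have h4 : t * ‖deriv (deriv φ) t‖ ≤ C₂ := by
      have : t * ‖deriv (deriv φ) t‖ = ‖(t : ℂ) * deriv (deriv φ) t‖ := by
        rw [norm_mul, norm_real, Real.norm_of_nonneg (by linarith)]
      rw [this, h3, norm_neg]
      refine (norm_add_le _ _).trans ?_
      rw [norm_mul, norm_mul, hC₂]
      gcongr
      · exact h1 t ht
      · exact h0 t ht
    have := norm_nonneg (deriv (deriv φ) t)
    nlinarith
  obtain ⟨C, hCN⟩ := hC (2 * N)
  refine ⟨2 * C + C₂, fun t ht => ?_⟩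
  have htpos : 0 < t := by linarith
  set h : ℝ := (t ^ N)⁻¹ with hh
  have hpos : 0 < h := by positivity
  have hd : ∀ s : ℝ, HasDerivAt (fun s : ℝ => φ s - s * deriv φ t) (deriv φ s - deriv φ t) s := fun s => by
    have e1 : HasDerivAt (fun z : ℂ => φ z - z * deriv φ t) (deriv φ s - 1 * deriv φ t) (s : ℂ) :=
      (hφ s).hasDerivAt.sub ((hasDerivAt_id _).mul_const _)
    simpa using e1.comp_ofReal
  have hd2 : ∀ s ∈ Icc t (t + h), ‖deriv φ s - deriv φ t‖ ≤ C₂ * h := fun s hs => by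
    have := (convex_Icc t (t + h)).norm_image_sub_le_of_norm_hasDerivWithin_le
      (f := fun s : ℝ => deriv φ s) (f' := fun s : ℝ => deriv (deriv φ) s) (C := C₂)
      (fun s _ => (hφ' s).hasDerivAt.comp_ofReal.hasDerivWithinAt)
      (fun s hs => h2 s (ht.trans hs.1)) (left_mem_Icc.2 (by linarith)) hs
    refine this.trans ?_
    have hC2 : 0 ≤ C₂ := (norm_nonneg _).trans (h2 t ht)
    gcongr
    rw [Real.norm_of_nonneg (by linarith [hs.1])]; linarith [hs.2]
  have h5 := (convex_Icc t (t + h)).norm_image_sub_le_of_norm_hasDerivWithin_le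
      (fun s _ => (hd s).hasDerivWithinAt) hd2 (left_mem_Icc.2 (by linarith))
      (right_mem_Icc.2 (by linarith : t ≤ t + h))
  have hth : t ≤ t + h := by linarith
  have hb : ∀ s : ℝ, t ≤ s → ‖φ s‖ ≤ C * h ^ 2 := fun s hs => by
    have e1 := hCN s (ht.trans hs)
    have e2 : ‖φ s‖ * t ^ (2 * N) ≤ C := le_trans (by gcongr) e1
    have e3 : t ^ (2 * N) * h ^ 2 = 1 := by rw [hh]; field_simp; ring
    calc ‖φ s‖ = ‖φ s‖ * t ^ (2 * N) * h ^ 2 := by rw [mul_assoc, e3, mul_one]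
      _ ≤ C * h ^ 2 := by gcongr
  have h6 : h * ‖deriv φ t‖ ≤ 2 * (C * h ^ 2) + C₂ * h * h := by
    have e : (h : ℂ) * deriv φ t = φ ((t + h : ℝ) : ℂ) - φ t -
        ((φ ((t + h : ℝ) : ℂ) - ((t + h : ℝ) : ℂ) * deriv φ t) - (φ t - t * deriv φ t)) := by
      push_cast; ring
    have e2 : h * ‖deriv φ t‖ = ‖(h : ℂ) * deriv φ t‖ := by
      rw [norm_mul, norm_real, Real.norm_of_nonneg hpos.le]
    rw [e2, e]
    refine (norm_sub_le _ _).trans (add_le_add ((norm_sub_le _ _).trans ?_) (h5.trans_eq ?_))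
    · linarith [hb _ hth, hb t le_rfl]
    · rw [add_sub_cancel_left, Real.norm_of_nonneg hpos.le]
  have h7 : ‖deriv φ t‖ ≤ (2 * C + C₂) * h := by
    refine le_of_mul_le_mul_left (h6.trans_eq ?_) hpos
    ring
  calc ‖deriv φ t‖ * t ^ N ≤ (2 * C + C₂) * h * t ^ N := by gcongr
    _ = 2 * C + C₂ := by rw [hh]; field_simp

/-- An energy identity: W = t^{1−μ} Im(φ' φ̄) has derivative −t^{−μ} Im κ |φ|² on t > 0. As μ < 1, W
vanishes at 0; by decay it tends to 0 at infinity. Being monotone, it is identically zero, and so is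
φ on the positive axis. -/
theorem eq_zero_of_ode_of_lt_one (hκ : 0 < κ.im) (hμ : μ < 1) (ht₀ : 1 ≤ t₀)
    (hφ : Differentiable ℂ φ)
    (hode : ∀ t, t * deriv (deriv φ) t + (1 - μ) * deriv φ t + κ * φ t = 0)
    (hC : ∀ N : ℕ, ∃ C, ∀ t : ℝ, t₀ ≤ t → ‖φ t‖ * t ^ N ≤ C) : φ = 0 := by
  have hφ' : Differentiable ℂ (deriv φ) := hφ.deriv
  let e : ℝ → ℝ := fun t => (deriv φ t * (starRingEnd ℂ) (φ t)).im
  let W : ℝ → ℝ := fun t => t ^ (1 - μ) * e t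
  have he : ∀ t : ℝ, HasDerivAt e (deriv (deriv φ) t * (starRingEnd ℂ) (φ t)).im t := fun t => by
    have h1 := (hφ' t).hasDerivAt.comp_ofReal
    have h2 := (conjCLE : ℂ →L[ℝ] ℂ).hasFDerivAt.comp_hasDerivAt t (hφ t).hasDerivAt.comp_ofReal
    have h3 := imCLM.hasFDerivAt.comp_hasDerivAt t (h1.mul h2)
    refine h3.congr_deriv ?_
    simp
    ring
  have hWc : ContinuousOn W (Ici 0) := by
    refine ContinuousOn.mul ?_ fun t _ => (he t).continuousAt.continuousWithinAt
    exact (Real.continuous_rpow_const (by linarith)).continuousOn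
  have hW : ∀ t : ℝ, 0 < t → HasDerivAt W (-(t ^ (-μ) * (κ.im * normSq (φ t)))) t := fun t ht => by
    have h1 := (Real.hasDerivAt_rpow_const (x := t) (p := 1 - μ) (Or.inl ht.ne')).mul (he t)
    refine h1.congr_deriv ?_
    have e1 : t ^ (1 - μ) = t ^ (-μ) * t := by
      rw [← Real.rpow_add_one ht.ne']; congr 1; ring
    have e2 : t * (deriv (deriv φ) t * (starRingEnd ℂ) (φ t)).im =
        -(1 - μ) * e t - κ.im * normSq (φ t) := by
      have h3 : (t : ℂ) * deriv (deriv φ) t * (starRingEnd ℂ) (φ t) =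
          -(1 - μ) * (deriv φ t * (starRingEnd ℂ) (φ t)) - κ * normSq (φ t) := by
        rw [← mul_conj]
        linear_combination hode t * (starRingEnd ℂ) (φ t)
      have h4 := congrArg Complex.im h3
      rw [mul_assoc, im_ofReal_mul] at h4
      rw [h4]
      have : (-(1 - μ : ℂ)) = ((-(1 - μ) : ℝ) : ℂ) := by push_cast; ring
      rw [this, sub_im, im_ofReal_mul, im_mul_ofReal]
    rw [e1, mul_assoc (t ^ (-μ)), e2]
    have : (1 - μ - 1) = -μ := by ring
    rw [this]
    simp only [e]
    ring
  have hanti : AntitoneOn W (Ici 0) := by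
    refine antitoneOn_of_deriv_nonpos (convex_Ici 0) hWc ?_ ?_
    · rw [interior_Ici]
      exact fun t ht => (hW t ht).differentiableAt.differentiableWithinAt
    · rw [interior_Ici]
      intro t ht
      rw [(hW t ht).deriv]
      have h1 : 0 ≤ t ^ (-μ) := Real.rpow_nonneg (le_of_lt ht) _
      have := normSq_nonneg (φ t)
      have : 0 ≤ t ^ (-μ) * (κ.im * normSq (φ t)) := by positivity
      linarith
  have hW0 : W 0 = 0 := by
    simp only [W]; rw [Real.zero_rpow (by linarith), zero_mul]
  have hlim : Tendsto W atTop (𝓝 0) := by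
    obtain ⟨C₀, h0⟩ := hC 0
    simp only [pow_zero, mul_one] at h0
    obtain ⟨C₁, h1⟩ := deriv_bounded_of_ode ht₀ hφ hode h0
    obtain ⟨N, hN⟩ := exists_nat_ge (2 - μ)
    obtain ⟨C, hCN⟩ := hC N
    have hC1 : 0 ≤ C₁ := (norm_nonneg _).trans (h1 t₀ le_rfl)
    have hlim2 : Tendsto (fun t : ℝ => C₁ * C * t⁻¹) atTop (𝓝 0) := by
      simpa using tendsto_inv_atTop_zero.const_mul (C₁ * C)
    refine squeeze_zero_norm' ?_ hlim2
    filter_upwards [eventually_ge_atTop t₀] with t ht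
    have ht0 : 0 < t := by linarith
    have h2 : |e t| ≤ C₁ * ‖φ t‖ := by
      refine (abs_im_le_norm _).trans ?_
      rw [norm_mul, RCLike.norm_conj]
      gcongr
      exact h1 t ht
    have h3 : t ^ (1 - μ) ≤ t ^ N * t⁻¹ := by
      have : t ^ N * t⁻¹ = t ^ ((N : ℝ) - 1) := by
        rw [Real.rpow_sub_one ht0.ne', Real.rpow_natCast]; rfl
      rw [this]
      exact Real.rpow_le_rpow_of_exponent_le (ht₀.trans ht) (by linarith)
    simp only [W]
    rw [norm_mul, Real.norm_eq_abs, Real.norm_eq_abs, abs_of_nonneg (Real.rpow_nonneg ht0.le _)]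
    calc t ^ (1 - μ) * |e t| ≤ (t ^ N * t⁻¹) * (C₁ * ‖φ t‖) := by gcongr
      _ = C₁ * (‖φ t‖ * t ^ N) * t⁻¹ := by ring
      _ ≤ C₁ * C * t⁻¹ := by gcongr; exact hCN t ht
  have hWz : ∀ t : ℝ, 0 ≤ t → W t = 0 := fun t ht => by
    refine le_antisymm ?_ ?_
    · rw [← hW0]; exact hanti self_mem_Ici ht ht
    · refine le_of_tendsto hlim ?_
      filter_upwards [eventually_ge_atTop t] with s hs
      exact hanti ht (ht.trans hs) hs
  have hz : ∀ t : ℝ, 0 < t → φ t = 0 := fun t ht => by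
    have h1 : HasDerivAt W 0 t := (hasDerivAt_const t (0 : ℝ)).congr_of_eventuallyEq (by
      filter_upwards [lt_mem_nhds ht] with s hs
      exact hWz s hs.le)
    have h2 := (hW t ht).unique h1
    have h3 : 0 < t ^ (-μ) := Real.rpow_pos_of_pos ht _
    have h4 : normSq (φ t) = 0 := by
      have h5 : t ^ (-μ) * (κ.im * normSq (φ t)) = 0 := by linarith
      simpa [h3.ne', hκ.ne'] using h5
    exact normSq_eq_zero.1 h4
  have han : AnalyticOnNhd ℂ φ univ := fun z _ => hφ.analyticAt z
  have := han.eqOn_zero_of_preconnected_of_eventuallyEq_zero isPreconnected_univ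
    (mem_univ ((1 : ℝ) : ℂ)) ((hφ.analyticAt _).eventually_eq_zero_of_real (by
      filter_upwards [lt_mem_nhds one_pos] with s hs
      exact hz s hs))
  ext z
  exact this (mem_univ z)

/-- A rapidly decaying entire solution of `t φ'' + (1 - μ) φ' + κ φ = 0` vanishes. -/
theorem eq_zero_of_ode (hκ : 0 < κ.im) (ht₀ : 1 ≤ t₀) (n : ℕ) : ∀ {μ : ℝ} {φ : ℂ → ℂ},
    μ < n + 1 → Differentiable ℂ φ →
    (∀ t, t * deriv (deriv φ) t + (1 - μ) * deriv φ t + κ * φ t = 0) →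
    (∀ N : ℕ, ∃ C, ∀ t : ℝ, t₀ ≤ t → ‖φ t‖ * t ^ N ≤ C) → φ = 0 := by
  induction n with
  | zero =>
    intro μ φ hμ hφ hode hC
    exact eq_zero_of_ode_of_lt_one hκ (by simpa using hμ) ht₀ hφ hode hC
  | succ n ih =>
    intro μ φ hμ hφ hode hC
    have hφ' : Differentiable ℂ (deriv φ) := hφ.deriv
    have hφ'' : Differentiable ℂ (deriv (deriv φ)) := hφ'.deriv
    have h1 : deriv φ = 0 := by
      -- Differentiating the equation gives the same equation for φ' with μ lowered by one. Once φ'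
      -- = 0, the original equation reduces to κφ = 0.
      refine ih (μ := μ - 1) (by push_cast at hμ; linarith) hφ' (fun t => ?_)
        (deriv_decay_of_ode ht₀ hφ hode hC)
      have h2 := (((hasDerivAt_id t).mul (hφ'' t).hasDerivAt).add
        ((hφ' t).hasDerivAt.const_mul (1 - μ : ℂ))).add ((hφ t).hasDerivAt.const_mul κ)
      have h3 : HasDerivAt (fun t => t * deriv (deriv φ) t + (1 - μ) * deriv φ t + κ * φ t) 0 t :=
        (hasDerivAt_const t (0 : ℂ)).congr_of_eventuallyEq (Eventually.of_forall hode)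
      have h4 := h2.unique h3
      simp only [id] at h4
      push_cast
      linear_combination h4
    ext t
    have h2 := hode t
    have hκ0 : κ ≠ 0 := fun h => by simp [h] at hκ
    simpa [h1, hκ0] using h2

end ODE

/-! ## Entire periodic solutions decaying on the diagonal -/

/-- The derivative with respect to the first variable. -/
noncomputable def pd₁ (W : ℂ × ℂ → ℂ) (q : ℂ × ℂ) : ℂ := fderiv ℂ W q (1, 0)

/-- The derivative with respect to the second variable. -/
noncomputable def pd₂ (W : ℂ × ℂ → ℂ) (q : ℂ × ℂ) : ℂ := fderiv ℂ W q (0, 1)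

theorem AnalyticOnNhd.pd₁ {W : ℂ × ℂ → ℂ} {U : Set (ℂ × ℂ)} (hW : AnalyticOnNhd ℂ W U) :
    AnalyticOnNhd ℂ (pd₁ W) U := fun q hq =>
  ((ContinuousLinearMap.apply ℂ ℂ ((1, 0) : ℂ × ℂ)).analyticAt _).comp (hW.fderiv q hq)

theorem hasDerivAt_comp_prod {W : ℂ × ℂ → ℂ} {a b : ℂ → ℂ} {a' b' s : ℂ}
    (hW : DifferentiableAt ℂ W (a s, b s)) (ha : HasDerivAt a a' s) (hb : HasDerivAt b b' s) :
    HasDerivAt (fun s => W (a s, b s)) (pd₁ W (a s, b s) * a' + pd₂ W (a s, b s) * b') s := by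
  have h := hW.hasFDerivAt.comp_hasDerivAt s (ha.prodMk hb)
  refine h.congr_deriv ?_
  have : ((a', b') : ℂ × ℂ) = a' • (1, 0) + b' • (0, 1) := by simp
  rw [this, map_add, map_smul, map_smul, pd₁, pd₂, smul_eq_mul, smul_eq_mul]
  ring

theorem pd₁_eq_deriv {W : ℂ × ℂ → ℂ} {q : ℂ × ℂ} (hW : DifferentiableAt ℂ W q) :
    pd₁ W q = deriv (fun z => W (z, q.2)) q.1 := by
  have := hasDerivAt_comp_prod (W := W) (a := fun z => z) (b := fun _ => q.2) (s := q.1) hW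
    (hasDerivAt_id _) (hasDerivAt_const _ _)
  rw [this.deriv]; simp

section Fourier

/-- A continuous periodic function with vanishing Fourier coefficients vanishes. -/
theorem eq_zero_of_fourier {T : ℝ} (hT : 0 < T) {f : ℝ → ℂ} (hf : Continuous f)
    (hp : Function.Periodic f T)
    (h : ∀ n : ℤ, ∫ x in (0:ℝ)..T, f x * exp (2 * Real.pi * I * n * x / T) = 0) : f = 0 := by
  have : Fact (0 < T) := ⟨hT⟩
  have hc : Continuous (hp.lift : AddCircle T → ℂ) := hf.quotient_lift _
  let F : C(AddCircle T, ℂ) := ⟨hp.lift, hc⟩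
  have h0 : fourierCoeff F = 0 := by
    ext n
    rw [fourierCoeff_eq_intervalIntegral _ _ 0, zero_add]
    have h1 : ∀ x : ℝ, (fourier (-n) (x : AddCircle T)) • F (x : AddCircle T) =
        f x * exp (2 * Real.pi * I * (-n : ℤ) * x / T) := fun x => by
      rw [fourier_coe_apply, smul_eq_mul, mul_comm]; rfl
    simp_rw [h1]
    rw [h (-n)]; simp
  have hs : Summable (fourierCoeff F) := by rw [h0]; exact summable_zero
  ext x
  have h2 := has_pointwise_sum_fourier_series_of_summable hs (x : AddCircle T)
  rw [h0] at h2
  simp only [Pi.zero_apply, zero_smul] at h2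
  exact h2.unique hasSum_zero

end Fourier

/-! ### Integrals of periodic functions along vertical segments -/

section Contour

variable {L T : ℝ} {h : ℂ → ℂ}

/-- Cauchy's theorem on a rectangle whose horizontal sides cancel by periodicity. -/
theorem integral_vertical_eq (hh : ∀ s, L < s.re → DifferentiableAt ℂ h s)
    (hp : ∀ s : ℂ, L < s.re → h (s + T * I) = h s) {σ₁ σ₂ : ℝ} (h1 : L < σ₁) (h2 : L < σ₂) :
    ∫ θ in (0:ℝ)..T, h (σ₁ + θ * I) = ∫ θ in (0:ℝ)..T, h (σ₂ + θ * I) := by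
  have := integral_boundary_rect_eq_zero_of_differentiableOn h σ₁ (σ₂ + T * I) (fun s hs => by
    refine (hh s ?_).differentiableWithinAt
    have := hs.1
    simp only [mem_preimage] at this
    refine lt_of_lt_of_le ?_ (Set.mem_uIcc.1 this |>.elim (fun h => min_le_of_left_le h.1)
      fun h => min_le_of_right_le h.1)
    simp [h1, h2])
  simp only [ofReal_re, ofReal_im, add_re, mul_re, I_re, mul_zero, I_im, mul_one, sub_self, add_zero,
    add_im, mul_im, zero_add, ofReal_zero, zero_mul] at this
  have e : ∫ x in σ₁..σ₂, h (x + T * I) = ∫ x in σ₁..σ₂, h x := by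
    refine intervalIntegral.integral_congr fun x hx => ?_
    refine hp x ?_
    rcases Set.mem_uIcc.1 hx with h | h
    · simpa using h1.trans_le h.1
    · simpa using h2.trans_le h.1
  rw [e, sub_self, zero_add, ← smul_sub, smul_eq_zero] at this
  exact (sub_eq_zero.1 (this.resolve_left I_ne_zero)).symm

theorem hasDerivAt_vertical (σ θ : ℝ) : HasDerivAt (fun θ : ℝ => (σ + θ * I : ℂ)) I θ := by
  have := ((hasDerivAt_id θ).ofReal_comp.mul_const I).const_add (σ : ℂ)
  simpa using this

theorem integral_vertical_deriv {h' : ℂ → ℂ} (hh : ∀ s, L < s.re → HasDerivAt h (h' s) s)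
    (hc : ∀ s, L < s.re → ContinuousAt h' s)
    (hp : ∀ s : ℂ, L < s.re → h (s + T * I) = h s) {σ : ℝ} (h1 : L < σ) :
    ∫ θ in (0:ℝ)..T, h' (σ + θ * I) = 0 := by
  have hre : ∀ θ : ℝ, L < (σ + θ * I : ℂ).re := fun θ => by simpa using h1
  have hcont : Continuous fun θ : ℝ => h' (σ + θ * I) := continuous_iff_continuousAt.2 fun θ =>
    ContinuousAt.comp (g := h') (hc _ (hre θ)) (hasDerivAt_vertical σ θ).continuousAt
  have := intervalIntegral.integral_eq_sub_of_hasDerivAt (a := 0) (b := T)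
    (f := fun θ : ℝ => h (σ + θ * I)) (f' := fun θ : ℝ => I * h' (σ + θ * I))
    (fun θ _ => by
      exact ((hh _ (hre θ)).scomp θ (hasDerivAt_vertical σ θ)).congr_deriv (smul_eq_mul _ _)) ((continuous_const.mul hcont).intervalIntegrable _ _)
  rw [hp _ (by simpa using h1), intervalIntegral.integral_const_mul] at this
  simpa using this

end Contour

/-! ### Fourier coefficients along the curves z e^s = t -/

section Transform

variable {L : ℝ} {W : ℂ × ℂ → ℂ}

/-- The Fourier coefficients of `W` along the curves `z = t e^{-s}`. -/
noncomputable def transf (T σ : ℝ) (W : ℂ × ℂ → ℂ) (μ t : ℂ) : ℂ :=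
  ∫ θ in (0:ℝ)..T, W (t * exp (-(σ + θ * I)), σ + θ * I) * exp (μ * (σ + θ * I))

/-- Differentiation in t brings out a factor e^{−s}, which lowers the exponent μ by one. -/
theorem hasDerivAt_transf {T σ : ℝ} (hT : 0 ≤ T) (hσ : L < σ)
    (hW : AnalyticOnNhd ℂ W {q | L < q.2.re}) (μ t : ℂ) :
    HasDerivAt (transf T σ W μ) (transf T σ (pd₁ W) (μ - 1) t) t := by
  have hre : ∀ θ : ℝ, L < (σ + θ * I : ℂ).re := fun θ => by simpa using hσ
  have hcW : ∀ {V : ℂ × ℂ → ℂ} (ν : ℂ), AnalyticOnNhd ℂ V {q | L < q.2.re} →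
      ContinuousOn (Function.uncurry fun (t : ℂ) (θ : ℝ) =>
        V (t * exp (-(σ + θ * I)), σ + θ * I) * exp (ν * (σ + θ * I))) (univ ×ˢ Icc 0 T) := by
    intro V ν hV
    refine Continuous.continuousOn ?_
    refine Continuous.mul ?_ (by fun_prop)
    exact hV.continuousOn.comp_continuous
      (f := fun q : ℂ × ℝ => (q.1 * exp (-(σ + q.2 * I)), (σ + q.2 * I : ℂ))) (by fun_prop)
      fun q => hre q.2
  refine hasDerivAt_intervalIntegral_of_continuousOn hT isOpen_univ (hcW μ hW) (hcW (μ - 1) hW.pd₁)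
    (fun t _ θ _ => ?_) (mem_univ t)
  have h1 := (hasDerivAt_comp_prod (W := W) (a := fun t => t * exp (-(σ + θ * I)))
    (b := fun _ => (σ + θ * I : ℂ)) (s := t) (hW _ (hre θ)).differentiableAt
    ((hasDerivAt_id t).mul_const _) (hasDerivAt_const _ _)).mul_const (exp (μ * (σ + θ * I)))
  refine h1.congr_deriv ?_
  rw [mul_zero, add_zero, one_mul, mul_assoc, ← exp_add]
  congr 2
  ring

theorem deriv_transf {T σ : ℝ} (hT : 0 ≤ T) (hσ : L < σ)
    (hW : AnalyticOnNhd ℂ W {q | L < q.2.re}) (μ : ℂ) :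
    deriv (transf T σ W μ) = transf T σ (pd₁ W) (μ - 1) :=
  funext fun t => (hasDerivAt_transf hT hσ hW μ t).deriv

variable {V : ℂ × ℂ → ℂ} {κ : ℂ} {T : ℝ}

theorem pd₁_periodic (hV : AnalyticOnNhd ℂ V {q | L < q.2.re})
    (hp : ∀ z s : ℂ, L < s.re → V (z, s + T * I) = V (z, s)) (z s : ℂ) (hs : L < s.re) :
    pd₁ V (z, s + T * I) = pd₁ V (z, s) := by
  rw [pd₁_eq_deriv (hV _ (show L < (s + T * I).re by simpa using hs)).differentiableAt,
    pd₁_eq_deriv (hV _ hs).differentiableAt]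
  simp only
  congr 1
  ext z
  exact hp z s hs

theorem transf_periodic {W : ℂ × ℂ → ℂ} {μ : ℂ}
    (hp : ∀ z s : ℂ, L < s.re → W (z, s + T * I) = W (z, s)) (hT : exp (T * I) = 1)
    (hμ : exp (μ * (T * I)) = 1) (t s : ℂ) (hs : L < s.re) :
    W (t * exp (-(s + T * I)), s + T * I) * exp (μ * (s + T * I)) =
      W (t * exp (-s), s) * exp (μ * s) := by
  rw [mul_add, exp_add, hμ, mul_one, neg_add, exp_add, exp_neg (T * I), hT, inv_one, mul_one,
    hp _ _ hs]

/-- The s-derivative of the periodic function ∂_z V(te^{−s}, s) e^{(μ−1)s} integrates to zero over a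
period. Expanded with V_{zs} = −κe^s V, this integral is −tφ'' − (1 − μ)φ' − κφ. -/
theorem transf_ode {σ : ℝ} (hσ : L < σ) (hT : exp (T * I) = 1) (hT0 : 0 ≤ T)
    (hV : AnalyticOnNhd ℂ V {q | L < q.2.re})
    (hp : ∀ z s : ℂ, L < s.re → V (z, s + T * I) = V (z, s))
    (hpde : ∀ q : ℂ × ℂ, L < q.2.re → pd₂ (pd₁ V) q = -κ * exp q.2 * V q) {μ : ℂ}
    (hμ : exp (μ * (T * I)) = 1) (t : ℂ) :
    t * deriv (deriv (transf T σ V μ)) t + (1 - μ) * deriv (transf T σ V μ) t +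
      κ * transf T σ V μ t = 0 := by
  rw [deriv_transf hT0 hσ hV, deriv_transf hT0 hσ hV.pd₁]
  have hre : ∀ θ : ℝ, L < (σ + θ * I : ℂ).re := fun θ => by simpa using hσ
  have hc : ∀ {W : ℂ × ℂ → ℂ} (ν : ℂ), AnalyticOnNhd ℂ W {q | L < q.2.re} → ∀ s : ℂ, L < s.re →
      ContinuousAt (fun s => W (t * exp (-s), s) * exp (ν * s)) s := fun {W} ν hW s hs => by
    refine ContinuousAt.mul ?_ (by fun_prop)
    exact ContinuousAt.comp (g := W) (f := fun s => (t * exp (-s), s))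
      (hW (t * exp (-s), s) hs).continuousAt (by fun_prop)
  have hi : ∀ {W : ℂ × ℂ → ℂ} (ν : ℂ), AnalyticOnNhd ℂ W {q | L < q.2.re} →
      IntervalIntegrable (fun θ : ℝ => W (t * exp (-(σ + θ * I)), σ + θ * I) *
        exp (ν * (σ + θ * I))) MeasureTheory.volume 0 T := fun {W} ν hW =>
    (continuous_iff_continuousAt.2 fun θ => ContinuousAt.comp (f := fun θ : ℝ => (σ + θ * I : ℂ))
      (hc ν hW _ (hre θ)) (hasDerivAt_vertical σ θ).continuousAt).intervalIntegrable _ _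
  have h0 := integral_vertical_deriv (T := T) (σ := σ) (L := L)
    (h := fun s => pd₁ V (t * exp (-s), s) * exp ((μ - 1) * s))
    (h' := fun s => -t * (pd₁ (pd₁ V) (t * exp (-s), s) * exp ((μ - 1 - 1) * s)) -
      κ * (V (t * exp (-s), s) * exp (μ * s)) +
      (μ - 1) * (pd₁ V (t * exp (-s), s) * exp ((μ - 1) * s))) (fun s hs => by
        have e1 : HasDerivAt (fun s => t * exp (-s)) (t * (exp (-s) * -1)) s :=
          ((hasDerivAt_neg s).cexp.const_mul t)
        have e2 : HasDerivAt (fun s => exp ((μ - 1) * s)) (exp ((μ - 1) * s) * ((μ - 1) * 1)) s :=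
          ((hasDerivAt_id s).const_mul (μ - 1)).cexp
        refine ((hasDerivAt_comp_prod (W := pd₁ V) (a := fun s => t * exp (-s)) (b := fun s => s)
          (s := s) (hV.pd₁ _ hs).differentiableAt e1 (hasDerivAt_id s)).mul e2).congr_deriv ?_
        rw [hpde _ hs]
        have e3 : exp (μ * s) = exp s * exp ((μ - 1) * s) := by rw [← exp_add]; congr 1; ring
        have e4 : exp ((μ - 1 - 1) * s) = exp (-s) * exp ((μ - 1) * s) := by
          rw [← exp_add]; congr 1; ring
        rw [e3, e4]
        ring)
    (fun s hs => ((continuousAt_const.mul (hc _ hV.pd₁.pd₁ s hs)).sub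
      (continuousAt_const.mul (hc _ hV s hs))).add (continuousAt_const.mul (hc _ hV.pd₁ s hs)))
    (transf_periodic (μ := μ - 1) (pd₁_periodic hV hp) hT (by
      rw [sub_mul, one_mul, exp_sub, hμ, hT, div_one]) t) hσ
  rw [intervalIntegral.integral_add, intervalIntegral.integral_sub,
    intervalIntegral.integral_const_mul, intervalIntegral.integral_const_mul,
    intervalIntegral.integral_const_mul] at h0
  · unfold transf
    linear_combination -h0
  · exact (hi _ hV.pd₁.pd₁).const_mul _
  · exact (hi _ hV).const_mul _
  · exact ((hi _ hV.pd₁.pd₁).const_mul _).sub ((hi _ hV).const_mul _)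
  · exact (hi _ hV.pd₁).const_mul _

theorem exp_decay_le {δ : ℝ} (hδ : 0 < δ) (n : ℕ) : ∃ C, ∀ r : ℝ, 0 ≤ r →
    Real.exp (-δ * r) * r ^ n ≤ C := by
  refine ⟨n.factorial / δ ^ n, fun r hr => ?_⟩
  have h := Real.pow_div_factorial_le_exp (δ * r) (by positivity) n
  rw [neg_mul, Real.exp_neg, inv_mul_le_iff₀ (Real.exp_pos _)]
  rw [div_le_iff₀ (by positivity), mul_pow] at h
  rw [mul_div_assoc', le_div_iff₀ (by positivity)]
  linarith

/-- An entire (in `z`) periodic (in `s`) solution that decays on the diagonal vanishes. -/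
theorem eq_zero_of_decay (hκ : 0 < κ.im) {m : ℕ} (hm : 0 < m)
    (hV : AnalyticOnNhd ℂ V {q | L < q.2.re})
    (hp : ∀ z s : ℂ, L < s.re → V (z, s + (2 * Real.pi * m : ℝ) * I) = V (z, s))
    (hpde : ∀ q : ℂ × ℂ, L < q.2.re → pd₂ (pd₁ V) q = -κ * exp q.2 * V q)
    {K δ : ℝ} (hδ : 0 < δ)
    (hdec : ∀ τ : ℂ, L < τ.re →
      ‖V (exp τ, (starRingEnd ℂ) τ)‖ ≤ K * Real.exp (-δ * Real.exp τ.re))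
    {q : ℂ × ℂ} (hq : L < q.2.re) : V q = 0 := by
  set T : ℝ := 2 * Real.pi * m with hTdef
  have hm' : (m : ℂ) ≠ 0 := by exact_mod_cast hm.ne'
  have hpi : (Real.pi : ℂ) ≠ 0 := by exact_mod_cast Real.pi_ne_zero
  have hT0 : 0 < T := by positivity
  have hT1 : exp (T * I) = 1 := by
    rw [exp_eq_one_iff]; exact ⟨m, by rw [hTdef]; push_cast; ring⟩
  have hμ : ∀ l : ℤ, exp (((l : ℝ) / m : ℝ) * (T * I)) = 1 := fun l => by
    rw [exp_eq_one_iff]; exact ⟨l, by rw [hTdef]; push_cast; field_simp⟩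
  have hind : ∀ (l : ℤ) (t : ℂ) {σ₁ σ₂ : ℝ}, L < σ₁ → L < σ₂ →
      transf T σ₁ V ((l : ℝ) / m : ℝ) t = transf T σ₂ V ((l : ℝ) / m : ℝ) t := fun l t σ₁ σ₂ h1 h2 =>
    integral_vertical_eq (h := fun s => V (t * exp (-s), s) * exp (((l : ℝ) / m : ℝ) * s))
      (fun s hs => by
        refine DifferentiableAt.mul ?_ (by fun_prop)
        exact DifferentiableAt.comp (g := V) (f := fun s => (t * exp (-s), s)) s
          (hV (t * exp (-s), s) hs).differentiableAt (by fun_prop))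
      (fun s hs => transf_periodic hp hT1 (hμ l) t s hs) h1 h2
  have hK : 0 ≤ K := by
    have h1 := (norm_nonneg _).trans (hdec ((L + 1 : ℝ) : ℂ) (by simp))
    exact nonneg_of_mul_nonneg_left h1 (Real.exp_pos _)
  have hzero : ∀ (l : ℤ) {σ : ℝ}, L < σ → transf T σ V ((l : ℝ) / m : ℝ) = 0 := fun l σ hσ => by
    set μ : ℝ := (l : ℝ) / m with hμdef
    obtain ⟨n, hn⟩ := exists_nat_gt (μ - 1)
    -- This threshold ensures that, for t beyond it, the abscissa (log t)/2 chosen below exceeds L.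
    refine eq_zero_of_ode (κ := κ) hκ (t₀ := max 1 (Real.exp (2 * (L + 1)))) (le_max_left _ _) n
      (by linarith) (fun t => (hasDerivAt_transf hT0.le hσ hV _ t).differentiableAt)
      (fun t => transf_ode hσ hT1 hT0.le hV hp hpde (hμ l) t) fun N => ?_
    obtain ⟨k, hk⟩ := exists_nat_ge (μ + 2 * N)
    obtain ⟨C, hC⟩ := exp_decay_le hδ k
    refine ⟨T * K * C, fun t ht => ?_⟩
    have ht1 : 1 ≤ t := (le_max_left _ _).trans ht
    have ht0 : 0 < t := by linarith
    -- The transform does not depend on the abscissa of the segment. On Re s = ρ with e^{2ρ} = t one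
    -- has t e^{−s} = e^{s̄}: the curve lies on the real plane, at distance r = √t from the origin,
    -- where the decay hypothesis applies.
    set ρ : ℝ := Real.log t / 2 with hρ
    have hρL : L < ρ := by
      have h1 : 2 * (L + 1) ≤ Real.log t := by
        rw [Real.le_log_iff_exp_le ht0]; exact (le_max_right _ _).trans ht
      linarith
    have hρ0 : 0 ≤ ρ := by have := Real.log_nonneg ht1; positivity
    set r := Real.exp ρ with hr
    have hr1 : 1 ≤ r := Real.one_le_exp hρ0
    have htr : t = r ^ 2 := by
      rw [hr, ← Real.exp_nat_mul, hρ]; push_cast; rw [mul_div_cancel₀ _ (two_ne_zero)]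
      exact (Real.exp_log ht0).symm
    have hb : ∀ θ ∈ uIoc (0:ℝ) T, ‖V (t * exp (-(ρ + θ * I)), ρ + θ * I) * exp (μ * (ρ + θ * I))‖ ≤
        K * Real.exp (-δ * r) * Real.exp (μ * ρ) := fun θ _ => by
      have h1 := hdec (ρ - θ * I) (by simpa using hρL)
      have e1 : (starRingEnd ℂ) (ρ - θ * I) = ρ + θ * I := by
        apply Complex.ext <;> simp
      have e2 : (t : ℂ) * exp (-(ρ + θ * I)) = exp (ρ - θ * I) := by
        rw [htr, hr, ofReal_pow, ofReal_exp, ← exp_nat_mul, ← exp_add]; congr 1; push_cast; ring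
      have e3 : (ρ - θ * I : ℂ).re = ρ := by simp
      rw [e1, e3] at h1
      rw [e2, norm_mul, norm_exp]
      have e4 : ((μ : ℂ) * (ρ + θ * I)).re = μ * ρ := by simp
      rw [e4]
      gcongr
    have h2 := intervalIntegral.norm_integral_le_of_norm_le_const hb
    rw [sub_zero, abs_of_pos hT0] at h2
    have h3 : ‖transf T σ V μ t‖ ≤ K * Real.exp (-δ * r) * Real.exp (μ * ρ) * T := by
      rw [hind l t hσ hρL]; exact h2
    have h4 : Real.exp (μ * ρ) * t ^ N ≤ r ^ k := by
      have : t ^ N = Real.exp (2 * N * ρ) := by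
        rw [htr, hr, ← pow_mul, ← Real.exp_nat_mul]; push_cast; ring_nf
      rw [this, ← Real.exp_add, hr, ← Real.exp_nat_mul]
      apply Real.exp_le_exp.2
      nlinarith
    calc ‖transf T σ V μ t‖ * t ^ N ≤ K * Real.exp (-δ * r) * Real.exp (μ * ρ) * T * t ^ N := by
          gcongr
      _ = T * K * Real.exp (-δ * r) * (Real.exp (μ * ρ) * t ^ N) := by ring
      _ ≤ T * K * Real.exp (-δ * r) * r ^ k := by gcongr
      _ = T * K * (Real.exp (-δ * r) * r ^ k) := by ring
      _ ≤ T * K * C := by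
          have := hC r (by linarith)
          gcongr
  obtain ⟨z, s⟩ := q
  have hs : L < s.re := hq
  -- The curve with this t passes through (z, s), at θ = Im s. All Fourier coefficients of V along
  -- it vanish, hence V does too.
  set t := z * exp s with ht
  let f : ℝ → ℂ := fun θ => V (t * exp (-(s.re + θ * I)), s.re + θ * I)
  have hre : ∀ θ : ℝ, L < (s.re + θ * I : ℂ).re := fun θ => by simpa using hs
  have hf : f = 0 := by
    refine eq_zero_of_fourier hT0 ?_ (fun θ => ?_) fun n => ?_
    · exact hV.continuousOn.comp_continuous
        (f := fun θ : ℝ => (t * exp (-(s.re + θ * I)), (s.re + θ * I : ℂ))) (by fun_prop) hre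
    · have := transf_periodic (W := V) (μ := 0) hp hT1 (by simp) t (s.re + θ * I) (hre θ)
      simp only [zero_mul, exp_zero, mul_one] at this
      simp only [f]
      rw [← this]
      push_cast
      ring_nf
    · have h1 := congrFun (hzero n hs) t
      have h2 : ∀ θ : ℝ, f θ * exp (2 * Real.pi * I * n * θ / T) =
          exp (-(((n : ℝ) / m : ℝ) * s.re)) * (V (t * exp (-(s.re + θ * I)), s.re + θ * I) *
            exp (((n : ℝ) / m : ℝ) * (s.re + θ * I))) := fun θ => by
        simp only [f]
        rw [mul_left_comm, ← exp_add]
        congr 2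
        rw [hTdef]; push_cast; field_simp; ring
      simp_rw [h2]
      rw [intervalIntegral.integral_const_mul]
      unfold transf at h1
      rw [h1]; simp
  have h3 := congrFun hf s.im
  simp only [f, Pi.zero_apply, re_add_im, ht] at h3
  rwa [mul_assoc, ← exp_add, add_neg_cancel, exp_zero, mul_one] at h3

end Transform

/-! ## Operations on solutions; unique continuation -/

section SolLemmas

variable {κ : ℂ} {x dx f g : ℂ → ℂ} {Ω Ω' : Set ℂ} {p : ℂ → ℂ × ℂ → ℂ}

theorem Dev.id (ho : IsOpen Ω) (hc : Convex ℝ Ω) : Dev (fun τ => τ) (fun _ => 1) Ω :=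
  ⟨ho, hc, fun τ _ => hasDerivAt_id τ, fun _ _ => differentiableAt_const _⟩

theorem Dev.map_nhds (hx : Dev x dx Ω) {τ : ℂ} (hτ : τ ∈ Ω) (hdx : dx τ ≠ 0) :
    map x (𝓝 τ) = 𝓝 (x τ) := by
  have han : AnalyticAt ℂ x τ := by
    refine DifferentiableOn.analyticAt (s := Ω) (fun t ht => ?_) (hx.isOpen.mem_nhds hτ)
    exact (hx.hasDerivAt t ht).differentiableAt.differentiableWithinAt
  have hs := han.hasStrictDerivAt
  rw [(hx.hasDerivAt τ hτ).deriv] at hs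
  exact hs.map_nhds_eq hdx

theorem Sol.congr_eventually (hf : Sol κ dx Ω f)
    (h : ∀ τ ∈ Ω', ∃ τ' ∈ Ω, τ' = τ ∧ f =ᶠ[𝓝 τ] g) : Sol κ dx Ω' g := fun τ hτ => by
  obtain ⟨_, hτ', rfl, hfg⟩ := h τ hτ
  obtain ⟨h1, e, h2⟩ := hf _ hτ'
  refine ⟨h1.congr_of_eventuallyEq hfg.symm, e, ?_⟩
  rw [← hfg.self_of_nhds]
  refine h2.congr_of_eventuallyEq ?_
  filter_upwards [hfg.eventually_nhds] with y hy
  exact (Filter.EventuallyEq.dz_eq hy).symm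

theorem Sol.congr (hΩ : IsOpen Ω) (hf : Sol κ dx Ω f) (h : EqOn f g Ω) : Sol κ dx Ω g :=
  hf.congr_eventually fun τ hτ => ⟨τ, hτ, rfl, h.eventuallyEq_of_mem (hΩ.mem_nhds hτ)⟩

theorem dz_sub {τ : ℂ} (hf : DifferentiableAt ℝ f τ) (hg : DifferentiableAt ℝ g τ) :
    dz (fun τ => f τ - g τ) τ = dz f τ - dz g τ := by
  refine dz_eq_of_hasFDerivAt (b := dzb f τ - dzb g τ)
    ((hf.hasFDerivAt_wirt.sub hg.hasFDerivAt_wirt).congr_fderiv ?_)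
  ext1 v; simp; ring

theorem dz_const_mul {τ : ℂ} (c : ℂ) (hf : DifferentiableAt ℝ f τ) :
    dz (fun τ => c * f τ) τ = c * dz f τ := by
  refine dz_eq_of_hasFDerivAt (b := c * dzb f τ)
    ((hf.hasFDerivAt_wirt.const_mul c).congr_fderiv ?_)
  ext1 v; simp; ring

theorem Sol.sub (hΩ : IsOpen Ω) (hf : Sol κ dx Ω f) (hg : Sol κ dx Ω g) :
    Sol κ dx Ω fun τ => f τ - g τ := fun τ hτ => by
  obtain ⟨h1, e, h2⟩ := hf τ hτ
  obtain ⟨h1', e', h2'⟩ := hg τ hτ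
  refine ⟨h1.sub h1', e - e', ?_⟩
  have h3 : HasFDerivAt (fun τ => dz f τ - dz g τ) _ τ := h2.sub h2'
  refine (h3.congr_of_eventuallyEq ?_).congr_fderiv (by ext1 v; simp; ring)
  filter_upwards [hΩ.mem_nhds hτ] with y hy
  exact dz_sub (hf y hy).1 (hg y hy).1

theorem Sol.const_mul (hΩ : IsOpen Ω) (c : ℂ) (hf : Sol κ dx Ω f) :
    Sol κ dx Ω fun τ => c * f τ := fun τ hτ => by
  obtain ⟨h1, e, h2⟩ := hf τ hτ
  refine ⟨h1.const_mul c, c * e, ?_⟩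
  have h3 : HasFDerivAt (fun τ => c * dz f τ) _ τ := h2.const_mul c
  refine (h3.congr_of_eventuallyEq ?_).congr_fderiv (by ext1 v; simp; ring)
  filter_upwards [hΩ.mem_nhds hτ] with y hy
  exact dz_const_mul c (hf y hy).1

theorem dz_comp {τ c : ℂ} (hx : HasDerivAt x c τ) (hf : DifferentiableAt ℝ f (x τ)) :
    HasFDerivAt (fun τ => f (x τ)) (wirt (dz f (x τ) * c) (dzb f (x τ) * (starRingEnd ℂ) c)) τ :=
  (HasFDerivAt.comp τ hf.hasFDerivAt_wirt hx.hasFDerivAt_wirt).congr_fderiv (by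
    rw [wirt_comp]; simp)

/-- Solutions can be pulled back by holomorphic maps. -/
theorem Sol.comp {y dy : ℂ → ℂ} (hΩ : IsOpen Ω) (hf : Sol κ (fun _ => 1) Ω' f)
    (hx : ∀ τ ∈ Ω, HasDerivAt y (dy τ) τ) (hd : ∀ τ ∈ Ω, DifferentiableAt ℂ dy τ)
    (hm : MapsTo y Ω Ω') : Sol κ dy Ω fun τ => f (y τ) := fun τ hτ => by
  obtain ⟨h1, e, h2⟩ := hf _ (hm hτ)
  refine ⟨(dz_comp (hx τ hτ) h1).differentiableAt, ?_⟩
  have h3 := (HasFDerivAt.comp τ h2 (hx τ hτ).hasFDerivAt_wirt).mul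
    (hd τ hτ).hasDerivAt.hasFDerivAt_wirt
  refine ⟨e * dy τ * dy τ + dz f (y τ) * deriv dy τ, (h3.congr_of_eventuallyEq ?_).congr_fderiv ?_⟩
  · filter_upwards [hΩ.mem_nhds hτ] with s hs
    exact dz_eq_of_hasFDerivAt (dz_comp (hx s hs) (hf _ (hm hs)).1)
  · ext1 v; simp; ring

/-- Families of primitives can be pulled back by holomorphic maps. -/
theorem PF.comp {y dy : ℂ → ℂ} (hf : Sol κ (fun _ => 1) Ω' f)
    (hp : PF κ (fun τ => τ) (fun _ => 1) Ω' f p)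
    (hx : ∀ τ ∈ Ω, HasDerivAt y (dy τ) τ) (hm : MapsTo y Ω Ω') :
    PF κ y dy Ω (fun τ => f (y τ)) fun τ => p (y τ) where
  deriv A τ hτ := by
    refine (HasFDerivAt.comp τ (hp.deriv A _ (hm hτ)) (hx τ hτ).hasFDerivAt_wirt).congr_fderiv ?_
    rw [green, green, wirt_comp, dz_eq_of_hasFDerivAt (dz_comp (hx τ hτ) (hf _ (hm hτ)).1)]
    congr 1
    · simp; ring
    · simp
  entire τ hτ := hp.entire _ (hm hτ)

theorem hasFDerivAt_diag {V : ℂ × ℂ → ℂ} {τ c : ℂ} (hx : HasDerivAt x c τ)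
    (hV : DifferentiableAt ℂ V (x τ, (starRingEnd ℂ) τ)) :
    HasFDerivAt (fun τ => V (x τ, (starRingEnd ℂ) τ))
      (wirt (pd₁ V (x τ, (starRingEnd ℂ) τ) * c) (pd₂ V (x τ, (starRingEnd ℂ) τ))) τ := by
  refine (HasFDerivAt.comp τ (hV.hasFDerivAt.restrictScalars ℝ)
    (hx.hasFDerivAt_wirt.prodMk (hasFDerivAt_conj τ))).congr_fderiv ?_
  ext1 v
  have : ((c * v, (starRingEnd ℂ) v) : ℂ × ℂ) = (c * v) • (1, 0) + ((starRingEnd ℂ) v) • (0, 1) := by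
    simp
  simp [this, pd₁, pd₂, -Prod.smul_mk]
  ring

/-- The analytic continuation, near the real plane, of a solution. -/
noncomputable def rext (x f : ℂ → ℂ) (p : ℂ → ℂ × ℂ → ℂ) (q : ℂ × ℂ) : ℂ :=
  p q.1 (x q.1, (starRingEnd ℂ) (x ((starRingEnd ℂ) q.2))) + (f ((starRingEnd ℂ) q.2) -
    p ((starRingEnd ℂ) q.2) (x q.1, (starRingEnd ℂ) (x ((starRingEnd ℂ) q.2))))

theorem rext_diag (x f : ℂ → ℂ) (p : ℂ → ℂ × ℂ → ℂ) (τ : ℂ) : rext x f p (τ, (starRingEnd ℂ) τ) = f τ := by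
  simp [rext]

theorem isOpen_polyconj (h1 : IsOpen Ω) (h2 : IsOpen Ω') :
    IsOpen {q : ℂ × ℂ | q.1 ∈ Ω ∧ (starRingEnd ℂ) q.2 ∈ Ω'} :=
  (h1.preimage continuous_fst).inter (h2.preimage (continuous_conj.comp continuous_snd))

theorem convex_polyconj (h1 : Convex ℝ Ω) (h2 : Convex ℝ Ω') :
    Convex ℝ {q : ℂ × ℂ | q.1 ∈ Ω ∧ (starRingEnd ℂ) q.2 ∈ Ω'} :=
  (h1.linear_preimage (LinearMap.fst ℝ ℂ ℂ)).inter (h2.linear_preimage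
    ((conjCLE : ℂ →L[ℝ] ℂ).toLinearMap.comp (LinearMap.snd ℝ ℂ ℂ)))

theorem Dev.differentiableAt_conj (hx : Dev x dx Ω) {s : ℂ} (hs : (starRingEnd ℂ) s ∈ Ω) :
    DifferentiableAt ℂ (fun s => (starRingEnd ℂ) (x ((starRingEnd ℂ) s))) s :=
  (hasDerivAt_conj_of_wirt (f := fun s => (starRingEnd ℂ) (x s))
    (hx.hasDerivAt _ hs).hasFDerivAt_conj).differentiableAt

theorem PF.analyticOnNhd_rext (hx : Dev x dx Ω) (hf : Sol κ dx Ω f) (hp : PF κ x dx Ω f p) :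
    AnalyticOnNhd ℂ (rext x f p) {q | q.1 ∈ Ω ∧ (starRingEnd ℂ) q.2 ∈ Ω} := by
  refine DifferentiableOn.analyticOnNhd_prod (isOpen_polyconj hx.isOpen hx.isOpen) fun q hq =>
    DifferentiableAt.differentiableWithinAt ?_
  have d1 : DifferentiableAt ℂ (fun q : ℂ × ℂ => (starRingEnd ℂ) (x ((starRingEnd ℂ) q.2))) q :=
    DifferentiableAt.comp (g := fun s => (starRingEnd ℂ) (x ((starRingEnd ℂ) s)))
      (f := Prod.snd) q (hx.differentiableAt_conj hq.2) differentiableAt_snd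
  have d2 : DifferentiableAt ℂ (fun q : ℂ × ℂ => x q.1) q :=
    DifferentiableAt.comp (g := x) (f := Prod.fst) q (hx.hasDerivAt _ hq.1).differentiableAt
      differentiableAt_fst
  refine DifferentiableAt.fun_add ?_ ?_
  · exact DifferentiableAt.comp (g := fun q : ℂ × ℂ => p q.1 (x q.1, q.2))
      (f := fun q : ℂ × ℂ => (q.1, (starRingEnd ℂ) (x ((starRingEnd ℂ) q.2)))) q
      (hp.analyticOnNhd_hol hx hf (q.1, (starRingEnd ℂ) (x ((starRingEnd ℂ) q.2))) hq.1).differentiableAt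
      (differentiableAt_fst.prodMk d1)
  · exact DifferentiableAt.comp (g := fun q : ℂ × ℂ => f ((starRingEnd ℂ) q.2) -
      p ((starRingEnd ℂ) q.2) (q.1, (starRingEnd ℂ) (x ((starRingEnd ℂ) q.2))))
      (f := fun q : ℂ × ℂ => (x q.1, q.2)) q
      (hp.analyticOnNhd_anti hx hf (x q.1, q.2) hq.2).differentiableAt (d2.prodMk differentiableAt_snd)

/-- Uniqueness on the diagonal. -/
theorem eqOn_zero_of_diag {F : ℂ × ℂ → ℂ} (hc : Convex ℝ Ω)
    (hF : AnalyticOnNhd ℂ F {q | q.1 ∈ Ω ∧ (starRingEnd ℂ) q.2 ∈ Ω}) {τ₀ : ℂ} (h0 : τ₀ ∈ Ω)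
    (h : ∀ᶠ τ in 𝓝 τ₀, F (τ, (starRingEnd ℂ) τ) = 0) {q : ℂ × ℂ} (h1 : q.1 ∈ Ω)
    (h2 : (starRingEnd ℂ) q.2 ∈ Ω) : F q = 0 := by
  have hm : ((τ₀, (starRingEnd ℂ) τ₀) : ℂ × ℂ) ∈ {q : ℂ × ℂ | q.1 ∈ Ω ∧ (starRingEnd ℂ) q.2 ∈ Ω} := by
    simpa using h0
  exact hF.eqOn_zero_of_preconnected_of_eventuallyEq_zero (convex_polyconj hc hc).isPreconnected hm
    ((hF _ hm).eventually_eq_zero_of_diag h) ⟨h1, h2⟩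

/-- Unique continuation. -/
theorem Sol.eqOn_zero (hx : Dev x dx Ω) (hf : Sol κ dx Ω f) {τ₀ : ℂ} (h0 : τ₀ ∈ Ω)
    (h : ∀ᶠ τ in 𝓝 τ₀, f τ = 0) {τ : ℂ} (hτ : τ ∈ Ω) : f τ = 0 := by
  obtain ⟨p, hp⟩ := hf.exists_PF hx
  -- The solution is the diagonal restriction of an analytic function on a convex domain of ℂ², for
  -- which a neighbourhood in the diagonal is a set of uniqueness.
  rw [← rext_diag x f p τ]
  refine eqOn_zero_of_diag hx.convex (hp.analyticOnNhd_rext hx hf) h0 ?_ hτ (by simpa)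
  filter_upwards [h] with y hy
  rw [rext_diag, hy]

/-- `Sol` controls the derivative of ∂f/∂τ only; the continuity of ∂f/∂τ̄ is read off the analytic
extension `rext`. -/
theorem Sol.continuousOn_dzb (hx : Dev x dx Ω) (hf : Sol κ dx Ω f) : ContinuousOn (dzb f) Ω := by
  obtain ⟨p, hp⟩ := hf.exists_PF hx
  have hF := hp.analyticOnNhd_rext hx hf
  have he : EqOn (dzb f) (fun τ => fderiv ℂ (rext x f p) (τ, (starRingEnd ℂ) τ) (0, 1)) Ω := by
    intro τ hτ
    have h1 := hasFDerivAt_diag (V := rext x f p) (hasDerivAt_id τ)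
      (hF (id τ, (starRingEnd ℂ) τ) ⟨hτ, by simpa using hτ⟩).differentiableAt
    simp only [id, rext_diag] at h1
    exact dzb_eq_of_hasFDerivAt h1
  refine ContinuousOn.congr ?_ he
  intro τ hτ
  refine ContinuousAt.continuousWithinAt ?_
  have h2 : ContinuousAt (fderiv ℂ (rext x f p)) (τ, (starRingEnd ℂ) τ) :=
    (hF.fderiv (τ, (starRingEnd ℂ) τ) ⟨hτ, by simpa using hτ⟩).continuousAt
  have h3 : ContinuousAt (fun τ : ℂ => (τ, (starRingEnd ℂ) τ)) τ :=
    continuousAt_id.prodMk continuous_conj.continuousAt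
  exact (ContinuousAt.comp (g := fderiv ℂ (rext x f p))
    (f := fun τ : ℂ => (τ, (starRingEnd ℂ) τ)) h2 h3).clm_apply continuousAt_const

/-- The exponential solutions. -/
noncomputable def wave (α β z : ℂ) : ℂ := exp (α * z + β * (starRingEnd ℂ) z)

theorem hasFDerivAt_wave (α β z : ℂ) :
    HasFDerivAt (wave α β) (wirt (α * wave α β z) (β * wave α β z)) z := by
  have h1 : HasFDerivAt (fun z => α * z + β * (starRingEnd ℂ) z) (wirt α β) z :=
    (((hasFDerivAt_id_wirt z).const_mul α).add ((hasFDerivAt_conj z).const_mul β)).congr_fderiv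
      (by ext1 v; simp)
  refine (HasFDerivAt.comp z (Complex.hasDerivAt_exp _).hasFDerivAt_wirt h1).congr_fderiv ?_
  rw [wirt_comp]
  congr 1 <;> simp [wave, mul_comm]

theorem wave_ne_zero (α β z : ℂ) : wave α β z ≠ 0 := exp_ne_zero _

theorem wave_add (α β z h : ℂ) :
    wave α β (z + h) = exp (α * h + β * (starRingEnd ℂ) h) * wave α β z := by
  rw [wave, wave, ← exp_add, map_add]; congr 1; ring

theorem sol_wave {α β : ℂ} (hαβ : α * β = -κ) : Sol κ (fun _ => 1) Ω' (wave α β) := fun τ _ => by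
  refine ⟨(hasFDerivAt_wave α β τ).differentiableAt, α * α * wave α β τ, ?_⟩
  have h1 : dz (wave α β) = fun z => α * wave α β z :=
    funext fun z => dz_eq_of_hasFDerivAt (hasFDerivAt_wave α β z)
  rw [h1, map_one, mul_one, mul_one, ← hαβ]
  refine ((hasFDerivAt_wave α β τ).const_mul α).congr_fderiv ?_
  ext1 v; simp; ring

theorem sol_wave_comp {α β : ℂ} (hαβ : α * β = -κ) (hx : Dev x dx Ω) :
    Sol κ dx Ω fun τ => wave α β (x τ) :=
  (sol_wave (Ω' := univ) hαβ).comp hx.isOpen hx.hasDerivAt hx.differentiableAt (mapsTo_univ _ _)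

end SolLemmas

/-! ## Solutions with entire continuation in the first variable -/

/-- The continuation of `f` is entire in the first variable. -/
def Ent (κ : ℂ) (x dx : ℂ → ℂ) (Ω : Set ℂ) (f : ℂ → ℂ) : Prop :=
  ∃ p, PF κ x dx Ω f p ∧ ∀ τ ∈ Ω, ∀ w, p τ (x τ, w) = 0

section EntLemmas

variable {κ : ℂ} {x dx f g : ℂ → ℂ} {Ω Ω' : Set ℂ} {p : ℂ → ℂ × ℂ → ℂ}

/-- The branching part is analytic in (τ, w) over the convex set Ω × ℂ, so the identity theorem
spreads its vanishing. -/
theorem PF.ent_of_eventually (hx : Dev x dx Ω) (hf : Sol κ dx Ω f) (hp : PF κ x dx Ω f p) {τ₀ : ℂ}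
    (h0 : τ₀ ∈ Ω) {w₀ : ℂ} (h : ∀ᶠ q : ℂ × ℂ in 𝓝 (τ₀, w₀), p q.1 (x q.1, q.2) = 0) :
    Ent κ x dx Ω f := by
  refine ⟨p, hp, fun τ hτ w => ?_⟩
  have hc : IsPreconnected {q : ℂ × ℂ | q.1 ∈ Ω} :=
    (hx.convex.linear_preimage (LinearMap.fst ℝ ℂ ℂ)).isPreconnected
  exact (hp.analyticOnNhd_hol hx hf).eqOn_zero_of_preconnected_of_eventuallyEq_zero hc
    (z₀ := (τ₀, w₀)) h0 h (show (τ, w).1 ∈ Ω from hτ)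

/-- `Ent` asks for one suitable normalisation of the primitives. Primitives in two parametrisations
differ by an entire function of the pole, which the normalisation absorbs; a local comparison is
then enough. -/
theorem Ent.comp (hx : Dev x dx Ω) (h : Ent κ (fun τ => τ) (fun _ => 1) Ω' f)
    (hf : Sol κ (fun _ => 1) Ω' f) (hg : Sol κ dx Ω g) {τ₀ : ℂ} (h0 : τ₀ ∈ Ω)
    (h1 : ∀ᶠ τ in 𝓝 τ₀, x τ ∈ Ω' ∧ f (x τ) = g τ) : Ent κ x dx Ω g := by
  obtain ⟨p, hp, hp0⟩ := h
  obtain ⟨q, hq⟩ := hg.exists_PF hx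
  obtain ⟨r, hr, hball⟩ := Metric.eventually_nhds_iff_ball.1 (h1.and (hx.isOpen.mem_nhds h0))
  have hpb := hp.comp (Ω := Metric.ball τ₀ r) (y := x) (dy := dx) hf
    (fun τ hτ => hx.hasDerivAt τ (hball τ hτ).2) fun τ hτ => (hball τ hτ).1.1
  obtain ⟨J, hJ, hqJ⟩ := hq.exists_entire Metric.isOpen_ball (convex_ball _ _).isPreconnected hpb
    (fun τ hτ => (hball τ hτ).2) fun τ hτ => (hball τ hτ).1.2.symm
  refine (hq.add_entire hJ).ent_of_eventually hx hg h0 (w₀ := 0) ?_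
  filter_upwards [continuousAt_fst.preimage_mem_nhds (Metric.ball_mem_nhds τ₀ hr)] with s hs
  rw [← hqJ _ hs, hp0 _ (hball _ hs).1.1]

theorem Ent.of_comp (hx : Dev x dx Ω) (hΩ' : IsOpen Ω') (hcΩ' : Convex ℝ Ω') (h : Ent κ x dx Ω g)
    (hf : Sol κ (fun _ => 1) Ω' f) {τ₀ : ℂ} (h0 : τ₀ ∈ Ω) (hdx : dx τ₀ ≠ 0)
    (h1 : ∀ᶠ τ in 𝓝 τ₀, x τ ∈ Ω' ∧ f (x τ) = g τ) :
    Ent κ (fun τ => τ) (fun _ => 1) Ω' f := by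
  obtain ⟨q, hq, hq0⟩ := h
  obtain ⟨p, hp⟩ := hf.exists_PF (Dev.id hΩ' hcΩ')
  obtain ⟨r, hr, hball⟩ := Metric.eventually_nhds_iff_ball.1 (h1.and (hx.isOpen.mem_nhds h0))
  have hpb := hp.comp (Ω := Metric.ball τ₀ r) (y := x) (dy := dx) hf
    (fun τ hτ => hx.hasDerivAt τ (hball τ hτ).2) fun τ hτ => (hball τ hτ).1.1
  have hqb : PF κ x dx (Metric.ball τ₀ r) (fun τ => f (x τ)) q :=
    { deriv := fun A τ hτ => by
        refine (hq.deriv A τ (hball τ hτ).2).congr_fderiv ?_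
        have : dz (fun τ => f (x τ)) τ = dz g τ := by
          refine Filter.EventuallyEq.dz_eq ?_
          filter_upwards [Metric.isOpen_ball.mem_nhds hτ] with s hs
          exact (hball s hs).1.2
        rw [green, green, this, (hball τ hτ).1.2]
      entire := fun τ hτ => hq.entire τ (hball τ hτ).2 }
  obtain ⟨J, hJ, hqJ⟩ := hpb.exists_entire Metric.isOpen_ball (convex_ball _ _).isPreconnected hqb
    subset_rfl fun τ _ => rfl
  have hmem := (hball τ₀ (Metric.mem_ball_self hr)).1.1
  refine (hp.add_entire hJ).ent_of_eventually (Dev.id hΩ' hcΩ') hf hmem (w₀ := 0) ?_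
  have hz : ∀ᶠ z in 𝓝 (x τ₀), ∀ w, p z (z, w) + J (z, w) = 0 := by
    rw [← hx.map_nhds h0 hdx, eventually_map]
    filter_upwards [Metric.ball_mem_nhds τ₀ hr] with τ hτ w
    rw [← hqJ τ hτ, hq0 τ (hball τ hτ).2]
  filter_upwards [continuousAt_fst.eventually hz] with s hs
  exact hs _

end EntLemmas

/-! ## Translations in the logarithmic coordinate -/

/-- The translation by `h` of the plane in the coordinate `s`, where the affix is `exp s`. -/
noncomputable def shift (h s : ℂ) : ℂ := s + log (1 + h * exp (-s))

section Shift

variable {h s : ℂ}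

theorem norm_shift_arg_le (hh : ‖h‖ ≤ 1) (hs : 1 ≤ s.re) : ‖h * exp (-s)‖ ≤ 1 / 2 := by
  have h2 : (2 : ℝ) ≤ Real.exp s.re := by
    have := Real.add_one_le_exp (1 : ℝ)
    linarith [Real.exp_le_exp.2 hs]
  rw [norm_mul, norm_exp, neg_re, Real.exp_neg]
  calc ‖h‖ * (Real.exp s.re)⁻¹ ≤ 1 * 2⁻¹ := by gcongr
    _ = 1 / 2 := by norm_num

theorem shift_arg_mem_slitPlane (hh : ‖h‖ ≤ 1) (hs : 1 ≤ s.re) : 1 + h * exp (-s) ∈ slitPlane := by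
  refine Or.inl ?_
  have := (abs_re_le_norm (h * exp (-s))).trans (norm_shift_arg_le hh hs)
  rw [add_re, one_re]
  linarith [(abs_le.1 this).1]

theorem exp_shift (hh : ‖h‖ ≤ 1) (hs : 1 ≤ s.re) : exp (shift h s) = exp s + h := by
  rw [shift, exp_add, exp_log (slitPlane_ne_zero (shift_arg_mem_slitPlane hh hs)), mul_add, mul_one,
    mul_left_comm, ← exp_add, add_neg_cancel, exp_zero, mul_one]

theorem sub_one_lt_re_shift (hh : ‖h‖ ≤ 1) (hs : 1 ≤ s.re) : s.re - 1 < (shift h s).re := by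
  have h1 : (1 / 2 : ℝ) ≤ ‖1 + h * exp (-s)‖ := by
    have h2 := norm_sub_norm_le (1 : ℂ) (-(h * exp (-s)))
    rw [sub_neg_eq_add, norm_neg, norm_one] at h2
    linarith [norm_shift_arg_le hh hs]
  have h3 : -1 < Real.log ‖1 + h * exp (-s)‖ := by
    refine lt_of_lt_of_le ?_ (Real.log_le_log (by norm_num) h1)
    rw [one_div, Real.log_inv]
    linarith [Real.log_two_lt_d9]
  rw [shift, add_re, log_re]
  linarith

theorem hasDerivAt_shift (hh : ‖h‖ ≤ 1) (hs : 1 ≤ s.re) :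
    HasDerivAt (shift h) (exp s / exp (shift h s)) s := by
  have h1 : HasDerivAt (fun s => 1 + h * exp (-s)) (h * (exp (-s) * -1)) s :=
    ((hasDerivAt_neg s).cexp.const_mul h).const_add 1
  refine ((hasDerivAt_id s).add (h1.clog (shift_arg_mem_slitPlane hh hs))).congr_deriv ?_
  have h2 := slitPlane_ne_zero (shift_arg_mem_slitPlane hh hs)
  have h3 : exp (shift h s) = exp s * (1 + h * exp (-s)) := by
    rw [shift, exp_add, exp_log h2]
  rw [h3, div_mul_eq_div_div, div_self (exp_ne_zero s)]
  field_simp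
  ring

theorem conj_shift (hh : ‖h‖ ≤ 1) (hs : 1 ≤ s.re) :
    (starRingEnd ℂ) (shift h s) = shift ((starRingEnd ℂ) h) ((starRingEnd ℂ) s) := by
  rw [shift, shift, map_add, ← log_conj _ (slitPlane_arg_ne_pi (shift_arg_mem_slitPlane hh hs)),
    map_add, map_one, map_mul, ← exp_conj, map_neg]

theorem shift_add_period (m : ℕ) (h s : ℂ) : shift h (s + (2 * Real.pi * m : ℝ) * I) =
    shift h s + (2 * Real.pi * m : ℝ) * I := by
  have : exp (-(s + (2 * Real.pi * m : ℝ) * I)) = exp (-s) := by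
    rw [exp_eq_exp_iff_exists_int]
    exact ⟨-m, by push_cast; ring⟩
  rw [shift, shift, this]; ring

end Shift

/-! ## Solutions at infinity -/

theorem AnalyticOnNhd.pd₂ {W : ℂ × ℂ → ℂ} {U : Set (ℂ × ℂ)} (hW : AnalyticOnNhd ℂ W U) :
    AnalyticOnNhd ℂ (pd₂ W) U := fun q hq =>
  ((ContinuousLinearMap.apply ℂ ℂ ((0, 1) : ℂ × ℂ)).analyticAt _).comp (hW.fderiv q hq)

theorem pd₂_eq_deriv {W : ℂ × ℂ → ℂ} {q : ℂ × ℂ} (hW : DifferentiableAt ℂ W q) :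
    pd₂ W q = deriv (fun s => W (q.1, s)) q.2 := by
  have := hasDerivAt_comp_prod (W := W) (a := fun _ => q.1) (b := fun s => s) (s := q.2) hW
    (hasDerivAt_const _ _) (hasDerivAt_id _)
  rw [this.deriv]; simp

section Far

variable {L L' : ℝ} {κ α β : ℂ} {V : ℂ × ℂ → ℂ}

theorem dev_exp (L : ℝ) : Dev exp exp {τ : ℂ | L < τ.re} :=
  ⟨isOpen_re_gt L, convex_halfSpace_re_gt L, fun τ _ => hasDerivAt_exp τ,
    fun _ _ => differentiableAt_exp⟩

/-- Uniqueness on the diagonal, in the coordinate τ with z = e^τ, gives V = 0 at z = e^τ for Re τ >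
L. Since V(·, s) is entire, vanishing near one such z is enough. -/
theorem eq_zero_of_exp_diag (hV : AnalyticOnNhd ℂ V {q | L < q.2.re})
    (h : ∀ τ : ℂ, L < τ.re → V (exp τ, (starRingEnd ℂ) τ) = 0) {q : ℂ × ℂ} (hq : L < q.2.re) :
    V q = 0 := by
  have h1 : ∀ τ s : ℂ, L < τ.re → L < s.re → V (exp τ, s) = 0 := fun τ s hτ hs => by
    have hF : AnalyticOnNhd ℂ (fun q : ℂ × ℂ => V (exp q.1, q.2))
        {q | q.1 ∈ {τ : ℂ | L < τ.re} ∧ (starRingEnd ℂ) q.2 ∈ {τ : ℂ | L < τ.re}} := fun q hq => by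
      have hq2 : L < q.2.re := by simpa using hq.2
      exact AnalyticAt.comp (g := V) (f := fun q : ℂ × ℂ => (exp q.1, q.2)) (hV _ hq2)
        ((analyticAt_cexp.comp analyticAt_fst).prod analyticAt_snd)
    refine eqOn_zero_of_diag (convex_halfSpace_re_gt L) hF (τ₀ := τ) hτ ?_ (q := (τ, s)) hτ
      (by simpa using hs)
    filter_upwards [(isOpen_re_gt L).mem_nhds hτ] with y hy
    exact h y hy
  obtain ⟨z, s⟩ := q
  have hd : AnalyticOnNhd ℂ (fun z => V (z, s)) univ := fun z _ =>
    AnalyticAt.comp (g := V) (f := fun z => (z, s)) (hV (z, s) hq) (analyticAt_id.prod analyticAt_const)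
  set z₀ : ℂ := exp ((L + 1 : ℝ) : ℂ) with hz₀
  have hz₀' : z₀ = (Real.exp (L + 1) : ℝ) := by rw [hz₀, ofReal_exp]
  have hsl : z₀ ∈ slitPlane := by rw [hz₀']; exact Or.inl (by rw [ofReal_re]; exact Real.exp_pos _)
  have hlog : log z₀ = (L + 1 : ℝ) := by
    rw [hz₀', ← ofReal_log (Real.exp_pos _).le, Real.log_exp]
  have hev : ∀ᶠ z in 𝓝 z₀, V (z, s) = 0 := by
    have h2 : ∀ᶠ z in 𝓝 z₀, L < (log z).re := by
      have h3 : {w : ℂ | L < w.re} ∈ 𝓝 (log z₀) := (isOpen_re_gt L).mem_nhds (by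
        rw [hlog]; simp)
      exact (continuousAt_clog hsl).preimage_mem_nhds h3
    filter_upwards [h2, isOpen_slitPlane.mem_nhds hsl] with z hz hz'
    rw [← exp_log (slitPlane_ne_zero hz')]
    exact h1 _ _ hz hq
  exact hd.eqOn_zero_of_preconnected_of_eventuallyEq_zero isPreconnected_univ (mem_univ z₀) hev
    (mem_univ z)

/-- The continuation of a solution that is entire in the first variable. -/
theorem Ent.exists_analytic {v : ℂ → ℂ} (hv : Sol κ exp {τ | L < τ.re} v)
    (he : Ent κ exp exp {τ | L < τ.re} v) : ∃ V : ℂ × ℂ → ℂ,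
      AnalyticOnNhd ℂ V {q | L < q.2.re} ∧
      (∀ τ : ℂ, L < τ.re → V (exp τ, (starRingEnd ℂ) τ) = v τ) ∧
      ∀ q : ℂ × ℂ, L < q.2.re → pd₂ (pd₁ V) q = -κ * exp q.2 * V q := by
  obtain ⟨p, hp, hp0⟩ := he
  have hV := hp.analyticOnNhd_anti (dev_exp L) hv
  -- With the first branching part zero, the second one is the whole continuation; as p is entire in
  -- the pole, z may be any complex number.
  set V : ℂ × ℂ → ℂ := fun q => v ((starRingEnd ℂ) q.2) -
    p ((starRingEnd ℂ) q.2) (q.1, (starRingEnd ℂ) (exp ((starRingEnd ℂ) q.2))) with hVdef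
  have hset : {q : ℂ × ℂ | (starRingEnd ℂ) q.2 ∈ {τ : ℂ | L < τ.re}} = {q | L < q.2.re} := by
    ext q; simp
  rw [hset] at hV
  have hdiag : ∀ τ : ℂ, L < τ.re → V (exp τ, (starRingEnd ℂ) τ) = v τ := fun τ hτ => by
    simp only [hVdef, Complex.conj_conj]
    rw [hp0 τ hτ, sub_zero]
  refine ⟨V, hV, hdiag, fun q hq => ?_⟩
  -- On the diagonal the equation is the one satisfied by v; uniqueness carries it to the whole
  -- domain.
  have hA : AnalyticOnNhd ℂ (fun q => pd₂ (pd₁ V) q + κ * exp q.2 * V q) {q | L < q.2.re} :=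
    fun q hq => (hV.pd₁.pd₂ q hq).add ((analyticAt_const.mul
      (analyticAt_cexp.comp analyticAt_snd)).mul (hV q hq))
  have := eq_zero_of_exp_diag hA (fun τ hτ => ?_) hq
  · linear_combination this
  have hmem : ∀ {τ : ℂ}, L < τ.re → ((exp τ, (starRingEnd ℂ) τ) : ℂ × ℂ) ∈ {q : ℂ × ℂ | L < q.2.re} :=
    fun hτ => by simpa using hτ
  have h1 : ∀ τ : ℂ, L < τ.re → dz v τ = pd₁ V (exp τ, (starRingEnd ℂ) τ) * exp τ := fun τ hτ => by
    refine dz_eq_of_hasFDerivAt ((hasFDerivAt_diag (V := V) (hasDerivAt_exp τ)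
      (hV _ (hmem hτ)).differentiableAt).congr_of_eventuallyEq ?_)
    filter_upwards [(isOpen_re_gt L).mem_nhds hτ] with y hy
    exact (hdiag y hy).symm
  have h2 := (hasFDerivAt_diag (V := pd₁ V) (hasDerivAt_exp τ)
    (hV.pd₁ _ (hmem hτ)).differentiableAt).mul (hasDerivAt_exp τ).hasFDerivAt_wirt
  obtain ⟨-, e, h3⟩ := hv τ hτ
  have h4 : HasFDerivAt (dz v) (wirt (pd₁ V (exp τ, (starRingEnd ℂ) τ) * exp τ +
      exp τ * (pd₁ (pd₁ V) (exp τ, (starRingEnd ℂ) τ) * exp τ))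
      (exp τ * pd₂ (pd₁ V) (exp τ, (starRingEnd ℂ) τ))) τ := by
    refine (h2.congr_of_eventuallyEq ?_).congr_fderiv ?_
    · filter_upwards [(isOpen_re_gt L).mem_nhds hτ] with y hy
      exact h1 y hy
    · ext1 v; simp; ring
  have h5 := (dzb_eq_of_hasFDerivAt h3).symm.trans (dzb_eq_of_hasFDerivAt h4)
  rw [hdiag τ hτ]
  refine mul_left_cancel₀ (exp_ne_zero τ) ?_
  simp only
  rw [exp_conj]
  linear_combination -h5

/-- The Helmholtz equation is invariant under translations, which `shift` realises in the
logarithmic coordinate. The defect of v from being an eigenfunction of translation by h, with the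
multiplier of the plane wave, decays; hence `eq_zero_of_decay` annihilates it. A common
eigenfunction of all small translations is locally a multiple of the plane wave. -/
theorem eq_wave_of_shift {v : ℂ → ℂ} {m : ℕ} (hm : 0 < m) (hκ : 0 < κ.im)
    (hv : Sol κ exp {τ | L < τ.re} v) (he : Ent κ exp exp {τ | L < τ.re} v)
    (hper : ∀ τ : ℂ, L < τ.re → v (τ + (2 * Real.pi * m : ℝ) * I) = v τ)
    (hL1 : 1 ≤ L') (hLL : L + 1 ≤ L') {K δ : ℝ} (hδ : 0 < δ)
    (hsh : ∀ h τ : ℂ, ‖h‖ ≤ 1 → L' < τ.re →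
      ‖v (shift h τ) - exp (α * h + β * (starRingEnd ℂ) h) * v τ‖ ≤
        K * Real.exp (-δ * Real.exp τ.re)) {τ₁ : ℂ} (hτ₁ : L' < τ₁.re) :
    ∃ c, ∀ᶠ τ in 𝓝 τ₁, v τ = c * wave α β (exp τ) := by
  obtain ⟨V, hV, hdiag, hpde⟩ := he.exists_analytic hv
  have hVper : ∀ z s : ℂ, L < s.re → V (z, s + (2 * Real.pi * m : ℝ) * I) = V (z, s) :=
    fun z s hs => by
    have hA : AnalyticOnNhd ℂ (fun q : ℂ × ℂ => V (q.1, q.2 + (2 * Real.pi * m : ℝ) * I) - V q)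
        {q | L < q.2.re} := fun q hq => by
      refine AnalyticAt.sub ?_ (hV q hq)
      exact AnalyticAt.comp (g := V) (f := fun q : ℂ × ℂ => (q.1, q.2 + (2 * Real.pi * m : ℝ) * I))
        (hV _ (show L < (q.2 + (2 * Real.pi * m : ℝ) * I).re by simpa using hq))
        (analyticAt_fst.prod (analyticAt_snd.add analyticAt_const))
    refine sub_eq_zero.1 (eq_zero_of_exp_diag hA (fun τ hτ => ?_) (q := (z, s)) hs)
    have hτ' : L < (τ - (2 * Real.pi * m : ℝ) * I).re := by simpa using hτ
    have e1 : (starRingEnd ℂ) τ + (2 * Real.pi * m : ℝ) * I =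
        (starRingEnd ℂ) (τ - (2 * Real.pi * m : ℝ) * I) := by
      rw [map_sub, map_mul, conj_ofReal, conj_I]; ring
    have e2 : exp τ = exp (τ - (2 * Real.pi * m : ℝ) * I) := by
      rw [exp_eq_exp_iff_exists_int]; exact ⟨m, by push_cast; ring⟩
    simp only
    rw [hdiag τ hτ, e1, e2, hdiag _ hτ', ← hper _ hτ', sub_add_cancel, sub_self]
  have key : ∀ h : ℂ, ‖h‖ ≤ 1 → ∀ τ : ℂ, L' < τ.re →
      v (shift h τ) = exp (α * h + β * (starRingEnd ℂ) h) * v τ := fun h hh τ hτ => by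
    set e : ℂ := exp (α * h + β * (starRingEnd ℂ) h) with hedef
    set h' : ℂ := (starRingEnd ℂ) h with hh'def
    have hh' : ‖h'‖ ≤ 1 := by rw [hh'def, RCLike.norm_conj]; exact hh
    have hre : ∀ {s : ℂ}, L' < s.re → L < (shift h' s).re := fun {s} hs => by
      linarith [sub_one_lt_re_shift hh' (hL1.trans hs.le)]
    have hLs : ∀ {s : ℂ}, L' < s.re → L < s.re := fun hs => by linarith
    -- On the real plane, translation by h moves z by h and z̄ by the conjugate of h; in ℂ² the two
    -- coordinates are moved independently. W inherits the equation, the period and the entirety in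
    -- z.
    let W : ℂ × ℂ → ℂ := fun q => V (q.1 + h, shift h' q.2) - e * V q
    have hsan : ∀ s : ℂ, L' < s.re → AnalyticAt ℂ (shift h') s := fun s hs => by
      refine analyticAt_id.add (AnalyticAt.clog ?_ (shift_arg_mem_slitPlane hh' (hL1.trans hs.le)))
      exact analyticAt_const.add (analyticAt_const.mul
        (analyticAt_cexp.comp analyticAt_id.neg))
    have hW : AnalyticOnNhd ℂ W {q | L' < q.2.re} := fun q hq => by
      refine AnalyticAt.sub ?_ (analyticAt_const.mul (hV q (hLs hq)))
      exact AnalyticAt.comp (g := V) (f := fun q : ℂ × ℂ => (q.1 + h, shift h' q.2))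
        (hV _ (hre hq)) ((analyticAt_fst.add analyticAt_const).prod
          ((hsan _ hq).comp analyticAt_snd))
    have hW1 : ∀ q : ℂ × ℂ, L' < q.2.re →
        pd₁ W q = pd₁ V (q.1 + h, shift h' q.2) - e * pd₁ V q := fun q hq => by
      rw [pd₁_eq_deriv (hW q hq).differentiableAt]
      have h1 := hasDerivAt_comp_prod (W := V) (a := fun z => z + h) (b := fun _ => shift h' q.2)
        (s := q.1) (hV _ (hre hq)).differentiableAt ((hasDerivAt_id _).add_const _)
        (hasDerivAt_const _ _)
      have h2 := hasDerivAt_comp_prod (W := V) (a := fun z => z) (b := fun _ => q.2)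
        (s := q.1) (hV _ (hLs hq)).differentiableAt (hasDerivAt_id _) (hasDerivAt_const _ _)
      exact ((h1.sub (h2.const_mul e)).congr_deriv (by ring)).deriv
    have hWpde : ∀ q : ℂ × ℂ, L' < q.2.re → pd₂ (pd₁ W) q = -κ * exp q.2 * W q := fun q hq => by
      rw [pd₂_eq_deriv (hW.pd₁ q hq).differentiableAt]
      have h0 := hasDerivAt_shift hh' (hL1.trans (le_of_lt hq))
      have h1 := hasDerivAt_comp_prod (W := pd₁ V) (a := fun _ => q.1 + h) (b := shift h')
        (s := q.2) (hV.pd₁ _ (hre hq)).differentiableAt (hasDerivAt_const _ _) h0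
      have h2 := hasDerivAt_comp_prod (W := pd₁ V) (a := fun _ => q.1) (b := fun s => s)
        (s := q.2) (hV.pd₁ _ (hLs hq)).differentiableAt (hasDerivAt_const _ _) (hasDerivAt_id _)
      have h3 := (h1.sub (h2.const_mul e)).congr_of_eventuallyEq
        (f₁ := fun s => pd₁ W (q.1, s)) (by
          filter_upwards [(isOpen_re_gt L').mem_nhds hq] with s hs
          exact hW1 _ hs)
      rw [h3.deriv, hpde _ (hre hq), hpde _ (hLs hq)]
      simp only [W]
      have := exp_ne_zero (shift h' q.2)
      field_simp
      ring
    have hWper : ∀ z s : ℂ, L' < s.re → W (z, s + (2 * Real.pi * m : ℝ) * I) = W (z, s) :=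
      fun z s hs => by
        simp only [W]
        rw [shift_add_period, hVper _ _ (hre hs), hVper _ _ (hLs hs)]
    have hWdiag : ∀ τ : ℂ, L' < τ.re → W (exp τ, (starRingEnd ℂ) τ) = v (shift h τ) - e * v τ :=
      fun τ hτ => by
        have hτ1 : 1 ≤ τ.re := hL1.trans hτ.le
        simp only [W]
        rw [hdiag τ (hLs hτ), hh'def, ← conj_shift hh hτ1, ← exp_shift hh hτ1, hdiag]
        linarith [sub_one_lt_re_shift hh hτ1]
    have hz := eq_zero_of_decay (L := L') hκ hm hW hWper hWpde hδ (K := K) (fun τ hτ => by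
      rw [hWdiag τ hτ]; exact hsh h τ hh hτ) (q := (exp τ, (starRingEnd ℂ) τ)) (by simpa using hτ)
    rw [hWdiag τ hτ] at hz
    exact sub_eq_zero.1 hz
  refine ⟨v τ₁ / wave α β (exp τ₁), ?_⟩
  have c1 : Tendsto (fun τ => exp τ - exp τ₁) (𝓝 τ₁) (𝓝 0) := by
    have : ContinuousAt (fun τ => exp τ - exp τ₁) τ₁ := by fun_prop
    simpa [ContinuousAt] using this
  have c2 : Tendsto (fun τ => (τ - τ₁).im) (𝓝 τ₁) (𝓝 0) := by
    have : ContinuousAt (fun τ => (τ - τ₁).im) τ₁ := by fun_prop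
    simpa [ContinuousAt] using this
  filter_upwards [c1.eventually (Metric.closedBall_mem_nhds 0 one_pos),
    c2.eventually (Ioo_mem_nhds (neg_lt_zero.2 Real.pi_pos) Real.pi_pos)] with τ h1 h2
  have h1' : ‖exp τ - exp τ₁‖ ≤ 1 := by simpa using h1
  -- Every τ near τ₁ arises from τ₁ by a translation; |Im(τ − τ₁)| < π selects the right branch of
  -- the logarithm.
  have hs : shift (exp τ - exp τ₁) τ₁ = τ := by
    have : 1 + (exp τ - exp τ₁) * exp (-τ₁) = exp (τ - τ₁) := by
      rw [sub_mul, ← exp_add, ← exp_add, add_neg_cancel, exp_zero]; ring_nf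
    rw [shift, this, log_exp h2.1 h2.2.le]
    ring
  have := key _ h1' τ₁ hτ₁
  rw [hs] at this
  have e : exp τ = exp τ₁ + (exp τ - exp τ₁) := by ring
  rw [this]
  conv_rhs => rw [e, wave_add]
  rw [div_mul_eq_mul_div, eq_div_iff (wave_ne_zero _ _ _)]
  ring

end Far

/-! ## Primitives near a branch point -/

section Period

variable {κ c : ℂ} {L K : ℝ} {f : ℂ → ℂ} {p : ℂ → ℂ × ℂ → ℂ} {m : ℕ}

theorem dev_add_exp (c : ℂ) (L : ℝ) : Dev (fun τ => c + exp τ) exp {τ : ℂ | τ.re < L} :=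
  ⟨isOpen_re_lt L, convex_halfSpace_re_lt L, fun τ _ => (hasDerivAt_exp τ).const_add c,
    fun _ _ => differentiableAt_exp⟩

theorem exp_add_period (m : ℕ) (τ : ℂ) : exp (τ + (2 * Real.pi * m : ℝ) * I) = exp τ := by
  rw [exp_eq_exp_iff_exists_int]; exact ⟨m, by push_cast; ring⟩

theorem dz_add_const (f : ℂ → ℂ) (a τ : ℂ) : dz (fun τ => f (τ + a)) τ = dz f (τ + a) := by
  simp only [dz]; rw [fderiv_comp_add_right]

/-- The Green form is invariant under the shift because f and e^τ are, so the increment of its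
primitive is constant. -/
theorem PF.exists_period (hp : PF κ (fun τ => c + exp τ) exp {τ | τ.re < L} f p)
    (hper : ∀ τ : ℂ, τ.re < L → f (τ + (2 * Real.pi * m : ℝ) * I) = f τ) (A : ℂ × ℂ) :
    ∃ J : ℂ, ∀ τ : ℂ, τ.re < L → p (τ + (2 * Real.pi * m : ℝ) * I) A - p τ A = J := by
  set a : ℂ := (2 * Real.pi * m : ℝ) * I with ha
  have hre : ∀ {τ : ℂ}, τ.re < L → (τ + a).re < L := fun hτ => by rw [ha]; simpa using hτ
  have hd : ∀ τ : ℂ, τ.re < L → HasFDerivAt (fun τ => p (τ + a) A - p τ A) (0 : ℂ →L[ℝ] ℂ) τ := by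
    intro τ hτ
    have h1 : HasFDerivAt (fun τ => p (τ + a) A) _ τ :=
      HasFDerivAt.comp (g := fun τ => p τ A) (f := fun τ => τ + a) τ
        (hp.deriv A (τ + a) (hre hτ)) ((hasFDerivAt_id (𝕜 := ℝ) τ).add_const a)
    refine (h1.sub (hp.deriv A τ hτ)).congr_fderiv ?_
    have h2 : dz f (τ + a) = dz f τ := by
      rw [← dz_add_const]
      refine Filter.EventuallyEq.dz_eq ?_
      filter_upwards [(isOpen_re_lt L).mem_nhds hτ] with s hs
      exact hper s hs
    rw [green, green, h2, hper τ hτ, ha, exp_add_period]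
    ext1 v; simp
  refine ⟨p ((L - 1 : ℝ) + a) A - p (L - 1 : ℝ) A, fun τ hτ => ?_⟩
  exact (isOpen_re_lt L).is_const_of_fderiv_eq_zero (𝕜 := ℝ) (convex_halfSpace_re_lt L).isPreconnected
    (fun τ hτ => (hd τ hτ).differentiableAt.differentiableWithinAt)
    (fun τ hτ => (hd τ hτ).fderiv) hτ (by simp)

theorem hasDerivAt_horizontal (σ θ : ℝ) : HasDerivAt (fun σ : ℝ => (σ + θ * I : ℂ)) 1 σ := by
  have := (hasDerivAt_id σ).ofReal_comp.add_const (θ * I : ℂ)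
  simpa using this

/-- The primitives of a solution that is bounded near a branch point have no period. -/
theorem PF.periodic (hf : Sol κ exp {τ | τ.re < L} f)
    (hp : PF κ (fun τ => c + exp τ) exp {τ | τ.re < L} f p)
    (hper : ∀ τ : ℂ, τ.re < L → f (τ + (2 * Real.pi * m : ℝ) * I) = f τ)
    (hK : ∀ τ : ℂ, τ.re < L → ‖f τ‖ ≤ K) (A : ℂ × ℂ) {τ : ℂ} (hτ : τ.re < L) :
    p (τ + (2 * Real.pi * m : ℝ) * I) A = p τ A := by
  obtain ⟨J, hJ⟩ := hp.exists_period hper A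
  suffices h : J = 0 by rw [← sub_eq_zero, hJ τ hτ, h]
  by_contra hJ0
  set T : ℝ := 2 * Real.pi * m with hT
  have hT0 : 0 ≤ T := by positivity
  have hx := dev_add_exp c L
  have hK0 : 0 ≤ K := (norm_nonneg _).trans (hK _ hτ)
  let R : ℂ → ℂ := fun τ => riem κ (c + exp τ) A
  let R₁ : ℂ → ℂ := fun τ => riemHol κ (c + exp τ) A * exp τ
  let R₂ : ℂ → ℂ := fun τ => riemBar κ (c + exp τ) A * (starRingEnd ℂ) (exp τ)
  have hcA : ∀ F : ℂ → ℂ × ℂ → ℂ, Continuous (fun q : ℂ × (ℂ × ℂ) => F q.1 q.2) →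
      Continuous fun z => F z A := fun F hF => hF.comp (by fun_prop : Continuous fun z : ℂ => (z, A))
  have cR : Continuous R := (hcA _ (continuous_riem κ)).comp (by fun_prop)
  have cR₁ : Continuous R₁ := ((hcA _ (continuous_riemHol κ)).comp (by fun_prop)).mul (by fun_prop)
  have cR₂ : Continuous R₂ := ((hcA _ (continuous_riemBar κ)).comp (by fun_prop)).mul
    (continuous_conj.comp continuous_exp)
  have hR : ∀ τ, HasFDerivAt R (wirt (R₁ τ) (R₂ τ)) τ := fun τ => by
    refine (HasFDerivAt.comp τ (hasFDerivAt_riem κ (c + exp τ) A)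
      ((hasDerivAt_exp τ).const_add c).hasFDerivAt_wirt).congr_fderiv ?_
    rw [wirt_comp]
    simp [R₁, R₂]
  have hcomp := isCompact_closedBall c (Real.exp L)
  obtain ⟨C₀, hC₀⟩ := hcomp.exists_bound_of_continuousOn (hcA _ (continuous_riem κ)).continuousOn
  obtain ⟨C₁, hC₁⟩ := hcomp.exists_bound_of_continuousOn (hcA _ (continuous_riemHol κ)).continuousOn
  obtain ⟨C₂, hC₂⟩ := hcomp.exists_bound_of_continuousOn (hcA _ (continuous_riemBar κ)).continuousOn
  have hmem : ∀ τ : ℂ, τ.re < L → c + exp τ ∈ Metric.closedBall c (Real.exp L) := fun τ hτ => by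
    rw [mem_closedBall_iff_norm, add_sub_cancel_left, norm_exp]
    exact Real.exp_le_exp.2 hτ.le
  have hC00 : 0 ≤ C₀ := (norm_nonneg _).trans (hC₀ _ (hmem τ hτ))
  have hC10 : 0 ≤ C₁ := (norm_nonneg _).trans (hC₁ _ (hmem τ hτ))
  have hC20 : 0 ≤ C₂ := (norm_nonneg _).trans (hC₂ _ (hmem τ hτ))
  have hbR : ∀ τ : ℂ, τ.re < L → ‖R τ * f τ‖ ≤ C₀ * K := fun τ hτ => by
    rw [norm_mul]
    exact mul_le_mul (hC₀ _ (hmem τ hτ)) (hK τ hτ) (norm_nonneg _) hC00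
  have hbR' : ∀ τ : ℂ, τ.re < L → ‖f τ * (R₁ τ + R₂ τ)‖ ≤ K * (C₁ + C₂) * Real.exp τ.re :=
    fun τ hτ => by
    rw [norm_mul, mul_assoc]
    refine mul_le_mul (hK τ hτ) ?_ (norm_nonneg _) hK0
    refine (norm_add_le _ _).trans ?_
    simp only [R₁, R₂]
    rw [norm_mul, norm_mul, RCLike.norm_conj, norm_exp, add_mul]
    have h1 := hC₁ _ (hmem τ hτ)
    have h2 := hC₂ _ (hmem τ hτ)
    gcongr
  have hre : ∀ {σ : ℝ} (θ : ℝ), σ < L → (σ + θ * I : ℂ).re < L := fun θ h => by simpa using h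
  -- Integration by parts along the loop Re τ = σ gives N' = −2iJ + 2Y with Y = O(e^σ). Since f is
  -- bounded, so is N, which excludes J ≠ 0 as σ → −∞.
  let N : ℝ → ℂ := fun σ => ∫ θ in (0:ℝ)..T, R (σ + θ * I) * f (σ + θ * I)
  let S : ℂ → ℂ := fun τ => (R₁ τ + R₂ τ) * f τ + R τ * (dz f τ + dzb f τ)
  have hcS : ContinuousOn S {τ | τ.re < L} :=
    ((cR₁.add cR₂).continuousOn.mul hf.continuousOn).add
      (cR.continuousOn.mul (hf.continuousOn_dz.add (hf.continuousOn_dzb hx)))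
  have hcF : ContinuousOn (fun τ => R τ * f τ) {τ | τ.re < L} := cR.continuousOn.mul hf.continuousOn
  have hmaps : MapsTo (fun q : ℝ × ℝ => (q.1 + q.2 * I : ℂ)) (Iio L ×ˢ Icc 0 T) {τ | τ.re < L} :=
    fun q hq => hre _ hq.1
  have hcq : ContinuousOn (fun q : ℝ × ℝ => (q.1 + q.2 * I : ℂ)) (Iio L ×ˢ Icc 0 T) :=
    Continuous.continuousOn (by fun_prop)
  have hRf : ∀ τ : ℂ, τ.re < L → HasFDerivAt (fun τ => R τ * f τ)
      (R τ • wirt (dz f τ) (dzb f τ) + f τ • wirt (R₁ τ) (R₂ τ)) τ := fun τ hτ =>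
    (hR τ).mul (hf τ hτ).1.hasFDerivAt_wirt
  have hN : ∀ σ, σ < L → HasDerivAt N (∫ θ in (0:ℝ)..T, S (σ + θ * I)) σ := fun σ hσ => by
    refine hasDerivAt_intervalIntegral_of_continuousOn (𝕜 := ℝ) hT0 isOpen_Iio
      (F := fun σ θ => R (σ + θ * I) * f (σ + θ * I)) (F' := fun σ θ => S (σ + θ * I))
      (hcF.comp hcq hmaps) (hcS.comp hcq hmaps) (fun σ hσ θ _ => ?_) hσ
    refine ((hRf _ (hre θ hσ)).comp_hasDerivAt σ (hasDerivAt_horizontal σ θ)).congr_deriv ?_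
    simp [S]; ring
  have hint : ∀ {G : ℂ → ℂ} {σ : ℝ}, ContinuousOn G {τ | τ.re < L} → σ < L →
      IntervalIntegrable (fun θ : ℝ => G (σ + θ * I)) MeasureTheory.volume 0 T := fun {G σ} hG hσ => by
    refine Continuous.intervalIntegrable ?_ _ _
    exact hG.comp_continuous (f := fun θ : ℝ => (σ + θ * I : ℂ)) (by fun_prop) fun θ => hre θ hσ
  have hcY : ContinuousOn (fun τ => f τ * (R₁ τ + R₂ τ)) {τ | τ.re < L} :=
    hf.continuousOn.mul (cR₁.add cR₂).continuousOn
  let Y : ℝ → ℂ := fun σ => ∫ θ in (0:ℝ)..T, f (σ + θ * I) * (R₁ (σ + θ * I) + R₂ (σ + θ * I))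
  have hNJ : ∀ σ, σ < L → ∫ θ in (0:ℝ)..T, S (σ + θ * I) = -2 * I * J + 2 * Y σ := fun σ hσ => by
    let Θ : ℂ → ℂ := fun τ => I * (R₁ τ - R₂ τ) * f τ + R τ * (I * (dz f τ - dzb f τ))
    have hcΘ : ContinuousOn Θ {τ | τ.re < L} :=
      ((continuousOn_const.mul (cR₁.sub cR₂).continuousOn).mul hf.continuousOn).add
      (cR.continuousOn.mul (continuousOn_const.mul
        (hf.continuousOn_dz.sub (hf.continuousOn_dzb hx))))
    have h1 : ∫ θ in (0:ℝ)..T, Θ (σ + θ * I) = 0 := by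
      rw [intervalIntegral.integral_eq_sub_of_hasDerivAt
        (f := fun θ : ℝ => R (σ + θ * I) * f (σ + θ * I)) (fun θ _ => ?_) (hint hcΘ hσ)]
      · simp only [R]
        rw [hper _ (by simpa using hσ), hT, exp_add_period]
        simp
      · refine ((hRf _ (hre θ hσ)).comp_hasDerivAt θ (hasDerivAt_vertical σ θ)).congr_deriv ?_
        simp [Θ]; ring
    -- This is the Green form evaluated on the vertical direction I, written through the horizontal
    -- derivative S of Rf, its vertical derivative Θ, and terms without derivatives of f. Θ
    -- integrates to zero over the loop.
    let G : ℂ → ℂ := fun τ => I / 2 * S τ + 1 / 2 * Θ τ - I * (f τ * (R₁ τ + R₂ τ))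
    have hcG : ContinuousOn G {τ | τ.re < L} :=
      ((continuousOn_const.mul hcS).add (continuousOn_const.mul hcΘ)).sub
        (continuousOn_const.mul hcY)
    have h2 : ∫ θ in (0:ℝ)..T, G (σ + θ * I) = J := by
      rw [intervalIntegral.integral_eq_sub_of_hasDerivAt
        (f := fun θ : ℝ => p (σ + θ * I) A) (fun θ _ => ?_) (hint hcG hσ)]
      · simpa using hJ σ hσ
      · refine ((hp.deriv A _ (hre θ hσ)).comp_hasDerivAt θ (hasDerivAt_vertical σ θ)).congr_deriv ?_
        simp [G, S, Θ, green, R, R₂]; ring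
    simp only [G] at h2
    rw [intervalIntegral.integral_sub, intervalIntegral.integral_add,
      intervalIntegral.integral_const_mul, intervalIntegral.integral_const_mul,
      intervalIntegral.integral_const_mul, h1] at h2
    · simp only [Y]
      linear_combination -2 * I * h2 + (∫ θ in (0:ℝ)..T, S (σ + θ * I)) * I_sq -
        2 * (∫ θ in (0:ℝ)..T, f (σ + θ * I) * (R₁ (σ + θ * I) + R₂ (σ + θ * I))) * I_sq
    · exact (hint hcS hσ).const_mul _
    · exact (hint hcΘ hσ).const_mul _
    · exact ((hint hcS hσ).const_mul _).add ((hint hcΘ hσ).const_mul _)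
    · exact (hint hcY hσ).const_mul _
  set B : ℝ := C₀ * K * T with hB
  have hB0 : 0 ≤ B := by positivity
  have hNB : ∀ σ, σ < L → ‖N σ‖ ≤ B := fun σ hσ => by
    have := intervalIntegral.norm_integral_le_of_norm_le_const (a := 0) (b := T)
      (fun θ _ => hbR _ (hre θ hσ))
    rwa [sub_zero, abs_of_nonneg hT0] at this
  set D : ℝ := 2 * (K * (C₁ + C₂) * T) with hD
  have hD0 : 0 ≤ D := by positivity
  have hYD : ∀ σ, σ < L → ‖2 * Y σ‖ ≤ D * Real.exp σ := fun σ hσ => by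
    have := intervalIntegral.norm_integral_le_of_norm_le_const (a := 0) (b := T)
      (f := fun θ : ℝ => f (σ + θ * I) * (R₁ (σ + θ * I) + R₂ (σ + θ * I)))
      (C := K * (C₁ + C₂) * Real.exp σ) (fun θ _ => by
        have := hbR' _ (hre θ hσ)
        rwa [show (σ + θ * I : ℂ).re = σ by simp] at this)
    rw [sub_zero, abs_of_nonneg hT0] at this
    rw [norm_mul, Complex.norm_ofNat, hD]
    simp only [Y]
    nlinarith
  have hJpos : 0 < ‖J‖ := norm_pos_iff.2 hJ0
  obtain ⟨σ₀, hσL, hσ₀⟩ : ∃ σ₀, σ₀ < L ∧ D * Real.exp σ₀ ≤ ‖J‖ := by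
    have h1 : Tendsto (fun σ => D * Real.exp σ) atBot (𝓝 0) := by
      simpa using Real.tendsto_exp_atBot.const_mul D
    exact ((eventually_lt_atBot L).and (h1.eventually (ge_mem_nhds hJpos))).exists
  have hM : ∀ σ ∈ Iic σ₀, HasDerivWithinAt (fun σ : ℝ => N σ + 2 * I * J * σ) (2 * Y σ) (Iic σ₀) σ :=
    fun σ hσ => by
      have hσ' : σ < L := lt_of_le_of_lt hσ hσL
      have h1 : HasDerivAt (fun σ : ℝ => 2 * I * J * (σ : ℂ)) (2 * I * J) σ := by
        simpa using (hasDerivAt_id σ).ofReal_comp.const_mul (2 * I * J)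
      refine (((hN σ hσ').add h1).congr_deriv ?_).hasDerivWithinAt
      rw [hNJ σ hσ']; ring
  -- Over this length the term 2iJσ varies by 2(2B + 1), while the error contributes at most 2B + 1
  -- and N at most 2B.
  set σ₁ : ℝ := σ₀ - (2 * B + 1) / ‖J‖ with hσ₁
  have hle : σ₁ ≤ σ₀ := by rw [hσ₁]; have : 0 ≤ (2 * B + 1) / ‖J‖ := by positivity
                           linarith
  have h1 := (convex_Iic σ₀).norm_image_sub_le_of_norm_hasDerivWithin_le hM (C := ‖J‖)
    (fun σ hσ => (hYD σ (lt_of_le_of_lt hσ hσL)).trans (le_trans (by gcongr; exact hσ) hσ₀))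
    (self_mem_Iic) (show σ₁ ∈ Iic σ₀ from hle)
  have h2 : ‖(σ₁ - σ₀ : ℝ)‖ = (2 * B + 1) / ‖J‖ := by
    rw [hσ₁, sub_sub_cancel_left, norm_neg, Real.norm_of_nonneg (by positivity)]
  rw [h2, mul_div_cancel₀ _ hJpos.ne'] at h1
  have h3 : ‖2 * I * J * ((σ₁ - σ₀ : ℝ) : ℂ)‖ = 2 * (2 * B + 1) := by
    rw [norm_mul, norm_real, h2, norm_mul, norm_mul, norm_I, Complex.norm_ofNat]
    field_simp
  have h4 : 2 * I * J * ((σ₁ - σ₀ : ℝ) : ℂ) = (N σ₁ + 2 * I * J * σ₁ - (N σ₀ + 2 * I * J * σ₀)) -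
      (N σ₁ - N σ₀) := by push_cast; ring
  have h5 := norm_sub_le (N σ₁ + 2 * I * J * σ₁ - (N σ₀ + 2 * I * J * σ₀)) (N σ₁ - N σ₀)
  rw [← h4, h3] at h5
  have h6 := norm_sub_le (N σ₁) (N σ₀)
  linarith [hNB σ₁ (lt_of_le_of_lt hle hσL), hNB σ₀ hσL]

end Period

/-! ## Branched coverings of the plane with a solution of the diffraction problem -/

/-- The data of the diffraction problem in the characteristic coordinates: a branched covering `ψ`
of the plane, branching over `P` only, a solution `u` and the plane wave `wave α β`. -/
structure ScatteringData {S : Type*} [TopologicalSpace S] (P : Set ℂ) (ψ : S → ℂ) (κ α β : ℂ)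
    (u : S → ℂ) : Prop where
  finite : P.Finite
  proper : IsProperMap ψ
  order : ∀ Q, ∃ m, HasBranchingOrder ψ Q m
  order_one : ∀ Q, ψ Q ∉ P → HasBranchingOrder ψ Q 1
  cont : Continuous u
  sol : ∀ (U : Set ℂ) (g : ℂ → S), IsOpen U → Disjoint U P → ContinuousOn g U →
    (∀ x ∈ U, ψ (g x) = x) → Sol κ (fun _ => 1) U (u ∘ g)
  im_pos : 0 < κ.im
  mul_eq : α * β = -κ
  -- Sheets and cuts are forgotten here: ε may vary from point to point, and no continuity of ε is
  -- assumed.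
  far : ∃ δ > 0, ∃ K : ℝ, ∀ a, ∃ ε : ℂ, (ε = 0 ∨ ε = 1) ∧
    ‖u a - ε * wave α β (ψ a)‖ ≤ K * Real.exp (-δ * ‖ψ a‖)
  -- This is how the single illuminated sheet enters: arbitrarily far away, u tells one point of a
  -- fibre from all the others.
  sep : ∀ R : ℝ, ∃ a, R < ‖ψ a‖ ∧ ψ a ∉ P ∧ ∀ a', a' ≠ a → ψ a' = ψ a → u a' ≠ u a

/-- `G` is a lift to `S` of the local biholomorphism `x : Ω → ℂ ∖ P`. -/
structure Lift {S : Type*} [TopologicalSpace S] (P : Set ℂ) (ψ : S → ℂ) (x dx : ℂ → ℂ)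
    (Ω : Set ℂ) (G : ℂ → S) : Prop where
  dev : Dev x dx Ω
  ne : ∀ τ ∈ Ω, dx τ ≠ 0
  cont : ContinuousOn G Ω
  proj : ∀ τ ∈ Ω, ψ (G τ) = x τ
  avoid : ∀ τ ∈ Ω, x τ ∉ P

namespace ScatteringData

variable {S : Type*} [TopologicalSpace S] {P : Set ℂ} {ψ : S → ℂ} {κ α β : ℂ}
  {u : S → ℂ} {x dx : ℂ → ℂ} {Ω : Set ℂ} {G G' : ℂ → S}

theorem isOpen_compl (D : ScatteringData P ψ κ α β u) : IsOpen Pᶜ := D.finite.isClosed.isOpen_compl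

theorem isLocalHomeomorphOn (D : ScatteringData P ψ κ α β u) : IsLocalHomeomorphOn ψ (ψ ⁻¹' Pᶜ) := by
  refine .mk _ _ fun Q hQ => ?_
  obtain ⟨-, h, h1, -, h3⟩ := D.order_one Q hQ
  refine ⟨h.transHomeomorph (Homeomorph.addLeft (ψ Q)), by simpa using h1, fun y hy => ?_⟩
  have := h3 y (by simpa using hy)
  simpa using this

theorem exists_chart (D : ScatteringData P ψ κ α β u) {Q : S} (hQ : ψ Q ∉ P) :
    ∃ e : OpenPartialHomeomorph S ℂ, Q ∈ e.source ∧ ψ = e :=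
  D.isLocalHomeomorphOn Q hQ

theorem finite_fiber (D : ScatteringData P ψ κ α β u) {c : ℂ} (hc : c ∉ P) : (ψ ⁻¹' {c}).Finite :=
  (D.proper.isCompact_preimage isCompact_singleton).finite
    (.of_openPartialHomeomorph ψ subset_rfl fun Q hQ => by
      obtain ⟨e, he, h⟩ := D.exists_chart (Q := Q) (by rw [show ψ Q = c from hQ]; exact hc)
      exact ⟨e, he, h.symm⟩)

theorem isCoveringMapOn (D : ScatteringData P ψ κ α β u) [T2Space S] : IsCoveringMapOn ψ Pᶜ :=
  D.proper.isClosedMap.isCoveringMapOn_of_isLocalHomeomorphOn (fun _ hc => D.finite_fiber hc)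
    D.isLocalHomeomorphOn

theorem exists_lift (D : ScatteringData P ψ κ α β u) [T2Space S] (hΩ : IsOpen Ω) (hcΩ : Convex ℝ Ω) (hx : ContinuousOn x Ω)
    (hP : ∀ τ ∈ Ω, x τ ∉ P) {τ₀ : ℂ} (h0 : τ₀ ∈ Ω) {a : S} (ha : ψ a = x τ₀) :
    ∃ G : ℂ → S, ContinuousOn G Ω ∧ (∀ τ ∈ Ω, ψ (G τ) = x τ) ∧ G τ₀ = a := by
  classical
  have : ContractibleSpace Ω := hcΩ.contractibleSpace ⟨_, h0⟩
  have : LocallyPathConnectedSpace Ω := hΩ.locallyPathConnectedSpace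
  obtain ⟨F, ⟨hF0, hF⟩, -⟩ := D.isCoveringMapOn.existsUnique_continuousMap_lifts
    (⟨fun τ : Ω => x τ, continuousOn_iff_continuous_domRestrict.1 hx⟩ : C(Ω, ℂ)) (a₀ := ⟨τ₀, h0⟩)
    (e₀ := a) ha (fun τ => hP τ τ.2)
  refine ⟨fun τ => if h : τ ∈ Ω then F ⟨τ, h⟩ else a, ?_, fun τ hτ => ?_, ?_⟩
  · rw [continuousOn_iff_continuous_domRestrict]
    convert F.continuous using 1
    ext τ
    simp
  · simp only [dif_pos hτ]
    exact congrFun hF ⟨τ, hτ⟩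
  · simp only [dif_pos h0, hF0]

theorem eqOn_lift (D : ScatteringData P ψ κ α β u) [T2Space S] {X : Type*} [TopologicalSpace X] {s : Set X} {g g' : X → S}
    (hs : IsPreconnected s) (hg : ContinuousOn g s) (hg' : ContinuousOn g' s)
    (hP : ∀ τ ∈ s, ψ (g τ) ∉ P) (hgg : ∀ τ ∈ s, ψ (g τ) = ψ (g' τ)) {τ₀ : X} (h0 : τ₀ ∈ s)
    (h : g τ₀ = g' τ₀) : EqOn g g' s := by
  intro τ hτ
  refine (hs.induction₂ (fun a b => (g a = g' a ↔ g b = g' b)) (fun a ha => ?_)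
    (fun a b c _ _ _ h1 h2 => h1.trans h2) (fun a b _ _ h => h.symm) h0 hτ).1 h
  by_cases hab : g a = g' a
  · obtain ⟨e, he, hψ⟩ := D.exists_chart (hP a ha)
    have h1 := hg a ha (e.open_source.mem_nhds he)
    have h2 := hg' a ha (e.open_source.mem_nhds (hab ▸ he))
    filter_upwards [h1, h2, self_mem_nhdsWithin] with b hb1 hb2 hb
    refine iff_of_true hab (e.injOn hb1 hb2 ?_)
    rw [← hψ]; exact hgg b hb
  · obtain ⟨U, V, hU, hV, hUa, hVa, hUV⟩ := t2_separation hab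
    filter_upwards [hg a ha (hU.mem_nhds hUa), hg' a ha (hV.mem_nhds hVa)] with b hb1 hb2
    refine iff_of_false hab fun h => ?_
    exact disjoint_left.1 hUV hb1 (h ▸ hb2)

theorem exists_id_lift (D : ScatteringData P ψ κ α β u) [T2Space S] {U : Set ℂ} (hU : IsOpen U) (hcU : Convex ℝ U)
    (hP : Disjoint U P) {a : S} (ha : ψ a ∈ U) :
    ∃ g, Lift P ψ (fun z => z) (fun _ => 1) U g ∧ g (ψ a) = a := by
  have hP' : ∀ z ∈ U, z ∉ P := fun z hz => disjoint_left.1 hP hz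
  obtain ⟨g, h1, h2, h3⟩ := D.exists_lift hU hcU continuousOn_id hP' ha (a := a) rfl
  exact ⟨g, ⟨Dev.id hU hcU, fun _ _ => one_ne_zero, h1, h2, hP'⟩, h3⟩

theorem sol_lift (D : ScatteringData P ψ κ α β u) (hG : Lift P ψ x dx Ω G) : Sol κ dx Ω fun τ => u (G τ) := by
  intro τ hτ
  have hψ : ψ (G τ) ∉ P := by rw [hG.proj τ hτ]; exact hG.avoid τ hτ
  obtain ⟨e, he, hψe⟩ := D.exists_chart hψ
  have hG' := hG.cont.continuousAt (hG.dev.isOpen.mem_nhds hτ)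
  have hx := hG.dev.continuousOn.continuousAt (hG.dev.isOpen.mem_nhds hτ)
  have hU : IsOpen (e.target ∩ Pᶜ) := e.open_target.inter D.isOpen_compl
  have hxU : x τ ∈ e.target ∩ Pᶜ := by
    refine ⟨?_, hG.avoid τ hτ⟩
    rw [← hG.proj τ hτ, hψe]
    exact e.map_source he
  have h1 := D.sol (e.target ∩ Pᶜ) e.symm hU (disjoint_left.2 fun z hz => hz.2)
    (e.continuousOn_symm.mono inter_subset_left) fun z hz => by rw [hψe]; exact e.right_inv hz.1
  obtain ⟨r, hr, hball⟩ := Metric.eventually_nhds_iff_ball.1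
    (((hG.dev.isOpen.eventually_mem hτ).and (hx.eventually (hU.eventually_mem hxU))).and
      (hG'.eventually (e.open_source.eventually_mem he)))
  have h2 := h1.comp (Ω := Metric.ball τ r) (y := x) (dy := dx) Metric.isOpen_ball
    (fun t ht => hG.dev.hasDerivAt t (hball t ht).1.1)
    (fun t ht => hG.dev.differentiableAt t (hball t ht).1.1) fun t ht => (hball t ht).1.2
  have h3 := h2.congr (g := fun τ => u (G τ)) Metric.isOpen_ball fun t ht => by
    simp only [Function.comp]
    rw [← hG.proj t (hball t ht).1.1, hψe, e.left_inv (hball t ht).2]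
  exact h3 τ (Metric.mem_ball_self hr)

/-- If h is a chart with ψ = ψ Q + h^m, then τ ↦ h⁻¹(e^{τ/m}) unwinds the punctured neighbourhood of
Q onto a half-plane. A shift by 2πin multiplies h by e^{2πin/m}, which is trivial exactly when m
divides n. Continuity of u at Q supplies the bound. -/
theorem exists_near (D : ScatteringData P ψ κ α β u) (Q : S) {m : ℕ} (hm : HasBranchingOrder ψ Q m) : ∃ (L : ℝ) (G : ℂ → S),
    Lift P ψ (fun τ => ψ Q + exp τ) exp {τ | τ.re < L} G ∧
    (∀ τ : ℂ, τ.re < L → ∀ n : ℤ, G (τ + 2 * Real.pi * I * n) = G τ ↔ (m : ℤ) ∣ n) ∧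
    (∃ K, ∀ τ : ℂ, τ.re < L → ‖u (G τ)‖ ≤ K) ∧
    ∀ᶠ y in 𝓝 Q, ψ y ≠ ψ Q → ∃ τ : ℂ, τ.re < L ∧ G τ = y := by
  obtain ⟨hm0, h, h1, h2, h3⟩ := hm
  have hm' : (m : ℂ) ≠ 0 := by exact_mod_cast hm0.ne'
  have h0t : (0 : ℂ) ∈ h.target := h2 ▸ h.map_source h1
  have hs0 : h.symm 0 = Q := by rw [← h2, h.left_inv h1]
  have hcs : ContinuousAt h.symm 0 := h.continuousAt_symm h0t
  have hu : ∀ᶠ z in 𝓝 (0 : ℂ), ‖u (h.symm z)‖ < ‖u Q‖ + 1 := by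
    have : ContinuousAt (fun z => ‖u (h.symm z)‖) 0 :=
      continuous_norm.continuousAt.comp (D.cont.continuousAt.comp hcs)
    refine this.eventually (gt_mem_nhds ?_)
    simp only [hs0]; linarith
  obtain ⟨ρ, hρ, hball⟩ := Metric.eventually_nhds_iff_ball.1
    ((h.open_target.eventually_mem h0t).and hu)
  obtain ⟨r, hr, hrP⟩ := Metric.isOpen_iff.1
    (D.finite.subset (sdiff_subset (t := {ψ Q}))).isClosed.isOpen_compl (ψ Q)
    (by simp)
  set L := Real.log (min (ρ ^ m) r) with hL
  have hmin : 0 < min (ρ ^ m) r := lt_min (by positivity) hr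
  have hexpL : Real.exp L = min (ρ ^ m) r := Real.exp_log hmin
  have hlt : ∀ τ : ℂ, τ.re < L → exp (τ / m) ∈ Metric.ball (0 : ℂ) ρ := fun τ hτ => by
    rw [mem_ball_zero_iff]
    refine lt_of_pow_lt_pow_left₀ m hρ.le ?_
    rw [← norm_pow, ← exp_nat_mul, mul_div_cancel₀ _ hm', norm_exp]
    exact (Real.exp_lt_exp.2 hτ).trans_le (hexpL.trans_le (min_le_left _ _))
  have hmem : ∀ τ : ℂ, τ.re < L → h.symm (exp (τ / m)) ∈ h.source := fun τ hτ =>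
    h.map_target (hball _ (hlt τ hτ)).1
  refine ⟨L, fun τ => h.symm (exp (τ / m)), ⟨dev_add_exp _ _, fun τ _ => exp_ne_zero τ, ?_,
    fun τ hτ => ?_, fun τ hτ => ?_⟩, fun τ hτ n => ?_, ⟨‖u Q‖ + 1, fun τ hτ => ?_⟩, ?_⟩
  · exact h.continuousOn_symm.comp (Continuous.continuousOn (by fun_prop))
      fun τ hτ => (hball _ (hlt τ hτ)).1
  · rw [h3 _ (hmem τ hτ), h.right_inv (hball _ (hlt τ hτ)).1, ← exp_nat_mul, mul_div_cancel₀ _ hm']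
  · intro hP
    refine hrP (a := ψ Q + exp τ) ?_ ⟨hP, by simp [exp_ne_zero]⟩
    rw [mem_ball_iff_norm, add_sub_cancel_left, norm_exp]
    exact (Real.exp_lt_exp.2 hτ).trans_le (hexpL.trans_le (min_le_right _ _))
  · have hτ' : (τ + 2 * Real.pi * I * n).re < L := by simpa using hτ
    have hpi : (2 * Real.pi * I : ℂ) ≠ 0 := two_pi_I_ne_zero
    have e1 : h.symm (exp ((τ + 2 * Real.pi * I * n) / m)) = h.symm (exp (τ / m)) ↔
        exp ((τ + 2 * Real.pi * I * n) / m) = exp (τ / m) :=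
      h.symm.injOn.eq_iff (hball _ (hlt _ hτ')).1 (hball _ (hlt _ hτ)).1
    rw [e1, exp_eq_exp_iff_exists_int]
    refine exists_congr fun k => ?_
    constructor
    · intro hk
      have h4 : (2 * Real.pi * I : ℂ) * n = (2 * Real.pi * I) * (m * k) := by
        field_simp at hk
        linear_combination hk
      exact_mod_cast mul_left_cancel₀ hpi h4
    · rintro rfl
      push_cast
      field_simp
  · exact (hball _ (hlt τ hτ)).2.le
  · have hψc : ContinuousAt ψ Q := D.proper.continuous.continuousAt
    filter_upwards [h.open_source.mem_nhds h1, hψc (Metric.ball_mem_nhds _ hmin)] with y hy hyb hne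
    have hyy := h3 y hy
    have hy0 : h y ≠ 0 := fun h0 => hne (by rw [hyy, h0, zero_pow hm0.ne', add_zero])
    refine ⟨m * log (h y), ?_, ?_⟩
    · rw [← Real.exp_lt_exp, hexpL, ← norm_exp, exp_nat_mul, exp_log hy0]
      have : ψ y ∈ Metric.ball (ψ Q) (min (ρ ^ m) r) := hyb
      rwa [hyy, mem_ball_iff_norm, add_sub_cancel_left] at this
    · rw [mul_div_cancel_left₀ _ hm', exp_log hy0, h.left_inv hy]

end ScatteringData

/-! ## Comparison of lifts -/

namespace ScatteringData

variable {S : Type*} [TopologicalSpace S] {P : Set ℂ} {ψ : S → ℂ} {κ α β : ℂ}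
  {u : S → ℂ} {x dx : ℂ → ℂ} {Ω U : Set ℂ} {G G' g g' : ℂ → S}

theorem eventually_lift_eq [T2Space S] (D : ScatteringData P ψ κ α β u) (hG : Lift P ψ x dx Ω G)
    (hg : Lift P ψ (fun z => z) (fun _ => 1) U g) {τ₀ : ℂ} (h0 : τ₀ ∈ Ω) (hU : x τ₀ ∈ U)
    (h : g (x τ₀) = G τ₀) : ∀ᶠ τ in 𝓝 τ₀, x τ ∈ U ∧ g (x τ) = G τ := by
  have hx := hG.dev.continuousOn.continuousAt (hG.dev.isOpen.mem_nhds h0)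
  obtain ⟨r, hr, hball⟩ := Metric.eventually_nhds_iff_ball.1
    ((hG.dev.isOpen.eventually_mem h0).and (hx.eventually (hg.dev.isOpen.eventually_mem hU)))
  have := D.eqOn_lift (s := Metric.ball τ₀ r) (g := fun τ => g (x τ)) (g' := G)
    (convex_ball _ _).isPreconnected
    (hg.cont.comp (hG.dev.continuousOn.mono fun τ hτ => (hball τ hτ).1) fun τ hτ => (hball τ hτ).2)
    (hG.cont.mono fun τ hτ => (hball τ hτ).1)
    (fun τ hτ => by rw [hg.proj _ (hball τ hτ).2]; exact hg.avoid _ (hball τ hτ).2)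
    (fun τ hτ => by rw [hg.proj _ (hball τ hτ).2, hG.proj _ (hball τ hτ).1])
    (Metric.mem_ball_self hr) h
  filter_upwards [Metric.ball_mem_nhds τ₀ hr] with τ hτ
  exact ⟨(hball τ hτ).2, this hτ⟩

theorem eventually_section (D : ScatteringData P ψ κ α β u)
    (hg : Lift P ψ (fun z => z) (fun _ => 1) U g) {a : S} (ha : ψ a ∈ U) (h : g (ψ a) = a) :
    ∀ᶠ y in 𝓝 a, ψ y ∈ U ∧ g (ψ y) = y := by
  obtain ⟨e, he, hψ⟩ := D.exists_chart (Q := a) (hg.avoid _ ha)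
  have hψc : ContinuousAt ψ a := D.proper.continuous.continuousAt
  have hgc : ContinuousAt (fun y => g (ψ y)) a :=
    ContinuousAt.comp (hg.cont.continuousAt (hg.dev.isOpen.mem_nhds ha)) hψc
  filter_upwards [hψc.eventually (hg.dev.isOpen.eventually_mem ha),
    hgc.eventually (e.open_source.eventually_mem (show g (ψ a) ∈ e.source by rw [h]; exact he)),
    e.open_source.eventually_mem he] with y h1 h2 h3
  refine ⟨h1, e.injOn h2 h3 ?_⟩
  rw [← hψ]; exact hg.proj _ h1

theorem sol_diff (D : ScatteringData P ψ κ α β u) (hG : Lift P ψ x dx Ω G)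
    (hG' : Lift P ψ x dx Ω G') : Sol κ dx Ω fun τ => u (G' τ) - u (G τ) :=
  (D.sol_lift hG').sub hG.dev.isOpen (D.sol_lift hG)

theorem eqOn_wave (D : ScatteringData P ψ κ α β u) (hG : Lift P ψ x dx Ω G)
    (hG' : Lift P ψ x dx Ω G') {c τ : ℂ} (hτ : τ ∈ Ω)
    (h : ∀ᶠ t in 𝓝 τ, u (G' t) - u (G t) = c * wave α β (x t)) {t : ℂ} (ht : t ∈ Ω) :
    u (G' t) - u (G t) = c * wave α β (x t) := by
  refine sub_eq_zero.1 (Sol.eqOn_zero hG.dev ((D.sol_diff hG hG').sub hG.dev.isOpen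
    ((sol_wave_comp D.mul_eq hG.dev).const_mul hG.dev.isOpen c)) hτ ?_ ht)
  filter_upwards [h] with s hs
  rw [hs, sub_self]

theorem exists_lift_through [T2Space S] (D : ScatteringData P ψ κ α β u)
    (hG : Lift P ψ x dx Ω G) {τ₀ : ℂ} (h0 : τ₀ ∈ Ω) {a' : S} (ha' : ψ a' = x τ₀) :
    ∃ G', Lift P ψ x dx Ω G' ∧ G' τ₀ = a' := by
  obtain ⟨G', h1, h2, h3⟩ := D.exists_lift hG.dev.isOpen hG.dev.convex hG.dev.continuousOn hG.avoid
    h0 ha'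
  exact ⟨G', ⟨hG.dev, hG.ne, h1, h2, hG.avoid⟩, h3⟩

theorem eqOn_lift' [T2Space S] (D : ScatteringData P ψ κ α β u)
    (hG : Lift P ψ x dx Ω G) (hG' : Lift P ψ x dx Ω G') {τ₀ : ℂ} (h0 : τ₀ ∈ Ω)
    (h : G τ₀ = G' τ₀) : EqOn G G' Ω :=
  D.eqOn_lift hG.dev.convex.isPreconnected hG.cont hG'.cont
    (fun τ hτ => by rw [hG.proj τ hτ]; exact hG.avoid τ hτ)
    (fun τ hτ => by rw [hG.proj τ hτ, hG'.proj τ hτ]) h0 h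

theorem exists_ball (D : ScatteringData P ψ κ α β u) {c : ℂ} (hc : c ∉ P) :
    ∃ r > 0, Disjoint (Metric.ball c r) P := by
  obtain ⟨r, hr, h⟩ := Metric.isOpen_iff.1 D.isOpen_compl c hc
  exact ⟨r, hr, disjoint_left.2 fun z hz => h hz⟩

/-! ## Propagation over the pairs of points of a fibre -/

theorem frequently_notMem (D : ScatteringData P ψ κ α β u) (Q : S) : ∃ᶠ a in 𝓝 Q, ψ a ∉ P := by
  obtain ⟨m, hm0, h, h1, h2, h3⟩ := D.order Q
  have h0t : (0 : ℂ) ∈ h.target := h2 ▸ h.map_source h1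
  have hs0 : h.symm 0 = Q := by rw [← h2, h.left_inv h1]
  have hcs : Tendsto h.symm (𝓝[≠] 0) (𝓝 Q) := by
    have := (h.continuousAt_symm h0t).tendsto
    rw [hs0] at this
    exact this.mono_left nhdsWithin_le_nhds
  refine hcs.frequently (Eventually.frequently ?_)
  have hF : ∀ᶠ w in 𝓝 (ψ Q), w ∈ (P \ {ψ Q})ᶜ :=
    (D.finite.subset sdiff_subset).isClosed.isOpen_compl.eventually_mem (by simp)
  have hc : Tendsto (fun z : ℂ => ψ Q + z ^ m) (𝓝[≠] 0) (𝓝 (ψ Q)) := by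
    have : ContinuousAt (fun z : ℂ => ψ Q + z ^ m) 0 := by fun_prop
    have := this.tendsto
    rw [zero_pow hm0.ne', add_zero] at this
    exact this.mono_left nhdsWithin_le_nhds
  filter_upwards [hc.eventually hF, nhdsWithin_le_nhds (h.open_target.mem_nhds h0t),
    self_mem_nhdsWithin] with z hz1 hz2 hz3
  rw [h3 _ (h.map_target hz2), h.right_inv hz2]
  exact fun hP => hz1 ⟨hP, by simpa [hm0.ne'] using hz3⟩

/-- A property of the points of `S` that propagates along lifts is constant. -/
theorem propagate [T2Space S] [ConnectedSpace S] (D : ScatteringData P ψ κ α β u) {Z : S → Prop}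
    (hZ : ∀ (x dx : ℂ → ℂ) (Ω : Set ℂ) (G : ℂ → S), Lift P ψ x dx Ω G → ∀ τ ∈ Ω, ∀ τ' ∈ Ω,
      Z (G τ) → Z (G τ')) {a b : S} (ha : ψ a ∉ P) (hb : ψ b ∉ P) (h : Z a) : Z b := by
  -- All regular points near Q lie on a single lift, even when Q is over P: there the logarithmic
  -- lift covers a whole punctured neighbourhood.
  have hloc : ∀ Q, ∀ᶠ y in 𝓝 Q, ∀ᶠ y' in 𝓝 Q, ψ y ∉ P → ψ y' ∉ P → Z y → Z y' := fun Q => by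
    by_cases hQ : ψ Q ∈ P
    · obtain ⟨m, hm⟩ := D.order Q
      obtain ⟨L, G, hG, -, -, hev⟩ := D.exists_near Q hm
      filter_upwards [hev] with y hy
      filter_upwards [hev] with y' hy' hyP hyP' hZy
      obtain ⟨τ, hτ, rfl⟩ := hy fun h => hyP (h ▸ hQ)
      obtain ⟨τ', hτ', rfl⟩ := hy' fun h => hyP' (h ▸ hQ)
      exact hZ _ _ _ G hG τ hτ τ' hτ' hZy
    · obtain ⟨r, hr, hd⟩ := D.exists_ball hQ
      obtain ⟨g, hg, hgQ⟩ := D.exists_id_lift Metric.isOpen_ball (convex_ball _ _) hd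
        (Metric.mem_ball_self hr)
      have hev := D.eventually_section hg (Metric.mem_ball_self hr) hgQ
      filter_upwards [hev] with y hy
      filter_upwards [hev] with y' hy' _ _ hZy
      rw [← hy'.2]
      rw [← hy.2] at hZy
      exact hZ _ _ _ g hg _ hy.1 _ hy'.1 hZy
  -- This set is open by construction and closed by `hloc`, since regular points accumulate at every
  -- point of S. Connectedness concludes.
  let Y : Set S := {Q | ∀ᶠ y in 𝓝 Q, ψ y ∉ P → Z y}
  have hYo : IsOpen Y := isOpen_iff_mem_nhds.2 fun Q hQ => eventually_eventually_nhds.2 hQ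
  have hYc : IsClosed Y := by
    rw [← isOpen_compl_iff, isOpen_iff_mem_nhds]
    intro Q hQ
    have hQ' : ∃ᶠ y in 𝓝 Q, ¬ (ψ y ∉ P → Z y) := fun h => hQ (by
      filter_upwards [h] with y hy; exact not_not.1 hy)
    have hn : ∀ᶠ y in 𝓝 Q, ψ y ∉ P → ¬ Z y := by
      have h2 := hloc Q
      filter_upwards [h2] with y hy hyP hZy
      obtain ⟨y', h3, h4⟩ := (hQ'.and_eventually hy).exists
      push Not at h3
      exact h3.2 (h4 hyP h3.1 hZy)
    filter_upwards [hn.eventually_nhds] with Q' h1 hQY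
    obtain ⟨y, hy, hy1, hy2⟩ := ((D.frequently_notMem Q').and_eventually (h1.and hQY)).exists
    exact hy1 hy (hy2 hy)
  have haY : a ∈ Y := by
    obtain ⟨r, hr, hd⟩ := D.exists_ball ha
    obtain ⟨g, hg, hga⟩ := D.exists_id_lift Metric.isOpen_ball (convex_ball _ _) hd
      (Metric.mem_ball_self hr)
    filter_upwards [D.eventually_section hg (Metric.mem_ball_self hr) hga] with y hy _
    rw [← hy.2]
    exact hZ _ _ _ g hg _ (Metric.mem_ball_self hr) _ hy.1 (by rwa [hga])
  have hbY : b ∈ Y := by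
    rw [IsClopen.eq_univ ⟨hYc, hYo⟩ ⟨a, haY⟩]; trivial
  exact (show ∀ᶠ y in 𝓝 b, ψ y ∉ P → Z y from hbY).self_of_nhds hb

/-- Monodromy may permute the other points of the fibre, so the property that propagates is the
existence of a partner. It is carried along by the lift through it and remains distinct from the
base point by uniqueness of lifts. -/
theorem exists_pair [T2Space S] [ConnectedSpace S] (D : ScatteringData P ψ κ α β u)
    {R : S → S → Prop}
    (hR : ∀ (x dx : ℂ → ℂ) (Ω : Set ℂ) (G G' : ℂ → S), Lift P ψ x dx Ω G → Lift P ψ x dx Ω G' →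
      ∀ τ ∈ Ω, ∀ τ' ∈ Ω, R (G τ) (G' τ) → R (G τ') (G' τ')) {a a' b : S} (ha : ψ a ∉ P)
    (hb : ψ b ∉ P) (hne : a' ≠ a) (haa : ψ a' = ψ a) (h : R a a') :
    ∃ b', b' ≠ b ∧ ψ b' = ψ b ∧ R b b' := by
  refine D.propagate (Z := fun a => ∃ a', a' ≠ a ∧ ψ a' = ψ a ∧ R a a') ?_ ha hb ⟨a', hne, haa, h⟩
  rintro x dx Ω G hG τ hτ τ' hτ' ⟨a', h1, h2, h3⟩
  obtain ⟨G', hG', rfl⟩ := D.exists_lift_through hG hτ (h2.trans (hG.proj τ hτ))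
  exact ⟨G' τ', fun h => h1 (D.eqOn_lift' hG' hG hτ' h hτ), by rw [hG.proj _ hτ', hG'.proj _ hτ'],
    hR x dx Ω G G' hG hG' τ hτ τ' hτ' h3⟩

end ScatteringData

/-! ## Pairs of points with a continuation of the difference entire in the first variable -/

/-- The difference of the two germs of `u` has a continuation entire in the first variable. -/
def EntPair {S : Type*} [TopologicalSpace S] (P : Set ℂ) (ψ : S → ℂ) (κ : ℂ) (u : S → ℂ)
    (a a' : S) : Prop :=
  ∃ U g g', Lift P ψ (fun z => z) (fun _ => 1) U g ∧ Lift P ψ (fun z => z) (fun _ => 1) U g' ∧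
    ψ a ∈ U ∧ g (ψ a) = a ∧ g' (ψ a) = a' ∧
    Ent κ (fun z => z) (fun _ => 1) U fun z => u (g' z) - u (g z)

/-- The difference of the two germs of `u` is a plane wave. -/
def WavePair {S : Type*} [TopologicalSpace S] (P : Set ℂ) (ψ : S → ℂ) (α β : ℂ) (u : S → ℂ) (c : ℂ)
    (a a' : S) : Prop :=
  ∃ U g g', Lift P ψ (fun z => z) (fun _ => 1) U g ∧ Lift P ψ (fun z => z) (fun _ => 1) U g' ∧
    ψ a ∈ U ∧ g (ψ a) = a ∧ g' (ψ a) = a' ∧ ∀ z ∈ U, u (g' z) - u (g z) = c * wave α β z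

namespace ScatteringData

variable {S : Type*} [TopologicalSpace S] [T2Space S] {P : Set ℂ} {ψ : S → ℂ} {κ α β : ℂ}
  {u : S → ℂ} {x dx : ℂ → ℂ} {Ω U : Set ℂ} {G G' g g' : ℂ → S}

/-- The right side does not involve τ: hence being an `EntPair` is constant along a pair of lifts,
whatever their parametrisation. -/
theorem entPair_iff (D : ScatteringData P ψ κ α β u) (hG : Lift P ψ x dx Ω G)
    (hG' : Lift P ψ x dx Ω G') {τ : ℂ} (hτ : τ ∈ Ω) :
    EntPair P ψ κ u (G τ) (G' τ) ↔ Ent κ x dx Ω fun τ => u (G' τ) - u (G τ) := by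
  constructor
  · rintro ⟨U, g, g', hg, hg', h1, h2, h3, h4⟩
    rw [hG.proj τ hτ] at h1 h2 h3
    refine h4.comp hG.dev (D.sol_diff hg hg') (D.sol_diff hG hG') hτ ?_
    filter_upwards [D.eventually_lift_eq hG hg hτ h1 h2, D.eventually_lift_eq hG' hg' hτ h1 h3]
      with t ht ht'
    exact ⟨ht.1, by rw [ht.2, ht'.2]⟩
  · intro h
    obtain ⟨r, hr, hd⟩ := D.exists_ball (hG.avoid τ hτ)
    have hm := Metric.mem_ball_self (x := x τ) hr
    obtain ⟨g, hg, h2⟩ := D.exists_id_lift (a := G τ) Metric.isOpen_ball (convex_ball _ _) hd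
      (by rwa [hG.proj τ hτ])
    obtain ⟨g', hg', h3⟩ := D.exists_id_lift (a := G' τ) Metric.isOpen_ball (convex_ball _ _) hd
      (by rwa [hG'.proj τ hτ])
    refine ⟨_, g, g', hg, hg', by rwa [hG.proj τ hτ], h2, ?_, ?_⟩
    · rw [hG.proj τ hτ, ← hG'.proj τ hτ, h3]
    · rw [hG.proj τ hτ] at h2
      rw [hG'.proj τ hτ] at h3
      refine h.of_comp hG.dev Metric.isOpen_ball (convex_ball _ _) (D.sol_diff hg hg') hτ
        (hG.ne τ hτ) ?_
      filter_upwards [D.eventually_lift_eq hG hg hτ hm h2, D.eventually_lift_eq hG' hg' hτ hm h3]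
        with t ht ht'
      exact ⟨ht.1, by rw [ht.2, ht'.2]⟩

theorem wavePair_iff (D : ScatteringData P ψ κ α β u) (hG : Lift P ψ x dx Ω G)
    (hG' : Lift P ψ x dx Ω G') {c τ : ℂ} (hτ : τ ∈ Ω) :
    WavePair P ψ α β u c (G τ) (G' τ) ↔ ∀ t ∈ Ω, u (G' t) - u (G t) = c * wave α β (x t) := by
  constructor
  · rintro ⟨U, g, g', hg, hg', h1, h2, h3, h4⟩ t ht
    rw [hG.proj τ hτ] at h1 h2 h3
    refine D.eqOn_wave hG hG' hτ ?_ ht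
    filter_upwards [D.eventually_lift_eq hG hg hτ h1 h2, D.eventually_lift_eq hG' hg' hτ h1 h3]
      with t ht ht'
    rw [← ht.2, ← ht'.2, h4 _ ht.1]
  · intro h
    obtain ⟨r, hr, hd⟩ := D.exists_ball (hG.avoid τ hτ)
    have hm := Metric.mem_ball_self (x := x τ) hr
    obtain ⟨g, hg, h2⟩ := D.exists_id_lift (a := G τ) Metric.isOpen_ball (convex_ball _ _) hd
      (by rwa [hG.proj τ hτ])
    obtain ⟨g', hg', h3⟩ := D.exists_id_lift (a := G' τ) Metric.isOpen_ball (convex_ball _ _) hd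
      (by rwa [hG'.proj τ hτ])
    refine ⟨_, g, g', hg, hg', by rwa [hG.proj τ hτ], h2, ?_, fun z hz => ?_⟩
    · rw [hG.proj τ hτ, ← hG'.proj τ hτ, h3]
    · rw [hG.proj τ hτ] at h2
      rw [hG'.proj τ hτ] at h3
      refine D.eqOn_wave hg hg' hm ?_ hz
      rw [← hG.dev.map_nhds hτ (hG.ne τ hτ), eventually_map]
      filter_upwards [D.eventually_lift_eq hG hg hτ hm h2, D.eventually_lift_eq hG' hg' hτ hm h3,
        hG.dev.isOpen.eventually_mem hτ] with t ht ht' htΩ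
      rw [ht.2, ht'.2, h t htΩ]

end ScatteringData

/-! ## Pairs of points near infinity -/

/-- If the wave e^{tl}E exceeds 2k throughout, the two alternatives are separated and, by
continuity, the same one holds for all t; either way the translation defect is O(k). If the wave is
at most 2k somewhere, it is O(k) on the whole interval, and so is f. -/
theorem norm_sub_exp_mul_le {f : ℝ → ℂ} {l E : ℂ} {k Λ : ℝ} (hf : ContinuousOn f (Icc 0 1))
    (hl : ‖l‖ ≤ Λ)
    (h : ∀ t ∈ Icc (0:ℝ) 1, ‖f t‖ ≤ k ∨ ‖f t - exp (t * l) * E‖ ≤ k) :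
    ‖f 1 - exp l * f 0‖ ≤ k * (1 + Real.exp Λ + 4 * Real.exp (2 * Λ)) := by
  have hk : 0 ≤ k := (h 0 (by simp)).elim (norm_nonneg _).trans (norm_nonneg _).trans
  have hE : ∀ {t : ℝ}, t ∈ Icc (-1:ℝ) 1 → ‖exp (t * l)‖ ≤ Real.exp Λ := fun {t} ht => by
    rw [norm_exp]
    refine Real.exp_le_exp.2 (((abs_re_le_norm _).trans' (le_abs_self _)).trans ?_)
    rw [norm_mul, norm_real, Real.norm_eq_abs]
    calc |t| * ‖l‖ ≤ 1 * Λ := by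
          refine mul_le_mul (abs_le.2 ht) hl (norm_nonneg _) zero_le_one
      _ = Λ := one_mul _
  have hl1 : ‖exp l‖ ≤ Real.exp Λ := by simpa using hE (t := 1) (by simp)
  have hmain : (‖f 0‖ ≤ k ∧ ‖f 1‖ ≤ k ∨ ‖f 0 - E‖ ≤ k ∧ ‖f 1 - exp l * E‖ ≤ k) ∨
      ∃ t ∈ Icc (0:ℝ) 1, ‖exp (t * l) * E‖ ≤ 2 * k := by
    by_cases hsm : ∃ t ∈ Icc (0:ℝ) 1, ‖exp (t * l) * E‖ ≤ 2 * k
    · exact Or.inr hsm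
    · push Not at hsm
      left
      have hpre : IsPreconnected (Icc (0:ℝ) 1) := isPreconnected_Icc
      have hP : ∀ s ∈ Icc (0:ℝ) 1, ∀ t ∈ Icc (0:ℝ) 1, (‖f s‖ ≤ k ↔ ‖f t‖ ≤ k) := by
        intro s hs t ht
        refine hpre.induction₂ (fun a b => (‖f a‖ ≤ k ↔ ‖f b‖ ≤ k)) (fun a ha => ?_)
          (fun a b c _ _ _ h1 h2 => h1.trans h2) (fun a b _ _ h => h.symm) hs ht
        by_cases hfa : ‖f a‖ ≤ k
        · have h1 : k < ‖f a - exp (a * l) * E‖ := by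
            have h2 := norm_sub_norm_le (exp (a * l) * E) (f a)
            rw [norm_sub_rev] at h2
            linarith [hsm a ha]
          have hc : ContinuousWithinAt (fun a : ℝ => ‖f a - exp (a * l) * E‖) (Icc 0 1) a :=
            ((hf a ha).sub (Continuous.continuousWithinAt (by fun_prop))).norm
          filter_upwards [hc.eventually (lt_mem_nhds h1), self_mem_nhdsWithin] with b hb hb'
          exact iff_of_true hfa ((h b hb').resolve_right (not_le.2 hb))
        · filter_upwards [(hf a ha).norm.eventually (lt_mem_nhds (not_le.1 hfa))] with b hb
          exact iff_of_false hfa (not_le.2 hb)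
      have m0 : (0:ℝ) ∈ Icc (0:ℝ) 1 := by simp
      have m1 : (1:ℝ) ∈ Icc (0:ℝ) 1 := by simp
      by_cases hf0 : ‖f 0‖ ≤ k
      · exact Or.inl ⟨hf0, (hP 0 m0 1 m1).1 hf0⟩
      · refine Or.inr ⟨?_, ?_⟩
        · simpa using (h 0 m0).resolve_left hf0
        · simpa using (h 1 m1).resolve_left fun h1 => hf0 ((hP 0 m0 1 m1).2 h1)
  have hsplit : ‖f 1 - exp l * f 0‖ ≤ ‖f 1‖ + Real.exp Λ * ‖f 0‖ := by
    refine (norm_sub_le _ _).trans ?_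
    rw [norm_mul]
    gcongr
  have e2 : Real.exp (2 * Λ) = Real.exp Λ * Real.exp Λ := by rw [two_mul, Real.exp_add]
  have hpos := Real.exp_pos Λ
  rcases hmain with (⟨h0, h1⟩ | ⟨h0, h1⟩) | ⟨t, ht, hEt⟩
  · have := mul_le_mul_of_nonneg_left h0 hpos.le
    rw [e2]
    nlinarith [mul_pos hpos hpos]
  · have h2 : f 1 - exp l * f 0 = (f 1 - exp l * E) - exp l * (f 0 - E) := by ring
    have h3 : ‖f 1 - exp l * f 0‖ ≤ k + Real.exp Λ * k := by
      rw [h2]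
      refine (norm_sub_le _ _).trans (add_le_add h1 ?_)
      rw [norm_mul]
      exact mul_le_mul hl1 h0 (norm_nonneg _) hpos.le
    rw [e2]
    nlinarith [mul_pos hpos hpos]
  · have hE0 : ‖E‖ ≤ 2 * k * Real.exp Λ := by
      have h2 : E = exp ((-t : ℝ) * l) * (exp (t * l) * E) := by
        rw [← mul_assoc, ← exp_add]; push_cast; simp
      rw [h2, norm_mul, mul_comm]
      refine mul_le_mul hEt (hE ?_) (norm_nonneg _) (by positivity)
      exact ⟨by linarith [ht.2], by linarith [ht.1]⟩
    have h0 : ‖f 0‖ ≤ k + ‖E‖ := by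
      rcases h 0 (by simp) with h | h
      · linarith [norm_nonneg E]
      · have := norm_add_le (f 0 - exp ((0:ℝ) * l) * E) (exp ((0:ℝ) * l) * E)
        rw [sub_add_cancel] at this
        simp only [ofReal_zero, zero_mul, exp_zero, one_mul] at this h
        linarith
    have h1 : ‖f 1‖ ≤ k + Real.exp Λ * ‖E‖ := by
      rcases h 1 (by simp) with h | h
      · have : 0 ≤ Real.exp Λ * ‖E‖ := by positivity
        linarith
      · have := norm_add_le (f 1 - exp ((1:ℝ) * l) * E) (exp ((1:ℝ) * l) * E)
        rw [sub_add_cancel] at this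
        simp only [ofReal_one, one_mul] at this h
        rw [norm_mul (exp l)] at this
        have h3 := mul_le_mul_of_nonneg_right hl1 (norm_nonneg E)
        linarith
    rw [e2]
    have h4 := mul_le_mul_of_nonneg_left hE0 hpos.le
    have h5 := mul_le_mul_of_nonneg_left h0 hpos.le
    nlinarith

namespace ScatteringData

variable {S : Type*} [TopologicalSpace S] {P : Set ℂ} {ψ : S → ℂ} {κ α β : ℂ}
  {u : S → ℂ} {L : ℝ} {G G' : ℂ → S}

/-- Pigeonhole in a finite fibre: two of the points reached after k turns coincide, and uniqueness
of lifts yields a period. Its multiples are included in order to find a common period for two lifts.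
-/
theorem exists_period [T2Space S] (D : ScatteringData P ψ κ α β u)
    (hG : Lift P ψ exp exp {τ | L < τ.re} G) : ∃ m : ℕ, 0 < m ∧ ∀ k : ℕ, ∀ τ : ℂ, L < τ.re →
      G (τ + (2 * Real.pi * (m * k : ℕ) : ℝ) * I) = G τ := by
  have hre : ∀ (k : ℕ) {τ : ℂ}, L < τ.re → L < (τ + (2 * Real.pi * k : ℝ) * I).re := fun k τ hτ => by
    simpa using hτ
  set τ₀ : ℂ := ((L + 1 : ℝ) : ℂ) with hτ₀
  have h0 : L < τ₀.re := by simp [hτ₀]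
  obtain ⟨k₁, k₂, hlt, heq⟩ := (D.finite_fiber (hG.avoid τ₀ h0)).exists_lt_map_eq_of_forall_mem
    (f := fun k : ℕ => G (τ₀ + (2 * Real.pi * k : ℝ) * I)) fun k => by
      show ψ _ = _
      rw [hG.proj _ (hre k h0), exp_add_period]
  have h1 : ∀ τ : ℂ, L < τ.re → G (τ + (2 * Real.pi * (k₂ - k₁ : ℕ) : ℝ) * I) = G τ := by
    have hc : ContinuousOn (fun τ => G (τ + (2 * Real.pi * (k₂ - k₁ : ℕ) : ℝ) * I))
        {τ | L < τ.re} :=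
      hG.cont.comp (Continuous.continuousOn (by fun_prop)) fun τ hτ => hre _ hτ
    have := D.eqOn_lift (convex_halfSpace_re_gt L).isPreconnected hc hG.cont
      (fun τ hτ => by rw [hG.proj _ (hre _ hτ)]; exact hG.avoid _ (hre _ hτ))
      (fun τ hτ => by rw [hG.proj _ (hre _ hτ), hG.proj _ hτ, exp_add_period])
      (τ₀ := τ₀ + (2 * Real.pi * k₁ : ℝ) * I) (hre k₁ h0) (by
        rw [heq]
        congr 1
        rw [Nat.cast_sub hlt.le]; push_cast; ring)
    exact fun τ hτ => this hτ
  refine ⟨k₂ - k₁, by omega, fun k => ?_⟩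
  induction k with
  | zero => intro τ _; simp
  | succ k ih =>
    intro τ hτ
    refine Eq.trans ?_ ((ih _ (hre (k₂ - k₁) hτ)).trans (h1 τ hτ))
    congr 1
    push_cast; ring

/-- The field is followed along the segment from e^τ to e^τ + h. At each of its points `far` offers
the alternative of `norm_sub_exp_mul_le`, so no knowledge of the cuts is needed. -/
theorem exists_shift_bound (D : ScatteringData P ψ κ α β u) (hL : 0 ≤ L) : ∃ δ > 0, ∃ K : ℝ,
    ∀ G : ℂ → S, Lift P ψ exp exp {τ | L < τ.re} G → ∀ h τ : ℂ, ‖h‖ ≤ 1 → L + 1 < τ.re →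
      ‖u (G (shift h τ)) - exp (α * h + β * (starRingEnd ℂ) h) * u (G τ)‖ ≤
        K * Real.exp (-δ * Real.exp τ.re) := by
  obtain ⟨δ, hδ, K, hK⟩ := D.far
  set Λ := ‖α‖ + ‖β‖ with hΛ
  refine ⟨δ, hδ, K * Real.exp δ * (1 + Real.exp Λ + 4 * Real.exp (2 * Λ)), fun G hG h τ hh hτ => ?_⟩
  have hτ1 : 1 ≤ τ.re := by linarith
  have hth : ∀ {t : ℝ}, t ∈ Icc (0:ℝ) 1 → ‖t * h‖ ≤ 1 := fun {t} ht => by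
    rw [norm_mul, norm_real, Real.norm_of_nonneg ht.1]
    exact mul_le_one₀ ht.2 (norm_nonneg _) hh
  have hre : ∀ {t : ℝ}, t ∈ Icc (0:ℝ) 1 → L < (shift (t * h) τ).re := fun ht => by
    linarith [sub_one_lt_re_shift (hth ht) hτ1]
  have hK0 : 0 ≤ K := by
    obtain ⟨ε, -, h1⟩ := hK (G τ)
    exact nonneg_of_mul_nonneg_left ((norm_nonneg _).trans h1) (Real.exp_pos _)
  have hcs : ContinuousOn (fun t : ℝ => shift (t * h) τ) (Icc 0 1) := fun t ht => by
    refine ContinuousAt.continuousWithinAt (continuousAt_const.add (ContinuousAt.clog ?_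
      (shift_arg_mem_slitPlane (hth ht) hτ1)))
    fun_prop
  have hcf : ContinuousOn (fun t : ℝ => u (G (shift (t * h) τ))) (Icc 0 1) :=
    D.cont.comp_continuousOn (hG.cont.comp hcs fun t ht => hre ht)
  have hl : ‖α * h + β * (starRingEnd ℂ) h‖ ≤ Λ := by
    refine (norm_add_le _ _).trans ?_
    rw [norm_mul, norm_mul, RCLike.norm_conj]
    nlinarith [norm_nonneg α, norm_nonneg β]
  have key := norm_sub_exp_mul_le (E := wave α β (exp τ)) (k := K * Real.exp δ *
    Real.exp (-δ * Real.exp τ.re)) hcf hl fun t ht => by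
      obtain ⟨ε, hε, h1⟩ := hK (G (shift (t * h) τ))
      rw [hG.proj _ (hre ht), exp_shift (hth ht) hτ1] at h1
      -- The segment comes nearer to the origin by at most 1, which costs the factor e^δ.
      have h2 : K * Real.exp (-δ * ‖exp τ + t * h‖) ≤
          K * Real.exp δ * Real.exp (-δ * Real.exp τ.re) := by
        rw [mul_assoc, ← Real.exp_add]
        refine mul_le_mul_of_nonneg_left (Real.exp_le_exp.2 ?_) hK0
        have h3 := norm_sub_norm_le (exp τ) (-(t * h))
        rw [sub_neg_eq_add, norm_neg, norm_exp] at h3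
        nlinarith [hth ht]
      have h3 := h1.trans h2
      rcases hε with rfl | rfl
      · left; simpa using h3
      · right
        rw [one_mul, wave_add] at h3
        have e : α * (t * h) + β * (starRingEnd ℂ) (t * h) =
            t * (α * h + β * (starRingEnd ℂ) h) := by
          rw [map_mul, conj_ofReal]; ring
        rwa [e] at h3
  simp only [ofReal_one, one_mul, ofReal_zero, zero_mul] at key
  have hs0 : shift 0 τ = τ := by simp [shift]
  rw [hs0] at key
  refine key.trans_eq ?_
  ring

/-- Near infinity, an entire difference of two germs of `u` is a plane wave. -/
theorem exists_wavePair [T2Space S] (D : ScatteringData P ψ κ α β u) :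
    ∃ R : ℝ, ∀ a a' : S, R < ‖ψ a‖ → ψ a' = ψ a → EntPair P ψ κ u a a' →
      ∃ c, WavePair P ψ α β u c a a' := by
  obtain ⟨R₀, hR₀⟩ := D.finite.isBounded.exists_norm_le
  set L : ℝ := max R₀ 0 with hL
  have hL0 : 0 ≤ L := le_max_right _ _
  refine ⟨Real.exp L, fun a a' ha haa hent => ?_⟩
  have ha0 : ψ a ≠ 0 := fun h => by
    rw [h, norm_zero] at ha; exact absurd ha (Real.exp_pos _).le.not_gt
  have hτ : L < (log (ψ a)).re := by
    rw [log_re, Real.lt_log_iff_exp_lt (norm_pos_iff.2 ha0)]; exact ha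
  have hP : ∀ τ : ℂ, L < τ.re → exp τ ∉ P := fun τ hτ hP => by
    have h1 := hR₀ _ hP
    rw [norm_exp] at h1
    linarith [le_max_left R₀ 0, Real.add_one_le_exp τ.re]
  have hlift : ∀ b, ψ b = ψ a → ∃ G, Lift P ψ exp exp {τ | L < τ.re} G ∧ G (log (ψ a)) = b :=
    fun b hb => by
    obtain ⟨G, h1, h2, h3⟩ := D.exists_lift (isOpen_re_gt L) (convex_halfSpace_re_gt L)
      (continuous_exp.continuousOn) hP hτ (a := b) (by rw [exp_log ha0, hb])
    exact ⟨G, ⟨dev_exp L, fun τ _ => exp_ne_zero τ, h1, h2, hP⟩, h3⟩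
  obtain ⟨G, hG, hGa⟩ := hlift a rfl
  obtain ⟨G', hG', hGa'⟩ := hlift a' haa
  obtain ⟨m, hm, hper⟩ := D.exists_period hG
  obtain ⟨m', hm', hper'⟩ := D.exists_period hG'
  obtain ⟨δ, hδ, K, hsh⟩ := D.exists_shift_bound hL0
  have he : Ent κ exp exp {τ | L < τ.re} fun τ => u (G' τ) - u (G τ) := by
    rw [← hGa, ← hGa'] at hent
    exact (D.entPair_iff hG hG' hτ).1 hent
  -- The product m m' is a common number of turns for the two lifts; the constant doubles because
  -- the defects of both are added.
  obtain ⟨c, hc⟩ := eq_wave_of_shift (α := α) (β := β) (m := m * m') (L' := L + 1) (K := 2 * K)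
    (Nat.mul_pos hm hm') D.im_pos (D.sol_diff hG hG') he
    (fun τ hτ => by
      rw [hper m' τ hτ]
      have := hper' m τ hτ
      rw [mul_comm m' m] at this
      rw [this]) (by linarith) le_rfl hδ
    (fun h τ hh hτ => by
      have h1 := hsh G hG h τ hh hτ
      have h2 := hsh G' hG' h τ hh hτ
      have h3 := norm_sub_le (u (G' (shift h τ)) - exp (α * h + β * (starRingEnd ℂ) h) * u (G' τ))
        (u (G (shift h τ)) - exp (α * h + β * (starRingEnd ℂ) h) * u (G τ))
      have e : u (G' (shift h τ)) - u (G (shift h τ)) -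
          exp (α * h + β * (starRingEnd ℂ) h) * (u (G' τ) - u (G τ)) =
          u (G' (shift h τ)) - exp (α * h + β * (starRingEnd ℂ) h) * u (G' τ) -
          (u (G (shift h τ)) - exp (α * h + β * (starRingEnd ℂ) h) * u (G τ)) := by ring
      rw [e]
      linarith) (τ₁ := (L + 2 : ℝ)) (by rw [ofReal_re]; linarith)
  refine ⟨c, ?_⟩
  rw [← hGa, ← hGa', D.wavePair_iff hG hG' hτ]
  exact fun t ht => D.eqOn_wave hG hG' (τ := (L + 2 : ℝ)) (by simp) hc ht

end ScatteringData

/-! ### Distinct samples have distinct continuations -/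

namespace ScatteringData

variable {S : Type*} [TopologicalSpace S] {P : Set ℂ} {ψ : S → ℂ} {κ α β : ℂ}
  {u : S → ℂ} {L : ℝ} {c : ℂ} {G : ℂ → S}

theorem lift_add_period (hG : Lift P ψ (fun τ => c + exp τ) exp {τ | τ.re < L} G) (n : ℤ) :
    Lift P ψ (fun τ => c + exp τ) exp {τ | τ.re < L} fun τ => G (τ + 2 * Real.pi * I * n) := by
  have hre : ∀ {τ : ℂ}, τ.re < L → (τ + 2 * Real.pi * I * n).re < L := fun h => by simpa using h
  refine ⟨hG.dev, hG.ne, hG.cont.comp (Continuous.continuousOn (by fun_prop)) fun τ h => hre h,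
    fun τ hτ => ?_, hG.avoid⟩
  rw [hG.proj _ (hre hτ), exp_add, mul_comm (2 * Real.pi * I : ℂ) n, exp_int_mul_two_pi_mul_I,
    mul_one]

/-- The continuation of `u` cannot return to itself when the sample of the plane domain does not. -/
theorem not_ent [T2Space S] [ConnectedSpace S] (D : ScatteringData P ψ κ α β u)
    (hG : Lift P ψ (fun τ => c + exp τ) exp {τ | τ.re < L} G) {m : ℕ} (hm : 0 < m)
    (hper : ∀ τ : ℂ, τ.re < L → ∀ n : ℤ, G (τ + 2 * Real.pi * I * n) = G τ ↔ (m : ℤ) ∣ n) {n : ℤ}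
    (hn : ¬ (m : ℤ) ∣ n) :
    ¬ Ent κ (fun τ => c + exp τ) exp {τ | τ.re < L}
      fun τ => u (G (τ + 2 * Real.pi * I * n)) - u (G τ) := by
  intro hent
  have hG' := lift_add_period hG n
  set τ₀ : ℂ := ((L - 1 : ℝ) : ℂ) with hτ₀
  have h0 : τ₀.re < L := by simp [hτ₀]
  have hψ : ψ (G τ₀) ∉ P := by rw [hG.proj _ h0]; exact hG.avoid _ h0
  have hψ' : ψ (G (τ₀ + 2 * Real.pi * I * n)) = ψ (G τ₀) := by rw [hG'.proj _ h0, hG.proj _ h0]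
  have hne : G (τ₀ + 2 * Real.pi * I * n) ≠ G τ₀ := fun h => hn ((hper _ h0 n).1 h)
  have h1 := (D.entPair_iff hG hG' h0).2 hent
  obtain ⟨R, hR⟩ := D.exists_wavePair
  obtain ⟨b, hb, hbP, hbu⟩ := D.sep R
  -- Otherwise a pair that is entire but not a plane wave could be transported to a fibre near
  -- infinity, where no such pair exists.
  have h2 : ∃ e, WavePair P ψ α β u e (G τ₀) (G (τ₀ + 2 * Real.pi * I * n)) := by
    by_contra hno
    obtain ⟨b', -, h3, h4, h5⟩ := D.exists_pair
      (R := fun a a' => EntPair P ψ κ u a a' ∧ ¬ ∃ e, WavePair P ψ α β u e a a')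
      (fun x dx Ω G G' hG hG' τ hτ τ' hτ' h =>
        ⟨(D.entPair_iff hG hG' hτ').2 ((D.entPair_iff hG hG' hτ).1 h.1), fun ⟨e, he⟩ =>
          h.2 ⟨e, (D.wavePair_iff hG hG' hτ).2 ((D.wavePair_iff hG hG' hτ').1 he)⟩⟩)
      hψ hbP hne hψ' ⟨h1, hno⟩
    exact h5 (hR b b' hb h3 h4)
  obtain ⟨e, he⟩ := h2
  have he' := he
  rw [D.wavePair_iff hG hG' h0] at he
  -- The plane wave is single-valued, so each further n turns add the same amount. For k = m the
  -- loop closes on S, and the total m e must vanish.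
  have hsum : ∀ k : ℕ, u (G (τ₀ + 2 * Real.pi * I * (n * k : ℤ))) - u (G τ₀) =
      k * (e * wave α β (c + exp τ₀)) := fun k => by
    induction k with
    | zero => simp
    | succ k ih =>
      have h3 := he (τ₀ + 2 * Real.pi * I * (n * k : ℤ)) (by simpa using h0)
      have h4 : exp (τ₀ + 2 * Real.pi * I * (n * k : ℤ)) = exp τ₀ := by
        rw [exp_add, mul_comm (2 * Real.pi * I : ℂ), exp_int_mul_two_pi_mul_I, mul_one]
      have h5 : τ₀ + 2 * Real.pi * I * (n * (k + 1 : ℕ) : ℤ) =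
          τ₀ + 2 * Real.pi * I * (n * k : ℤ) + 2 * Real.pi * I * n := by push_cast; ring
      rw [h4] at h3
      rw [h5]
      push_cast at h3 ih ⊢
      linear_combination h3 + ih
  have hz := hsum m
  rw [(hper τ₀ h0 (n * m)).2 (dvd_mul_left _ _), sub_self] at hz
  have he0 : e = 0 := by
    have hm' : (m : ℂ) ≠ 0 := by exact_mod_cast hm.ne'
    have := wave_ne_zero α β (c + exp τ₀)
    simpa [hm', this] using hz.symm
  subst he0
  -- Transport of the zero difference to the distant fibre contradicts the choice of b.
  obtain ⟨b', hb1, hb2, U, g, g', hg, hg', h3, h4, h5, h6⟩ := D.exists_pair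
    (R := WavePair P ψ α β u 0) (fun x dx Ω G G' hG hG' τ hτ τ' hτ' h => by
      exact (D.wavePair_iff hG hG' hτ').2 ((D.wavePair_iff hG hG' hτ).1 h)) hψ hbP hne hψ' he'
  refine hbu b' hb1 hb2 ?_
  have := h6 _ h3
  rw [h4, h5, zero_mul] at this
  exact sub_eq_zero.1 this

/-- The charts at the points of a fibre, with a common radius. -/
theorem exists_near_uniform (D : ScatteringData P ψ κ α β u) (c : ℂ) : ∃ ρ > 0, ∀ y : S,
    ψ y ≠ c → ‖ψ y - c‖ < ρ → ∃ (Q : S) (m : ℕ) (L : ℝ) (G : ℂ → S), ψ Q = c ∧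
      HasBranchingOrder ψ Q m ∧ ρ ≤ Real.exp L ∧
      Lift P ψ (fun τ => c + exp τ) exp {τ | τ.re < L} G ∧
      (∀ τ : ℂ, τ.re < L → ∀ n : ℤ, G (τ + 2 * Real.pi * I * n) = G τ ↔ (m : ℤ) ∣ n) ∧
      (∃ K, ∀ τ : ℂ, τ.re < L → ‖u (G τ)‖ ≤ K) ∧ ∃ τ : ℂ, τ.re < L ∧ G τ = y := by
  choose m hm using D.order
  choose L G h1 h2 h3 h4 using fun Q => D.exists_near Q (hm Q)
  have hcomp := D.proper.isCompact_preimage (K := {c}) isCompact_singleton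
  obtain ⟨t, ht, hcov⟩ := hcomp.elim_nhds_subcover
    (fun Q => interior {y | ψ y ≠ ψ Q → ∃ τ : ℂ, τ.re < L Q ∧ G Q τ = y})
    fun Q _ => interior_mem_nhds.2 (h4 Q)
  -- Since ψ is closed, the finitely many charts that cover the fibre cover all points over some
  -- disc about c.
  have hev := D.proper.isClosedMap.eventually_nhds_fiber (p := fun y => y ∈ ⋃ Q ∈ t,
    interior {y | ψ y ≠ ψ Q → ∃ τ : ℂ, τ.re < L Q ∧ G Q τ = y}) c fun y hy =>
      (isOpen_biUnion fun Q _ => isOpen_interior).eventually_mem (hcov hy)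
  obtain ⟨r, hr, hball⟩ := Metric.eventually_nhds_iff_ball.1 hev
  obtain ⟨M, hM⟩ := (t.image fun Q => -L Q).exists_le
  refine ⟨min r (Real.exp (-M)), lt_min hr (Real.exp_pos _), fun y hy hyr => ?_⟩
  have h5 := hball (ψ y) (by
    rw [mem_ball_iff_norm]; exact hyr.trans_le (min_le_left _ _)) y rfl
  simp only [mem_iUnion] at h5
  obtain ⟨Q, hQ, hQy⟩ := h5
  have hψ : ψ Q = c := ht Q hQ
  have h6 := interior_subset hQy
  simp only [Set.mem_ofPred_eq, hψ] at h6
  have h1' := h1 Q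
  rw [hψ] at h1'
  exact ⟨Q, m Q, L Q, G Q, hψ, hm Q, (min_le_right _ _).trans (Real.exp_le_exp.2
    (neg_le.1 (hM _ (Finset.mem_image_of_mem _ hQ)))), h1', h2 Q, h3 Q, h6 hy⟩

end ScatteringData

/-! ## Analytic continuation -/

theorem AnalyticAt.eventually_eq_zero_imp {h : ℂ × ℂ → ℂ} {B : ℂ × ℂ} (hh : AnalyticAt ℂ h B) :
    ∀ᶠ B' in 𝓝 B, h =ᶠ[𝓝 B'] 0 → h =ᶠ[𝓝 B] 0 := by
  obtain ⟨r, hr, hball⟩ := Metric.eventually_nhds_iff_ball.1 hh.eventually_analyticAt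
  filter_upwards [Metric.ball_mem_nhds B hr] with B' hB' h0
  have := AnalyticOnNhd.eqOn_zero_of_preconnected_of_eventuallyEq_zero (𝕜 := ℂ) (f := h)
    (U := Metric.ball B r) hball (convex_ball B r).isPreconnected hB' h0
  exact this.eventuallyEq_of_mem (Metric.ball_mem_nhds B hr)

/-- Analytic continuation is unique. -/
theorem ContinuesAlong.unique {σ : C(unitInterval, ℂ × ℂ)} {f g g' : ℂ × ℂ → ℂ}
    (h : ContinuesAlong σ f g) (h' : ContinuesAlong σ f g') : g =ᶠ[𝓝 (σ 1)] g' := by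
  obtain ⟨F, h0, h1, ha, hc⟩ := h
  obtain ⟨F', h0', h1', ha', hc'⟩ := h'
  have key : ∀ s t : unitInterval, (F s =ᶠ[𝓝 (σ s)] F' s ↔ F t =ᶠ[𝓝 (σ t)] F' t) := by
    intro s t
    refine isPreconnected_univ.induction₂
      (fun s t : unitInterval => (F s =ᶠ[𝓝 (σ s)] F' s ↔ F t =ᶠ[𝓝 (σ t)] F' t)) (fun t _ => ?_)
      (fun a b c _ _ _ h1 h2 => h1.trans h2) (fun a b _ _ h => h.symm) (mem_univ s) (mem_univ t)
    rw [nhdsWithin_univ]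
    have hd := ((ha t).sub (ha' t)).eventually_eq_zero_imp
    have hσ : ContinuousAt σ t := σ.continuous.continuousAt
    by_cases hE : F t =ᶠ[𝓝 (σ t)] F' t
    · filter_upwards [hc t, hc' t, hσ.eventually hE.eventually_nhds] with s h1 h2 h3
      exact iff_of_true hE (h1.trans (EventuallyEq.trans h3 h2.symm))
    · filter_upwards [hc t, hc' t, hσ.eventually hd] with s h1 h2 h3
      refine iff_of_false hE fun h4 => hE ?_
      have h5 : F t =ᶠ[𝓝 (σ s)] F' t := h1.symm.trans (h4.trans h2)
      have h6 := h3 (by filter_upwards [h5] with q hq; simp [hq])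
      filter_upwards [h6] with q hq
      exact sub_eq_zero.1 hq
  exact h1.symm.trans (((key 0 1).1 (h0.trans h0'.symm)).trans h1')

/-! ### Explicit continuation around a 2-line -/

section Explicit

variable {κ c : ℂ} {L : ℝ} {f : ℂ → ℂ} {p : ℂ → ℂ × ℂ → ℂ}

/-- The branch near `exp τ` of the logarithm with the value `τ` there. -/
noncomputable def logAt (c τ z : ℂ) : ℂ := τ + log ((z - c) / exp τ)

theorem exp_logAt {τ z : ℂ} (hz : z ≠ c) : c + exp (logAt c τ z) = z := by
  rw [logAt, exp_add, exp_log (div_ne_zero (sub_ne_zero.2 hz) (exp_ne_zero τ)),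
    mul_div_cancel₀ _ (exp_ne_zero τ)]
  ring

theorem logAt_self (c τ : ℂ) : logAt c τ (c + exp τ) = τ := by
  simp [logAt]

theorem logAt_add_period (c τ z : ℂ) (n : ℤ) :
    logAt c (τ + 2 * Real.pi * I * n) z = logAt c τ z + 2 * Real.pi * I * n := by
  have h4 : exp (τ + 2 * Real.pi * I * n) = exp τ := by
    rw [exp_add, mul_comm (2 * Real.pi * I : ℂ), exp_int_mul_two_pi_mul_I, mul_one]
  rw [logAt, logAt, h4]; ring

theorem analyticAt_logAt (c τ : ℂ) : AnalyticAt ℂ (logAt c τ) (c + exp τ) := by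
  refine analyticAt_const.add (AnalyticAt.clog ?_ ?_)
  · exact (analyticAt_id.sub analyticAt_const).div_const
  · simp

/-- Two logarithms differ by 2πik, and continuity forces k = 0. Thus the branch is locally
independent of its base value, as a continuation along a path requires. -/
theorem eventually_logAt_eq (c τ : ℂ) :
    ∀ᶠ q : ℂ × ℂ in 𝓝 (τ, c + exp τ), logAt c q.1 q.2 = logAt c τ q.2 := by
  have hc1 : ContinuousAt (fun q : ℂ × ℂ => logAt c q.1 q.2) (τ, c + exp τ) := by
    refine continuousAt_fst.add (ContinuousAt.clog ?_ (by simp))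
    exact (continuousAt_snd.sub continuousAt_const).div (continuous_exp.continuousAt.comp
      continuousAt_fst) (exp_ne_zero _)
  have hc2 : ContinuousAt (fun q : ℂ × ℂ => logAt c τ q.2) (τ, c + exp τ) :=
    ContinuousAt.comp (g := logAt c τ) (f := Prod.snd) (analyticAt_logAt c τ).continuousAt
      continuousAt_snd
  have hc3 := (hc1.sub hc2).norm
  have hne : ∀ᶠ q : ℂ × ℂ in 𝓝 (τ, c + exp τ), q.2 ≠ c :=
    continuousAt_snd.eventually_ne (by simp)
  have hlt : ∀ᶠ q : ℂ × ℂ in 𝓝 (τ, c + exp τ),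
      ‖logAt c q.1 q.2 - logAt c τ q.2‖ < 2 * Real.pi := by
    refine hc3.eventually (gt_mem_nhds ?_)
    simp [logAt_self, Real.pi_pos]
  filter_upwards [hne, hlt] with q h1 h2
  have h3 : exp (logAt c q.1 q.2) = exp (logAt c τ q.2) := by
    have e1 := exp_logAt (τ := q.1) h1
    have e2 := exp_logAt (τ := τ) h1
    exact add_left_cancel (e1.trans e2.symm)
  obtain ⟨k, hk⟩ := exp_eq_exp_iff_exists_int.1 h3
  rw [hk, add_sub_cancel_left, norm_mul, norm_mul, norm_mul, norm_I, norm_real, Complex.norm_ofNat,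
    Real.norm_of_nonneg Real.pi_pos.le, mul_one, norm_intCast] at h2
  have h4 : |(k : ℝ)| < 1 := by
    by_contra h
    nlinarith [Real.pi_pos, not_lt.1 h]
  have h5 : k = 0 := by
    have : |k| < 1 := by exact_mod_cast h4
    exact Int.abs_lt_one_iff.1 this
  rw [hk, h5]; simp

theorem PF.analyticAt_logAt (hf : Sol κ exp {τ | τ.re < L} f)
    (hp : PF κ (fun τ => c + exp τ) exp {τ | τ.re < L} f p) {τ : ℂ} (hτ : τ.re < L) (w : ℂ) :
    AnalyticAt ℂ (fun q : ℂ × ℂ => p (logAt c τ q.1) q) (c + exp τ, w) := by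
  have h1 : AnalyticAt ℂ (fun q : ℂ × ℂ => p q.1 (c + exp q.1, q.2)) (logAt c τ (c + exp τ), w) :=
    hp.analyticOnNhd_hol (dev_add_exp c L) hf _ (by rw [logAt_self]; exact hτ)
  have h2 : AnalyticAt ℂ (fun q : ℂ × ℂ => (logAt c τ q.1, q.2)) (c + exp τ, w) :=
    (AnalyticAt.comp (g := logAt c τ) (f := Prod.fst) (_root_.analyticAt_logAt c τ)
      analyticAt_fst).prod analyticAt_snd
  generalize hg : (fun q : ℂ × ℂ => p q.1 (c + exp q.1, q.2)) = g at h1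
  have h3 := h1.comp_of_eq h2 rfl
  refine h3.congr ?_
  rw [← hg]
  have hne : ∀ᶠ q : ℂ × ℂ in 𝓝 (c + exp τ, w), q.1 ≠ c :=
    continuousAt_fst.eventually_ne (by simp)
  filter_upwards [hne] with q hq
  simp only [Function.comp, exp_logAt hq]

/-- The explicit continuation of a germ along a path around a 2-line. -/
theorem PF.continuesAlong (hf : Sol κ exp {τ | τ.re < L} f)
    (hp : PF κ (fun τ => c + exp τ) exp {τ | τ.re < L} f p) {R : ℂ × ℂ → ℂ}
    {σ : C(unitInterval, ℂ × ℂ)} {θ : unitInterval → ℂ} (hθ : Continuous θ)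
    (hre : ∀ t, (θ t).re < L) (hσ : ∀ t, (σ t).1 = c + exp (θ t))
    (hR : ∀ t, AnalyticAt ℂ R (σ t)) :
    ContinuesAlong σ (fun q => p (logAt c (θ 0) q.1) q + R q)
      (fun q => p (logAt c (θ 1) q.1) q + R q) := by
  refine ⟨fun t q => p (logAt c (θ t) q.1) q + R q, EventuallyEq.rfl, EventuallyEq.rfl,
    fun t => ?_, fun t => ?_⟩
  · refine AnalyticAt.add ?_ (hR t)
    have := hp.analyticAt_logAt hf (hre t) (σ t).2
    rwa [← hσ t] at this
  · have h1 := (eventually_logAt_eq c (θ t)).eventually_nhds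
    have h2 : ContinuousAt (fun s => (θ s, (σ s).1)) t :=
      hθ.continuousAt.prodMk (continuous_fst.comp σ.continuous).continuousAt
    rw [← hσ t] at h1
    filter_upwards [h2.eventually h1] with s hs
    have h3 : ContinuousAt (fun q : ℂ × ℂ => (θ s, q.1)) (σ s) := by fun_prop
    filter_upwards [h3.eventually hs] with q hq
    rw [show logAt c (θ s) q.1 = logAt c (θ t) q.1 from hq]

end Explicit

/-! ## The branches of the continuation -/

section Germs

variable {S : Type*} [TopologicalSpace S] {P : Set ℂ} {ψ : S → ℂ} {κ α β : ℂ}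
  {u : S → ℂ} {x dx : ℂ → ℂ} {Ω U D₁ D₂ : Set ℂ} {G g ga gb : ℂ → S} {p q pa pb : ℂ → ℂ × ℂ → ℂ}

namespace ScatteringData

/-- Two parametrised pieces of `S` yield the same branching parts, up to an entire function. -/
theorem exists_compare [T2Space S] (D : ScatteringData P ψ κ α β u) (hG : Lift P ψ x dx Ω G)
    (hp : PF κ x dx Ω (fun τ => u (G τ)) p) (hg : Lift P ψ (fun z => z) (fun _ => 1) U g)
    (hq : PF κ (fun z => z) (fun _ => 1) U (fun z => u (g z)) q) {τ₀ : ℂ} (h0 : τ₀ ∈ Ω)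
    (hU : x τ₀ ∈ U) (h : g (x τ₀) = G τ₀) :
    ∃ J : ℂ × ℂ → ℂ, Differentiable ℂ J ∧ ∀ᶠ τ in 𝓝 τ₀, ∀ A, q (x τ) A = p τ A + J A := by
  obtain ⟨r, hr, hball⟩ := Metric.eventually_nhds_iff_ball.1
    ((D.eventually_lift_eq hG hg h0 hU h).and (hG.dev.isOpen.mem_nhds h0))
  have hqb := hq.comp (Ω := Metric.ball τ₀ r) (y := x) (dy := dx) (D.sol_lift hg)
    (fun τ hτ => hG.dev.hasDerivAt τ (hball τ hτ).2) fun τ hτ => (hball τ hτ).1.1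
  obtain ⟨J, hJ, hqJ⟩ := hp.exists_entire Metric.isOpen_ball (convex_ball _ _).isPreconnected hqb
    (fun τ hτ => (hball τ hτ).2) fun τ hτ => by simp only [(hball τ hτ).1.2]
  exact ⟨J, hJ, by filter_upwards [Metric.ball_mem_nhds τ₀ hr] with τ hτ using hqJ τ hτ⟩

end ScatteringData

/-- The analytic germ composed of the branching part in the first variable, that comes from `gb`,
and the branching part in the second variable, that comes from `ga`. -/
noncomputable def glue (u : S → ℂ) (ga : ℂ → S) (pa pb : ℂ → ℂ × ℂ → ℂ) (q : ℂ × ℂ) : ℂ :=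
  pb q.1 q + (u (ga ((starRingEnd ℂ) q.2)) - pa ((starRingEnd ℂ) q.2) q)

namespace ScatteringData

theorem analyticOnNhd_fst (D : ScatteringData P ψ κ α β u)
    (hb : Lift P ψ (fun z => z) (fun _ => 1) D₁ gb)
    (hpb : PF κ (fun z => z) (fun _ => 1) D₁ (fun z => u (gb z)) pb) :
    AnalyticOnNhd ℂ (fun q : ℂ × ℂ => pb q.1 q) {q | q.1 ∈ D₁} :=
  hpb.analyticOnNhd_hol hb.dev (D.sol_lift hb)

theorem analyticOnNhd_snd (D : ScatteringData P ψ κ α β u)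
    (ha : Lift P ψ (fun z => z) (fun _ => 1) D₂ ga)
    (hpa : PF κ (fun z => z) (fun _ => 1) D₂ (fun z => u (ga z)) pa) :
    AnalyticOnNhd ℂ (fun q : ℂ × ℂ =>
      u (ga ((starRingEnd ℂ) q.2)) - pa ((starRingEnd ℂ) q.2) q) {q | (starRingEnd ℂ) q.2 ∈ D₂} := by
  have := hpa.analyticOnNhd_anti ha.dev (D.sol_lift ha)
  simpa only [Complex.conj_conj, Prod.mk.eta] using this

theorem analyticOnNhd_glue (D : ScatteringData P ψ κ α β u)
    (ha : Lift P ψ (fun z => z) (fun _ => 1) D₂ ga)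
    (hb : Lift P ψ (fun z => z) (fun _ => 1) D₁ gb)
    (hpa : PF κ (fun z => z) (fun _ => 1) D₂ (fun z => u (ga z)) pa)
    (hpb : PF κ (fun z => z) (fun _ => 1) D₁ (fun z => u (gb z)) pb) :
    AnalyticOnNhd ℂ (glue u ga pa pb) {q | q.1 ∈ D₁ ∧ (starRingEnd ℂ) q.2 ∈ D₂} := fun q hq =>
  (D.analyticOnNhd_fst hb hpb q hq.1).add (D.analyticOnNhd_snd ha hpa q hq.2)

end ScatteringData

/-- The germ of `f` at `B` is glued from pieces over `D₁` and `D₂`. -/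
def IsGlued (P : Set ℂ) (ψ : S → ℂ) (κ : ℂ) (u : S → ℂ) (D₁ D₂ : Set ℂ) (B : ℂ × ℂ)
    (f : ℂ × ℂ → ℂ) : Prop :=
  ∃ ga gb pa pb, Lift P ψ (fun z => z) (fun _ => 1) D₂ ga ∧
    Lift P ψ (fun z => z) (fun _ => 1) D₁ gb ∧
    PF κ (fun z => z) (fun _ => 1) D₂ (fun z => u (ga z)) pa ∧
    PF κ (fun z => z) (fun _ => 1) D₁ (fun z => u (gb z)) pb ∧
    B.1 ∈ D₁ ∧ (starRingEnd ℂ) B.2 ∈ D₂ ∧ f =ᶠ[𝓝 B] glue u ga pa pb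

/-- `q` lies on no singular 2-line. -/
def Avoids (P : Set ℂ) (q : ℂ × ℂ) : Prop := q.1 ∉ P ∧ (starRingEnd ℂ) q.2 ∉ P

namespace ScatteringData

variable {B : ℂ × ℂ} {f f' : ℂ × ℂ → ℂ}

/-- The two pieces may be re-lifted over any convex sets free of P that contain the base points.
This puts the germ in a form adapted to a prescribed neighbourhood. -/
theorem isGlued_of_isGlued [T2Space S] (D : ScatteringData P ψ κ α β u) {D₁' D₂' : Set ℂ}
    (h : IsGlued P ψ κ u D₁ D₂ B f) (ho1 : IsOpen D₁') (hc1 : Convex ℝ D₁') (hP1 : Disjoint D₁' P)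
    (ho2 : IsOpen D₂') (hc2 : Convex ℝ D₂') (hP2 : Disjoint D₂' P) (hB1 : B.1 ∈ D₁')
    (hB2 : (starRingEnd ℂ) B.2 ∈ D₂') : IsGlued P ψ κ u D₁' D₂' B f := by
  obtain ⟨ga, gb, pa, pb, ha, hb, hpa, hpb, h1, h2, hf⟩ := h
  obtain ⟨ga', ha', hga⟩ := D.exists_id_lift ho2 hc2 hP2 (a := ga ((starRingEnd ℂ) B.2))
    (by rw [ha.proj _ h2]; exact hB2)
  obtain ⟨gb', hb', hgb⟩ := D.exists_id_lift ho1 hc1 hP1 (a := gb B.1)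
    (by rw [hb.proj _ h1]; exact hB1)
  rw [ha.proj _ h2] at hga
  rw [hb.proj _ h1] at hgb
  obtain ⟨pa', hpa'⟩ := (D.sol_lift ha').exists_PF ha'.dev
  obtain ⟨pb', hpb'⟩ := (D.sol_lift hb').exists_PF hb'.dev
  obtain ⟨J1, hJ1, hJ1'⟩ := D.exists_compare ha hpa ha' hpa' h2 hB2 hga
  obtain ⟨J2, hJ2, hJ2'⟩ := D.exists_compare hb hpb hb' hpb' h1 hB1 hgb
  -- New primitives differ from the old ones by entire J1 and J2; in the sum only J1 − J2 matters,
  -- and it is absorbed into the first part.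
  refine ⟨ga', gb', pa', _, ha', hb', hpa', hpb'.add_entire (hJ1.sub hJ2), hB1, hB2, ?_⟩
  have hc : Tendsto (fun q : ℂ × ℂ => (starRingEnd ℂ) q.2) (𝓝 B) (𝓝 ((starRingEnd ℂ) B.2)) :=
    (continuous_conj.comp continuous_snd).continuousAt
  filter_upwards [hf, hc.eventually hJ1', continuousAt_fst.eventually hJ2',
    hc.eventually (D.eventually_lift_eq ha ha' h2 hB2 hga)] with q h3 h4 h5 h6
  rw [h3, glue, glue, h4, h5, h6.2]
  simp only [Pi.sub_apply]
  ring

/-- On a small ball all glued representations can use the same two discs, and the identity theorem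
then transfers one from any point of the ball to any other. Hence the property is both open and
closed along a path. -/
theorem exists_isGlued_iff [T2Space S] (D : ScatteringData P ψ κ α β u) (hf : AnalyticAt ℂ f B)
    (hB : Avoids P B) : ∀ᶠ B' in 𝓝 B,
      ((∃ D₁ D₂, IsGlued P ψ κ u D₁ D₂ B' f) ↔ ∃ D₁ D₂, IsGlued P ψ κ u D₁ D₂ B f) := by
  obtain ⟨r1, hr1, hP1⟩ := D.exists_ball hB.1
  obtain ⟨r2, hr2, hP2⟩ := D.exists_ball hB.2
  set D₁ := Metric.ball B.1 r1
  set D₂ := Metric.ball ((starRingEnd ℂ) B.2) r2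
  have hB1 : B.1 ∈ D₁ := Metric.mem_ball_self hr1
  have hB2 : (starRingEnd ℂ) B.2 ∈ D₂ := Metric.mem_ball_self hr2
  have key : ∀ {B'}, B'.1 ∈ D₁ → (starRingEnd ℂ) B'.2 ∈ D₂ →
      ((∃ D₁ D₂, IsGlued P ψ κ u D₁ D₂ B' f) ↔ IsGlued P ψ κ u D₁ D₂ B' f) := fun h1 h2 =>
    ⟨fun ⟨_, _, h⟩ => D.isGlued_of_isGlued h Metric.isOpen_ball (convex_ball _ _) hP1
      Metric.isOpen_ball (convex_ball _ _) hP2 h1 h2, fun h => ⟨_, _, h⟩⟩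
  have hW := isOpen_polyconj (Ω := D₁) (Ω' := D₂) Metric.isOpen_ball Metric.isOpen_ball
  obtain ⟨r, hr, hball⟩ := Metric.eventually_nhds_iff_ball.1
    (hf.eventually_analyticAt.and (hW.eventually_mem (show B ∈ _ from ⟨hB1, hB2⟩)))
  rw [key hB1 hB2]
  filter_upwards [Metric.ball_mem_nhds B hr] with B' hB'
  rw [key (hball B' hB').2.1 (hball B' hB').2.2]
  have hrig : ∀ C ∈ Metric.ball B r, ∀ C' ∈ Metric.ball B r,
      IsGlued P ψ κ u D₁ D₂ C f → IsGlued P ψ κ u D₁ D₂ C' f := by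
    rintro C hC C' hC' ⟨ga, gb, pa, pb, ha, hb, hpa, hpb, h1, h2, h3⟩
    refine ⟨ga, gb, pa, pb, ha, hb, hpa, hpb, (hball C' hC').2.1, (hball C' hC').2.2, ?_⟩
    exact (AnalyticOnNhd.eqOn_of_preconnected_of_eventuallyEq (fun q hq => (hball q hq).1)
      (fun q hq => D.analyticOnNhd_glue ha hb hpa hpb q (hball q hq).2)
      (convex_ball B r).isPreconnected hC h3).eventuallyEq_of_mem (Metric.isOpen_ball.mem_nhds hC')
  exact ⟨hrig _ hB' _ (Metric.mem_ball_self hr), hrig _ (Metric.mem_ball_self hr) _ hB'⟩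

theorem _root_.IsGlued.congr (h : IsGlued P ψ κ u D₁ D₂ B f) (hf : f' =ᶠ[𝓝 B] f) :
    IsGlued P ψ κ u D₁ D₂ B f' := by
  obtain ⟨ga, gb, pa, pb, ha, hb, hpa, hpb, h1, h2, h3⟩ := h
  exact ⟨ga, gb, pa, pb, ha, hb, hpa, hpb, h1, h2, hf.trans h3⟩

/-- Analytic continuation preserves the structure of a branch. -/
theorem exists_isGlued_of_continuesAlong [T2Space S] (D : ScatteringData P ψ κ α β u)
    {σ : C(unitInterval, ℂ × ℂ)} (hσ : ∀ t, Avoids P (σ t)) (hc : ContinuesAlong σ f f')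
    (h : ∃ D₁ D₂, IsGlued P ψ κ u D₁ D₂ (σ 0) f) :
    ∃ D₁ D₂, IsGlued P ψ κ u D₁ D₂ (σ 1) f' := by
  obtain ⟨F, h0, h1, ha, hc⟩ := hc
  have hcongr : ∀ {g g' : ℂ × ℂ → ℂ} {C : ℂ × ℂ}, g =ᶠ[𝓝 C] g' →
      ((∃ D₁ D₂, IsGlued P ψ κ u D₁ D₂ C g) ↔ ∃ D₁ D₂, IsGlued P ψ κ u D₁ D₂ C g') := fun h =>
    ⟨fun ⟨_, _, h'⟩ => ⟨_, _, h'.congr h.symm⟩, fun ⟨_, _, h'⟩ => ⟨_, _, h'.congr h⟩⟩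
  rw [← hcongr h1]
  rw [← hcongr h0] at h
  refine (isPreconnected_univ.induction₂
    (fun s t : unitInterval => (∃ D₁ D₂, IsGlued P ψ κ u D₁ D₂ (σ s) (F s)) ↔
      ∃ D₁ D₂, IsGlued P ψ κ u D₁ D₂ (σ t) (F t)) (fun t _ => ?_)
    (fun _ _ _ _ _ _ h1 h2 => h1.trans h2) (fun _ _ _ _ h => h.symm) (mem_univ 0)
    (mem_univ 1)).1 h
  rw [nhdsWithin_univ]
  filter_upwards [hc t, σ.continuous.continuousAt.eventually (D.exists_isGlued_iff (ha t) (hσ t))]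
    with s h2 h3
  exact (hcongr h2).trans h3 |>.symm

/-- At a real point the same piece of S and the same primitive serve for both parts. On the diagonal
the primitives cancel and leave u; the real plane is a set of uniqueness. -/
theorem isGlued_of_diag [T2Space S] (D : ScatteringData P ψ κ α β u) {A₀ : S} (hA : ψ A₀ ∉ P)
    (hf : AnalyticAt ℂ f (ψ A₀, (starRingEnd ℂ) (ψ A₀)))
    (hfu : ∀ᶠ A in 𝓝 A₀, f (ψ A, (starRingEnd ℂ) (ψ A)) = u A) :
    ∃ D₁ D₂, IsGlued P ψ κ u D₁ D₂ (ψ A₀, (starRingEnd ℂ) (ψ A₀)) f := by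
  obtain ⟨r, hr, hP⟩ := D.exists_ball hA
  have hm := Metric.mem_ball_self (x := ψ A₀) hr
  obtain ⟨g, hg, hgA⟩ := D.exists_id_lift Metric.isOpen_ball (convex_ball _ _) hP hm
  obtain ⟨p, hp⟩ := (D.sol_lift hg).exists_PF hg.dev
  refine ⟨_, _, g, g, p, p, hg, hg, hp, hp, hm, by simpa using hr, ?_⟩
  have hgc : Tendsto g (𝓝 (ψ A₀)) (𝓝 A₀) := by
    have := hg.cont.continuousAt (Metric.isOpen_ball.mem_nhds hm)
    rwa [ContinuousAt, hgA] at this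
  have h1 := (hf.sub (D.analyticOnNhd_glue hg hg hp hp (ψ A₀, (starRingEnd ℂ) (ψ A₀))
    ⟨hm, by simpa using hr⟩)).eventually_eq_zero_of_diag (by
      filter_upwards [hgc.eventually hfu, Metric.ball_mem_nhds _ hr] with z h2 h3
      rw [hg.proj z h3] at h2
      simp [glue, h2])
  filter_upwards [h1] with q hq
  exact sub_eq_zero.1 hq

end ScatteringData

/-- The germ of `f` at `B` is a branch of the continuation of `u`, in characteristic coordinates. -/
def IsCharBranch (P : Set ℂ) (ψ : S → ℂ) (u : S → ℂ) (B : ℂ × ℂ) (f : ℂ × ℂ → ℂ) : Prop :=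
  ∃ A₀ : S, ψ A₀ ∉ P ∧ ∃ f₀ : ℂ × ℂ → ℂ, AnalyticAt ℂ f₀ (ψ A₀, (starRingEnd ℂ) (ψ A₀)) ∧
    (∀ᶠ A in 𝓝 A₀, f₀ (ψ A, (starRingEnd ℂ) (ψ A)) = u A) ∧
    ∃ σ : C(unitInterval, ℂ × ℂ), σ 0 = (ψ A₀, (starRingEnd ℂ) (ψ A₀)) ∧ σ 1 = B ∧
      (∀ t, Avoids P (σ t)) ∧ ContinuesAlong σ f₀ f

/-- Near `C`, the bypasses of the line `q.1 = C.1` with winding number `n` bring the branches back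
to themselves. -/
def CharBypassReturns (P : Set ℂ) (ψ : S → ℂ) (u : S → ℂ) (C : ℂ × ℂ) (n : ℕ) : Prop :=
  ∃ U ∈ 𝓝 C, ∀ B f, IsCharBranch P ψ u B f →
    ∀ σ : C(unitInterval, ℂ × ℂ), σ 0 = B → σ 1 = B → (∀ t, σ t ∈ U ∧ Avoids P (σ t)) →
      HasWindingNumber (fun t => (σ t).1 - C.1) n → ContinuesAlong σ f f

theorem ContinuesAlong.congr {σ : C(unitInterval, ℂ × ℂ)} {f f' h h' : ℂ × ℂ → ℂ}
    (hc : ContinuesAlong σ f h) (hf : f =ᶠ[𝓝 (σ 0)] f') (hh : h =ᶠ[𝓝 (σ 1)] h') :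
    ContinuesAlong σ f' h' := by
  obtain ⟨F, h0, h1, h2⟩ := hc
  exact ⟨F, h0.trans hf, h1.trans hh, h2⟩

theorem ScatteringData.exists_isGlued [T2Space S] (D : ScatteringData P ψ κ α β u) {B : ℂ × ℂ}
    {f : ℂ × ℂ → ℂ} (h : IsCharBranch P ψ u B f) : ∃ D₁ D₂, IsGlued P ψ κ u D₁ D₂ B f := by
  obtain ⟨A₀, hA, f₀, h1, h2, σ, h3, rfl, h4, h5⟩ := h
  refine D.exists_isGlued_of_continuesAlong h4 h5 ?_
  rw [h3]
  exact D.isGlued_of_diag hA h1 h2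

/-- Branches obtained without a bypass. -/
theorem ScatteringData.isCharBranch_glue (D : ScatteringData P ψ κ α β u)
    (hg : Lift P ψ (fun z => z) (fun _ => 1) U g)
    (hp : PF κ (fun z => z) (fun _ => 1) U (fun z => u (g z)) p) {z w : ℂ} (hz : z ∈ U)
    (hw : (starRingEnd ℂ) w ∈ U) : IsCharBranch P ψ u (z, w) (glue u g p p) := by
  have han := D.analyticOnNhd_glue hg hg hp hp
  have hψ := hg.proj z hz
  have hz' : (starRingEnd ℂ) ((starRingEnd ℂ) z) ∈ U := by rwa [Complex.conj_conj]
  -- Only the second coordinate moves, away from the real plane and inside a convex domain free of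
  -- 2-lines.
  let γ : Path (z, (starRingEnd ℂ) z) (z, w) := Path.segment _ _
  have hγ : ∀ t, (γ t).1 ∈ U ∧ (starRingEnd ℂ) (γ t).2 ∈ U := fun t => by
    have : γ t ∈ segment ℝ (z, (starRingEnd ℂ) z) (z, w) := by
      rw [← Path.range_segment]; exact mem_range_self t
    exact (convex_polyconj hg.dev.convex hg.dev.convex).segment_subset ⟨hz, hz'⟩ ⟨hz, hw⟩ this
  refine ⟨g z, by rw [hψ]; exact hg.avoid z hz, glue u g p p, ?_, ?_, γ.toContinuousMap, ?_, ?_,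
    fun t => ⟨hg.avoid _ (hγ t).1, hg.avoid _ (hγ t).2⟩, fun _ => glue u g p p, EventuallyEq.rfl,
    EventuallyEq.rfl, fun t => han _ (hγ t), fun t => Eventually.of_forall fun s => EventuallyEq.rfl⟩
  · rw [hψ]; exact han _ ⟨hz, hz'⟩
  · filter_upwards [D.eventually_section hg (a := g z) (by rwa [hψ]) (by rw [hψ])] with y hy
    simp [glue, hy.2]
  · rw [hψ]; exact γ.source
  · exact γ.target

end Germs

/-! ## Branch 2-lines in characteristic coordinates -/

section Core

variable {S : Type*} [TopologicalSpace S] {P : Set ℂ} {ψ : S → ℂ} {κ α β : ℂ} {L : ℝ} {c : ℂ}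
  {u : S → ℂ} {f : ℂ → ℂ} {G g : ℂ → S} {p pb : ℂ → ℂ × ℂ → ℂ}

theorem exp_add_int (τ : ℂ) (n : ℤ) : exp (τ + 2 * Real.pi * I * n) = exp τ := by
  rw [exp_add, mul_comm (2 * Real.pi * I : ℂ) n, exp_int_mul_two_pi_mul_I, mul_one]

theorem PF.add_period (hp : PF κ (fun τ => c + exp τ) exp {τ | τ.re < L} f p) (n : ℤ) :
    PF κ (fun τ => c + exp τ) exp {τ | τ.re < L} (fun τ => f (τ + 2 * Real.pi * I * n))
      fun τ => p (τ + 2 * Real.pi * I * n) where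
  deriv A τ hτ := by
    have h1 : HasFDerivAt (fun τ => p (τ + 2 * Real.pi * I * n) A) _ τ :=
      HasFDerivAt.comp (g := fun τ => p τ A) (f := fun τ => τ + 2 * Real.pi * I * n) τ
        (hp.deriv A (τ + 2 * Real.pi * I * n) (by simpa using hτ))
        ((hasFDerivAt_id (𝕜 := ℝ) τ).add_const _)
    refine h1.congr_fderiv ?_
    rw [green, green, dz_add_const, exp_add_int]
    ext1 v; simp
  entire τ hτ := hp.entire _ (by simpa using hτ)

theorem continuousAt_logAt_fst (c τ w : ℂ) :
    Tendsto (fun q : ℂ × ℂ => logAt c τ q.1) (𝓝 (c + exp τ, w)) (𝓝 τ) := by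
  have h := (analyticAt_logAt c τ).continuousAt.tendsto
  rw [logAt_self] at h
  exact h.comp continuousAt_fst

/-- The comparison of the branching parts, read in the first variable. -/
theorem ScatteringData.exists_compare_logAt [T2Space S] (D : ScatteringData P ψ κ α β u)
    {U : Set ℂ} (hG : Lift P ψ (fun τ => c + exp τ) exp {τ | τ.re < L} G)
    (hp : PF κ (fun τ => c + exp τ) exp {τ | τ.re < L} (fun τ => u (G τ)) p)
    (hg : Lift P ψ (fun z => z) (fun _ => 1) U g)
    (hq : PF κ (fun z => z) (fun _ => 1) U (fun z => u (g z)) pb) {τ₀ : ℂ} (h0 : τ₀.re < L)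
    (hU : c + exp τ₀ ∈ U) (h : g (c + exp τ₀) = G τ₀) (w : ℂ) :
    ∃ J : ℂ × ℂ → ℂ, Differentiable ℂ J ∧ ∀ᶠ q : ℂ × ℂ in 𝓝 (c + exp τ₀, w),
      pb q.1 q = p (logAt c τ₀ q.1) q + J q := by
  obtain ⟨J, hJ, hev⟩ := D.exists_compare hG hp hg hq h0 hU h
  refine ⟨J, hJ, ?_⟩
  have hne : ∀ᶠ q : ℂ × ℂ in 𝓝 (c + exp τ₀, w), q.1 ≠ c :=
    continuousAt_fst.eventually_ne (by simp)
  filter_upwards [(continuousAt_logAt_fst c τ₀ w).eventually hev, hne] with q h1 h2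
  have := h1 q
  rwa [exp_logAt h2] at this

theorem Differentiable.analyticAt_prod {J : ℂ × ℂ → ℂ} (hJ : Differentiable ℂ J) (q : ℂ × ℂ) :
    AnalyticAt ℂ J q :=
  hJ.differentiableOn.analyticOnNhd_prod isOpen_univ q (mem_univ q)

/-- If all the orders of branching over `c` divide `n`, then `n` bypasses bring the branches back to
themselves. -/
theorem ScatteringData.charBypassReturns [T2Space S] (D : ScatteringData P ψ κ α β u) {w₀ : ℂ}
    (hc : c ∈ P) (hw : (starRingEnd ℂ) w₀ ∉ P) {n : ℕ}
    (hdiv : ∀ Q, ψ Q = c → ∀ m, HasBranchingOrder ψ Q m → m ∣ n) :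
    CharBypassReturns P ψ u (c, w₀) n := by
  obtain ⟨ρ, hρ, hnear⟩ := D.exists_near_uniform c
  obtain ⟨r, hr, hP⟩ := D.exists_ball hw
  -- The radius ρ serves all points of S over the punctured disc, since the neighbourhood must
  -- precede the branch. The second disc avoids P, so one piece `ga` serves along the whole path.
  refine ⟨{q | q.1 ∈ Metric.ball c ρ ∧ (starRingEnd ℂ) q.2 ∈ Metric.ball ((starRingEnd ℂ) w₀) r},
    (isOpen_polyconj Metric.isOpen_ball Metric.isOpen_ball).mem_nhds
      ⟨Metric.mem_ball_self hρ, Metric.mem_ball_self hr⟩, fun B f hBf σ hσ0 hσ1 hσ hwind => ?_⟩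
  obtain ⟨⟨hB1, hB2⟩, hB3, -⟩ := hσ0 ▸ hσ 0
  obtain ⟨D₁', D₂', hgl⟩ := D.exists_isGlued hBf
  obtain ⟨r1, hr1, hP1⟩ := D.exists_ball hB3
  obtain ⟨ga, gb, pa, pb, ha, hb, hpa, hpb, h1, -, hf⟩ := D.isGlued_of_isGlued hgl
    Metric.isOpen_ball (convex_ball _ _) hP1 Metric.isOpen_ball (convex_ball _ _) hP
    (Metric.mem_ball_self hr1) hB2
  have hy := hb.proj _ h1
  have hBc : B.1 ≠ c := fun h => hB3 (h ▸ hc)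
  obtain ⟨Q, m, L, G, hQ, hm, hρL, hG, hper, ⟨K, hK⟩, τ₀, hτ₀, hGτ⟩ := hnear (gb B.1)
    (by rwa [hy]) (by rw [hy]; exact mem_ball_iff_norm.1 hB1)
  have hBτ : c + exp τ₀ = B.1 := by rw [← hG.proj _ hτ₀, hGτ, hy]
  obtain ⟨p, hp⟩ := (D.sol_lift hG).exists_PF hG.dev
  obtain ⟨J, hJ, hcmp⟩ := D.exists_compare_logAt hG hp hb hpb hτ₀ (by rwa [hBτ])
    (by rw [hBτ, hGτ]) B.2
  rw [hBτ, Prod.mk.eta] at hcmp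
  obtain ⟨θ, hθ, hθn⟩ := hwind
  replace hθ : ∀ t, (σ t).1 - c = exp (θ t) := hθ
  have hθ0 : exp (θ 0) = exp τ₀ := by
    rw [← hθ 0, hσ0, ← hBτ]; simp
  -- The logarithm of the path is shifted by a multiple of 2πi so that it starts at τ₀, the
  -- parameter of the actual point of S.
  have hexp : ∀ t, exp (θ t - θ 0 + τ₀) = exp (θ t) := fun t => by
    rw [exp_add, exp_sub, hθ0, div_mul_cancel₀ _ (exp_ne_zero _)]
  have hre : ∀ t, (θ t - θ 0 + τ₀).re < L := fun t => by
    have h2 := mem_ball_iff_norm.1 (hσ t).1.1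
    rw [hθ t, ← hexp t, norm_exp] at h2
    exact Real.exp_lt_exp.1 (h2.trans_le hρL)
  have hσθ : ∀ t, (σ t).1 = c + exp (θ t - θ 0 + τ₀) := fun t => by
    rw [hexp t, ← hθ t]; ring
  have hcont := hp.continuesAlong (D.sol_lift hG) (σ := σ) (θ := fun t => θ t - θ 0 + τ₀)
    (R := fun q => J q + (u (ga ((starRingEnd ℂ) q.2)) - pa ((starRingEnd ℂ) q.2) q))
    (by fun_prop) hre hσθ
    fun t => (hJ.analyticAt_prod _).add (D.analyticOnNhd_snd ha hpa _ (hσ t).1.2)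
  simp only [sub_self, zero_add] at hcont
  have e1 : θ 1 - θ 0 + τ₀ = τ₀ + 2 * Real.pi * I * (n : ℤ) := by rw [hθn]; ring
  have hlog := continuousAt_logAt_fst c τ₀ B.2
  rw [hBτ, Prod.mk.eta] at hlog
  -- This is where divisibility enters: n turns close up on S, so by `PF.periodic` the primitive
  -- also returns to itself.
  have hfuper : ∀ τ : ℂ, τ.re < L → u (G (τ + (2 * Real.pi * n : ℝ) * I)) = u (G τ) :=
    fun τ hτ => by
      have := (hper τ hτ n).2 (by exact_mod_cast hdiv Q hQ m hm)
      rw [← this]; congr 2; push_cast; ring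
  have hend : (fun q : ℂ × ℂ => p (logAt c τ₀ q.1) q +
      (J q + (u (ga ((starRingEnd ℂ) q.2)) - pa ((starRingEnd ℂ) q.2) q))) =ᶠ[𝓝 B] f := by
    filter_upwards [hf, hcmp] with q h3 h4
    rw [h3, glue, h4]; ring
  refine hcont.congr (hσ0 ▸ hend) ?_
  rw [hσ1]
  refine EventuallyEq.trans ?_ hend
  filter_upwards [hlog.eventually ((isOpen_re_lt L).eventually_mem hτ₀)] with q hq
  rw [e1, logAt_add_period]
  have := hp.periodic (D.sol_lift hG) hfuper hK q hq
  rw [← this]; congr 3; push_cast; ring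

/-- Points near `c` that are joined to `e` by a segment avoiding `P`. -/
theorem exists_segment_disjoint (hP : P.Finite) {e : ℂ} (hc : c ∈ P) (he : e ∉ P) {ρ : ℝ}
    (hρ : 0 < ρ) : ∃ v : ℂ, v ≠ 0 ∧ ‖v‖ < ρ ∧ Disjoint (segment ℝ e (c + v)) P := by
  have hce : c - e ≠ 0 := sub_ne_zero.2 fun h => he (h ▸ hc)
  -- Take v orthogonal to c − e with relative length t. In the coordinate (z − e)/(c − e) every
  -- point of the segment other than e has slope t, so only finitely many t are forbidden.
  have hfin := hP.image fun z => ((z - e) / (c - e)).im / ((z - e) / (c - e)).re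
  have hpos : 0 < ρ / ‖c - e‖ := div_pos hρ (norm_pos_iff.2 hce)
  obtain ⟨t, ⟨ht0, htρ⟩, ht⟩ := ((Ioo_infinite hpos).sdiff hfin).nonempty
  have ht' : (t : ℂ) ≠ 0 := by exact_mod_cast ht0.ne'
  refine ⟨(c - e) * I * t, mul_ne_zero (mul_ne_zero hce I_ne_zero) ht', ?_, ?_⟩
  · rw [norm_mul, norm_mul, norm_I, mul_one, norm_real, Real.norm_of_nonneg ht0.le, mul_comm]
    exact (lt_div_iff₀ (norm_pos_iff.2 hce)).1 htρ
  · rw [disjoint_left]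
    intro z hz hzP
    rw [segment_eq_image'] at hz
    obtain ⟨s, -, rfl⟩ := hz
    have h1 : ((e + s • (c + (c - e) * I * t - e) : ℂ) - e) / (c - e) = (s : ℂ) * (1 + I * t) := by
      rw [div_eq_iff hce, Complex.real_smul]; ring
    refine ht ⟨_, hzP, ?_⟩
    simp only
    rw [h1]
    have hs : s ≠ 0 := by
      rintro rfl
      simp only [zero_smul, add_zero] at hzP
      exact he hzP
    simp [hs]

/-- If `n` bypasses bring the branches back to themselves, then `n` is a multiple of all the orders of
branching over `c`. -/
theorem ScatteringData.dvd_of_charBypassReturns [T2Space S] [ConnectedSpace S]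
    (D : ScatteringData P ψ κ α β u) {w₀ : ℂ}
    (hw : (starRingEnd ℂ) w₀ ∉ P) {n : ℕ} (h : CharBypassReturns P ψ u (c, w₀) n) (hc : c ∈ P)
    {Q : S} (hQ : ψ Q = c) {m : ℕ} (hm : HasBranchingOrder ψ Q m) : m ∣ n := by
  by_contra hmn
  obtain ⟨L, G, hG, hper, -, -⟩ := D.exists_near Q hm
  rw [hQ] at hG
  obtain ⟨V, hV, hret⟩ := h
  obtain ⟨V₁, hV₁, V₂, hV₂, hVV⟩ := mem_nhds_prod_iff.1 hV
  have hsep : (P \ {c})ᶜ ∈ 𝓝 c :=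
    (D.finite.subset sdiff_subset).isClosed.isOpen_compl.mem_nhds fun h => h.2 rfl
  obtain ⟨r, hr, hball⟩ := Metric.mem_nhds_iff.1 (inter_mem hV₁ hsep)
  -- A germ near the line must be joined to the real plane without leaving one sample. The segment
  -- from w̄₀ to c + v permits this, with c + v inside both the given neighbourhood and the
  -- logarithmic chart.
  obtain ⟨v, hv0, hv, hseg⟩ := exists_segment_disjoint D.finite hc hw
    (lt_min hr (Real.exp_pos L))
  set e := (starRingEnd ℂ) w₀ with he
  have hcomp : IsCompact (segment ℝ e (c + v)) := by
    rw [← Path.range_segment]; exact isCompact_range (Path.continuous _)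
  obtain ⟨δ, hδ, hthick⟩ := hcomp.exists_thickening_subset_open D.isOpen_compl
    (disjoint_left.1 hseg)
  -- Convex and free of P, it contains both c + v and w̄₀, so a single lift provides the two parts
  -- of the branch at (c + v, w₀).
  set U := Metric.thickening δ (segment ℝ e (c + v)) with hU
  have hUP : Disjoint U P := disjoint_left.2 hthick
  have hsub : segment ℝ e (c + v) ⊆ U := Metric.self_subset_thickening hδ _
  have heU : e ∈ U := hsub (left_mem_segment _ _ _)
  have hvU : c + v ∈ U := hsub (right_mem_segment _ _ _)
  set τ₀ := log v with hτ₀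
  have hexp : exp τ₀ = v := exp_log hv0
  have hτL : τ₀.re < L := by
    have h1 : ‖exp τ₀‖ < Real.exp L := by rw [hexp]; exact hv.trans_le (min_le_right _ _)
    rw [norm_exp] at h1
    exact Real.exp_lt_exp.1 h1
  have hGψ : ψ (G τ₀) = c + v := by rw [hG.proj _ hτL, hexp]
  obtain ⟨g, hg, hgG⟩ := D.exists_id_lift Metric.isOpen_thickening
    ((convex_segment e (c + v)).thickening δ) hUP (a := G τ₀) (by rwa [hGψ])
  rw [hGψ] at hgG
  obtain ⟨pb, hpb⟩ := (D.sol_lift hg).exists_PF hg.dev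
  obtain ⟨p, hp⟩ := (D.sol_lift hG).exists_PF hG.dev
  have hbr := D.isCharBranch_glue hg hpb hvU (w := w₀) heU
  obtain ⟨J, hJ, hcmp⟩ := D.exists_compare_logAt hG hp hg hpb hτL (by rwa [hexp])
    (by rw [hexp, hgG]) w₀
  let θ : C(unitInterval, ℂ) := ⟨fun t => τ₀ + 2 * Real.pi * I * n * (t : ℝ), by fun_prop⟩
  have hθre : ∀ t, (θ t).re = τ₀.re := fun t => by simp [θ]
  have hθn : ∀ t, ‖exp (θ t)‖ = ‖v‖ := fun t => by rw [norm_exp, hθre, ← norm_exp, hexp]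
  have hθ0 : θ 0 = τ₀ := by simp [θ]
  have hθ1 : θ 1 = τ₀ + 2 * Real.pi * I * (n : ℤ) := by simp [θ]
  let σ : C(unitInterval, ℂ × ℂ) := ⟨fun t => (c + exp (θ t), w₀), by fun_prop⟩
  have hσ0 : σ 0 = (c + v, w₀) := by
    change (c + exp (θ 0), w₀) = _
    rw [hθ0, hexp]
  have hσ1 : σ 1 = (c + v, w₀) := by
    change (c + exp (θ 1), w₀) = _
    rw [hθ1, exp_add_int, hexp]
  have hσb : ∀ t, (σ t).1 ∈ Metric.ball c r := fun t => by
    rw [mem_ball_iff_norm]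
    change ‖c + exp (θ t) - c‖ < r
    rw [add_sub_cancel_left, hθn]
    exact hv.trans_le (min_le_left _ _)
  have hσc : ∀ t, (σ t).1 ≠ c := fun t h => exp_ne_zero (θ t) (add_eq_left.1 h)
  have hcl := hret _ _ hbr σ hσ0 hσ1 (fun t => ⟨hVV ⟨(hball (hσb t)).1, mem_of_mem_nhds hV₂⟩,
    fun h => (hball (hσb t)).2 ⟨h, hσc t⟩, hw⟩) ⟨θ, fun t => by
      change c + exp (θ t) - c = _
      ring, by rw [hθ1, hθ0]; ring⟩
  have hcont := hp.continuesAlong (D.sol_lift hG) (σ := σ) (θ := θ)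
    (R := fun q => J q + (u (g ((starRingEnd ℂ) q.2)) - pb ((starRingEnd ℂ) q.2) q))
    θ.continuous (fun t => by rwa [hθre]) (fun t => rfl)
    fun t => (hJ.analyticAt_prod _).add (D.analyticOnNhd_snd hg hpb _ heU)
  rw [hθ0, hθ1] at hcont
  rw [hexp] at hcmp
  have hstart : (fun q : ℂ × ℂ => p (logAt c τ₀ q.1) q +
      (J q + (u (g ((starRingEnd ℂ) q.2)) - pb ((starRingEnd ℂ) q.2) q)))
      =ᶠ[𝓝 (c + v, w₀)] glue u g pb pb := by
    filter_upwards [hcmp] with q h4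
    rw [glue, h4]; ring
  -- The explicit continuation after n turns must agree with the original germ. The terms other than
  -- p cancel, so the n-turn increment of the first branching part is zero, which is `Ent` for the
  -- difference of the two samples.
  have hend := (hcont.congr (hσ0 ▸ hstart) EventuallyEq.rfl).unique hcl
  rw [hσ1] at hend
  have hT : Tendsto (fun q : ℂ × ℂ => (c + exp q.1, q.2)) (𝓝 (τ₀, w₀)) (𝓝 (c + v, w₀)) := by
    have : ContinuousAt (fun q : ℂ × ℂ => (c + exp q.1, q.2)) (τ₀, w₀) := by fun_prop
    rwa [ContinuousAt, hexp] at this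
  have hT' : Tendsto (fun q : ℂ × ℂ => (q.1, c + exp q.1)) (𝓝 (τ₀, w₀)) (𝓝 (τ₀, c + exp τ₀)) := by
    have : ContinuousAt (fun q : ℂ × ℂ => (q.1, c + exp q.1)) (τ₀, w₀) := by fun_prop
    exact this
  refine not_ent D hG hm.1 hper (n := n) (fun h => hmn (by exact_mod_cast h)) ?_
  refine PF.ent_of_eventually (w₀ := w₀) hG.dev (D.sol_diff hG (lift_add_period hG n))
    (PF.sub (D.sol_lift (lift_add_period hG n)) (D.sol_lift hG) (hp.add_period n) hp) hτL ?_
  filter_upwards [hT.eventually (hend.trans hstart.symm), hT'.eventually (eventually_logAt_eq c τ₀)]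
    with q h1 h2
  rw [logAt_self] at h2
  simp only [logAt_add_period, ← h2] at h1
  rw [add_left_inj] at h1
  rw [h1, sub_self]

end Core

/-! ## Curves in the plane have empty interior -/

/-- A disc is homeomorphic to the plane, and the plane minus a point is connected. -/
theorem isPreconnected_ball_sdiff_singleton (z w : ℂ) {r : ℝ} (hr : 0 < r) :
    IsPreconnected (Metric.ball z r \ {w}) := by
  by_cases hw : w ∈ Metric.ball z r
  · let e := OpenPartialHomeomorph.univBall z r
    have hs : e.source = univ := OpenPartialHomeomorph.univBall_source z r
    have ht : e.target = Metric.ball z r := OpenPartialHomeomorph.univBall_target z hr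
    have h1 : Metric.ball z r \ {w} = e '' {e.symm w}ᶜ := by
      ext y
      constructor
      · rintro ⟨hy, hyw⟩
        rw [← ht] at hy
        refine ⟨e.symm y, fun h => hyw ?_, e.right_inv hy⟩
        rw [← ht] at hw
        rw [mem_singleton_iff, ← e.right_inv hy, ← e.right_inv hw, mem_singleton_iff.1 h]
      · rintro ⟨y, hy, rfl⟩
        refine ⟨ht ▸ e.map_source (by simp [hs]), fun h => hy ?_⟩
        rw [mem_singleton_iff, ← mem_singleton_iff.1 h, e.left_inv (by simp [hs])]
    rw [h1]
    refine IsPreconnected.image ?_ _ (e.continuousOn.mono (by simp [hs]))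
    exact (isConnected_compl_singleton_of_one_lt_rank (by simp) _).isPreconnected
  · rw [sdiff_singleton_eq_self hw]
    exact (convex_ball z r).isPreconnected

/-- A disc inside the curve would stay connected after removal of any point, whereas its preimage in
a linear order is disconnected by removal of the middle one of three points. With closedness, this
makes the complement of the cuts dense. -/
theorem Topology.IsEmbedding.interior_range_eq_empty {X : Type*} [LinearOrder X]
    [TopologicalSpace X] [OrderClosedTopology X] {γ : X → ℂ} (hγ : IsEmbedding γ) :
    interior (range γ) = ∅ := by
  by_contra hne
  obtain ⟨z, hz⟩ := nonempty_iff_ne_empty.2 hne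
  obtain ⟨r, hr, hball⟩ := Metric.isOpen_iff.1 isOpen_interior z hz
  have hinf : (Metric.ball z r).Infinite := infinite_of_mem_nhds z (Metric.ball_mem_nhds z hr)
  have hpre : ∀ t, IsPreconnected (γ ⁻¹' (Metric.ball z r) \ {t}) := fun t => by
    rw [← hγ.isInducing.isPreconnected_image, image_sdiff hγ.injective, image_singleton,
      image_preimage_eq_of_subset (hball.trans interior_subset)]
    exact isPreconnected_ball_sdiff_singleton _ _ hr
  have hEinf : (γ ⁻¹' (Metric.ball z r)).Infinite := fun h => hinf (by
    rw [← image_preimage_eq_of_subset (hball.trans interior_subset)]; exact h.image γ)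
  have key : ∀ a ∈ γ ⁻¹' (Metric.ball z r), ∀ b ∈ γ ⁻¹' (Metric.ball z r),
      ∀ c ∈ γ ⁻¹' (Metric.ball z r), a < b → b < c → False := fun a ha b _ c hc hab hbc =>
    ((hpre b).Icc_subset ⟨ha, hab.ne⟩ ⟨hc, hbc.ne'⟩ ⟨hab.le, hbc.le⟩).2 rfl
  obtain ⟨t, ht, hcard⟩ := hEinf.exists_subset_card_eq 3
  obtain ⟨a, b, c, ha, hb, hc, hab, hac, hbc⟩ := Finset.two_lt_card_iff.1 (by omega : 2 < t.card)
  replace ha := ht ha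
  replace hb := ht hb
  replace hc := ht hc
  rcases lt_or_gt_of_ne hab with h1 | h1 <;> rcases lt_or_gt_of_ne hac with h2 | h2 <;>
    rcases lt_or_gt_of_ne hbc with h3 | h3
  · exact key a ha b hb c hc h1 h3
  · exact key a ha c hc b hb h2 h3
  · exact absurd (h1.trans h3) h2.not_gt
  · exact key c hc a ha b hb h2 h1
  · exact key b hb a ha c hc h1 h2
  · exact absurd (h3.trans h1) h2.not_gt
  · exact key b hb c hc a ha h3 h2
  · exact key c hc b hb a ha h3 h1

theorem IsArcJoining.isClosed_interior {a b : ℂ} {c : Set ℂ} (h : IsArcJoining a b c) :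
    IsClosed c ∧ interior c = ∅ := by
  obtain ⟨γ, hγ, rfl⟩ := h
  have := γ.continuous.isClosedEmbedding hγ
  exact ⟨this.isClosed_range, this.isEmbedding.interior_range_eq_empty⟩

theorem IsArcToInfinity.isClosed_interior {a : ℂ} {c : Set ℂ} (h : IsArcToInfinity a c) :
    IsClosed c ∧ interior c = ∅ := by
  obtain ⟨γ, hγ, hinj, -, hlim, rfl⟩ := h
  have hprop : IsProperMap γ := isProperMap_iff_tendsto_cocompact.2
    ⟨hγ, hlim.mono_left cocompact_le_atTop⟩
  have := IsClosedEmbedding.of_continuous_injective_isClosedMap hγ hinj hprop.isClosedMap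
  exact ⟨this.isClosed_range, this.isEmbedding.interior_range_eq_empty⟩

/-- Openness of z ↦ z^m. It lets density off the cuts pass from the plane to S. -/
theorem HasBranchingOrder.nhds_le_map {S : Type*} [TopologicalSpace S] {ψ : S → ℂ} {Q : S} {m : ℕ}
    (h : HasBranchingOrder ψ Q m) : 𝓝 (ψ Q) ≤ map ψ (𝓝 Q) := by
  obtain ⟨hm, e, h1, h2, h3⟩ := h
  have hev : ψ =ᶠ[𝓝 Q] (fun z : ℂ => ψ Q + z ^ m) ∘ e := by
    filter_upwards [e.open_source.mem_nhds h1] with y hy using h3 y hy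
  rw [map_congr hev, ← map_map, e.map_nhds_eq h1, h2]
  have han : AnalyticAt ℂ (fun z : ℂ => ψ Q + z ^ m) 0 := by fun_prop
  rcases han.eventually_constant_or_nhds_le_map_nhds with h | h
  · have : ∃ᶠ z : ℂ in 𝓝 0, z ≠ 0 :=
      (eventually_mem_nhdsWithin (a := (0 : ℂ)) (s := {0}ᶜ)).frequently.filter_mono
        nhdsWithin_le_nhds
    obtain ⟨z, hz, hz'⟩ := (this.and_eventually h).exists
    exact absurd (by simpa [hm.ne'] using hz') hz
  · simpa [hm.ne'] using h

/-! ## The two forms of the Helmholtz equation -/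

/-- The Laplacian is 4∂_z∂_{z̄}, whence κ = k²/4; the mixed terms cancel by symmetry of the second
derivative. -/
theorem sol_of_helmholtz {k : ℂ} {U : Set ℂ} {f : ℂ → ℂ} (hU : IsOpen U) (hf : ContDiffOn ℝ 2 f U)
    (h : ∀ x ∈ U, iteratedFDeriv ℝ 2 f x ![1, 1] + iteratedFDeriv ℝ 2 f x ![I, I]
        + k ^ 2 * f x = 0) : Sol (k ^ 2 / 4) (fun _ => 1) U f := fun x hx => by
  have hc := hf.contDiffAt (hU.mem_nhds hx)
  refine ⟨hc.differentiableAt two_ne_zero, ?_⟩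
  have hA := ((hc.fderiv_right (m := 1) le_rfl).differentiableAt one_ne_zero).hasFDerivAt
  have hsym := hc.isSymmSndFDerivAt (by simp)
  set A := fderiv ℝ (fderiv ℝ f) x with hAdef
  have h1 : HasFDerivAt (fun z => fderiv ℝ f z 1) ((ContinuousLinearMap.apply ℝ ℂ (1 : ℂ)).comp A) x :=
    (ContinuousLinearMap.apply ℝ ℂ (1 : ℂ)).hasFDerivAt.comp x hA
  have h2 : HasFDerivAt (fun z => fderiv ℝ f z I) ((ContinuousLinearMap.apply ℝ ℂ I).comp A) x :=
    (ContinuousLinearMap.apply ℝ ℂ I).hasFDerivAt.comp x hA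
  have h4 : A 1 1 + A I I + k ^ 2 * f x = 0 := by
    simpa [iteratedFDeriv_two_apply] using h x hx
  have h5 : A 1 I = A I 1 := hsym 1 I
  obtain ⟨Λ, hΛ, hΛv⟩ : ∃ Λ : ℂ →L[ℝ] ℂ, HasFDerivAt (dz f) Λ x ∧
      ∀ v, Λ v = (A v 1 - I * A v I) * 2⁻¹ :=
    ⟨_, (h1.sub (h2.const_mul I)).mul_const (2⁻¹ : ℂ), fun v => by simp [mul_comm]⟩
  have h7 : (Λ 1 + I * Λ I) / 2 = -(k ^ 2 / 4) * (1 * (starRingEnd ℂ) 1) * f x := by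
    rw [hΛv, hΛv, map_one (starRingEnd ℂ)]
    linear_combination (1 / 4 : ℂ) * h4 - (I / 4 : ℂ) * h5 - (1 / 4 : ℂ) * A I I * I_sq
  have h8 := eq_wirt Λ
  rw [h7] at h8
  exact ⟨_, hΛ.congr_fderiv h8⟩

theorem helmholtz_conj {k : ℂ} {U : Set ℂ} {f : ℂ → ℂ} (hf : ContDiffOn ℝ 2 f U)
    (h : ∀ x ∈ U, iteratedFDeriv ℝ 2 f x ![1, 1] + iteratedFDeriv ℝ 2 f x ![I, I]
        + k ^ 2 * f x = 0) :
    ContDiffOn ℝ 2 (f ∘ conjCLE) (conjCLE ⁻¹' U) ∧ ∀ x ∈ conjCLE ⁻¹' U,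
      iteratedFDeriv ℝ 2 (f ∘ conjCLE) x ![1, 1] + iteratedFDeriv ℝ 2 (f ∘ conjCLE) x ![I, I]
        + k ^ 2 * (f ∘ conjCLE) x = 0 := by
  refine ⟨hf.comp_continuousLinearMap (conjCLE : ℂ →L[ℝ] ℂ), fun x hx => ?_⟩
  have h1 := conjCLE.iteratedFDerivWithin_comp_right f uniqueDiffOn_univ (mem_univ (conjCLE x)) 2
  rw [preimage_univ, iteratedFDerivWithin_univ, iteratedFDerivWithin_univ] at h1
  rw [h1]
  have h2 := h _ hx
  have e1 : (fun i => (conjCLE : ℂ →L[ℝ] ℂ) ((![1, 1] : Fin 2 → ℂ) i)) = ![1, 1] := by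
    ext i; fin_cases i <;> simp
  have e2 : (fun i => (conjCLE : ℂ →L[ℝ] ℂ) ((![I, I] : Fin 2 → ℂ) i)) = ![-I, -I] := by
    ext i; fin_cases i <;> simp
  rw [ContinuousMultilinearMap.compContinuousLinearMap_apply,
    ContinuousMultilinearMap.compContinuousLinearMap_apply, e1, e2]
  have e3 : iteratedFDeriv ℝ 2 f (conjCLE x) ![-I, -I] =
      iteratedFDeriv ℝ 2 f (conjCLE x) ![I, I] := by
    simp [iteratedFDeriv_two_apply]
  rw [e3]
  exact h2

/-! ## Sommerfeld surfaces as branched coverings -/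

theorem HasBranchingOrder.conj {S : Type*} [TopologicalSpace S] {ψ : S → ℂ} {Q : S} {m : ℕ}
    (h : HasBranchingOrder ψ Q m) : HasBranchingOrder (fun a => (starRingEnd ℂ) (ψ a)) Q m := by
  obtain ⟨hm, e, h1, h2, h3⟩ := h
  refine ⟨hm, e.transHomeomorph conjCLE.toHomeomorph, by simpa using h1, by simp [h2],
    fun y hy => ?_⟩
  have := h3 y (by simpa using hy)
  simp [this]

theorem hasBranchingOrder_conj_iff {S : Type*} [TopologicalSpace S] {ψ : S → ℂ} {Q : S} {m : ℕ} :
    HasBranchingOrder (fun a => (starRingEnd ℂ) (ψ a)) Q m ↔ HasBranchingOrder ψ Q m :=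
  ⟨fun h => by simpa using h.conj, fun h => h.conj⟩

theorem wave_conj (α β z : ℂ) : wave β α ((starRingEnd ℂ) z) = wave α β z := by
  rw [wave, wave, Complex.conj_conj, add_comm]

/-- Reflection of the plane exchanges z with z̄ and α with β, so results on branching in the first
characteristic coordinate also yield those in the second. -/
theorem ScatteringData.conj {S : Type*} [TopologicalSpace S] {P : Set ℂ} {ψ : S → ℂ}
    {κ α β : ℂ} {u : S → ℂ} (D : ScatteringData P ψ κ α β u)
    (hsol : ∀ (U : Set ℂ) (g : ℂ → S), IsOpen U → Disjoint U ((starRingEnd ℂ) '' P) →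
      ContinuousOn g U → (∀ x ∈ U, (starRingEnd ℂ) (ψ (g x)) = x) → Sol κ (fun _ => 1) U (u ∘ g)) :
    ScatteringData ((starRingEnd ℂ) '' P) (fun a => (starRingEnd ℂ) (ψ a)) κ β α u where
  finite := D.finite.image _
  proper := conjCLE.toHomeomorph.isProperMap.comp D.proper
  order Q := (D.order Q).imp fun _ h => h.conj
  order_one Q hQ := (D.order_one Q fun h => hQ (mem_image_of_mem _ h)).conj
  cont := D.cont
  sol := hsol
  im_pos := D.im_pos
  mul_eq := by rw [mul_comm, D.mul_eq]
  far := by simpa only [wave_conj, RCLike.norm_conj] using D.far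
  sep R := by
    obtain ⟨a, h1, h2, h3⟩ := D.sep R
    refine ⟨a, by simpa using h1, ?_, fun a' hne h => h3 a' hne ((starRingEnd ℂ).injective h)⟩
    rintro ⟨z, hz, hza⟩
    exact h2 ((starRingEnd ℂ).injective hza ▸ hz)

namespace SommerfeldSurface

variable {S : Type*} [TopologicalSpace S] {N M : ℕ} (X : SommerfeldSurface S N M)

theorem isClosed_interior_cut (i : Fin X.numCuts) :
    IsClosed (X.cut i) ∧ interior (X.cut i) = ∅ := by
  rcases X.cut_arc i with ⟨j, j', -, h, -⟩ | ⟨j, h, -⟩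
  · exact h.isClosed_interior
  · exact h.isClosed_interior

theorem dense_compl_cuts : Dense ((⋃ i, X.cut i) ∪ range X.P)ᶜ := by
  rw [compl_union, compl_iUnion]
  refine Dense.inter_of_isOpen_right (dense_iInter_of_isOpen
    (fun i => (X.isClosed_interior_cut i).1.isOpen_compl)
    fun i => interior_eq_empty_iff_dense_compl.1 (X.isClosed_interior_cut i).2) ?_
    (finite_range X.P).isClosed.isOpen_compl
  exact (finite_range X.P).countable.dense_compl ℂ

theorem isOpenMap_ψ : IsOpenMap X.ψ :=
  isOpenMap_iff_nhds_le.2 fun Q => (X.exists_order Q).choose_spec.nhds_le_map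

/-- The M sheets give M distinct points of a fibre with M elements, so they exhaust it. -/
theorem exists_sheet (s₀ : Fin M) {a : S} (ha : X.ψ a ∉ (⋃ i, X.cut i) ∪ range X.P) :
    ∃ s, X.sheet s (X.ψ a) = a := by
  have hcut : X.ψ a ∉ ⋃ i, X.cut i := fun h => ha (Or.inl h)
  have hcard := X.card_fiber (X.ψ a) fun h => ha (Or.inr h)
  have hinj : Function.Injective fun s => X.sheet s (X.ψ a) := fun s s' h => by
    by_contra hne
    exact X.sheet_ne s s' hne _ hcut h
  have hfin : (X.ψ ⁻¹' {X.ψ a}).Finite := finite_of_ncard_pos (by rw [hcard]; exact s₀.pos)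
  have hsub : range (fun s => X.sheet s (X.ψ a)) ⊆ X.ψ ⁻¹' {X.ψ a} := by
    rintro _ ⟨s, rfl⟩
    exact X.ψ_sheet s _ hcut
  have := eq_of_subset_of_ncard_le hsub (by
    rw [hcard, ncard_range_of_injective hinj, Nat.card_fin]) hfin
  have ha' : a ∈ range fun s => X.sheet s (X.ψ a) := by rw [this]; rfl
  exact ha'

variable {X} {k : ℂ} {φ : ℝ} {s₀ : Fin M} {u : S → ℂ}

theorem incident_eq (k : ℂ) (φ : ℝ) (s₀ s : Fin M) (x : ℂ) : incident k φ s₀ s x =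
    (if s = s₀ then 1 else 0) * wave (-(I * k / 2) * exp (-I * φ)) (-(I * k / 2) * exp (I * φ)) x := by
  rw [incident]
  split_ifs
  · rw [one_mul, wave]
    congr 1
    have h1 : exp (-I * φ) = cos φ - sin φ * I := by
      rw [show -I * (φ : ℂ) = ((-φ : ℝ) : ℂ) * I by push_cast; ring, exp_mul_I]; simp; ring
    have h2 : exp (I * φ) = cos φ + sin φ * I := by rw [mul_comm, exp_mul_I]
    have h3 : x = x.re + x.im * I := (re_add_im x).symm
    have h4 : (starRingEnd ℂ) x = x.re - x.im * I := by
      apply Complex.ext <;> simp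
    rw [h1, h2, h4]
    nth_rw 3 [h3]
    push_cast
    linear_combination (-(I * k) * x.im * sin φ) * I_sq
  · simp

theorem IsDiffractionSolution.scatteringData (hk_re : 0 < k.re) (hk_im : 0 < k.im)
    (hu : X.IsDiffractionSolution k φ s₀ u) :
    ScatteringData (range X.P) X.ψ (k ^ 2 / 4) (-(I * k / 2) * exp (-I * φ))
      (-(I * k / 2) * exp (I * φ)) u := by
  obtain ⟨δ, hδ, K, hK⟩ := hu.scattered_decay
  refine ⟨finite_range _, X.isProperMap, X.exists_order, X.order_one, hu.continuous,
    fun U g hU hd hg hψ => ?_, ?_, ?_, ⟨δ, hδ, K, fun a => ?_⟩, fun R => ?_⟩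
  · obtain ⟨h1, h2⟩ := hu.helmholtz U g hU hd ⟨hg, hψ⟩
    exact sol_of_helmholtz hU h1 h2
  · have : (k ^ 2 / 4).im = k.re * k.im / 2 := by
      rw [show (k ^ 2 / 4 : ℂ) = ((1 / 4 : ℝ) : ℂ) * k ^ 2 by push_cast; ring, im_ofReal_mul]
      simp [pow_two]; ring
    rw [this]; positivity
  · have h1 : exp (-I * φ) * exp (I * φ) = 1 := by rw [← exp_add]; simp
    linear_combination (I * k / 2) ^ 2 * h1 + k ^ 2 / 4 * I_sq
  · set W := wave (-(I * k / 2) * exp (-I * φ)) (-(I * k / 2) * exp (I * φ)) with hW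
    have hWc : Continuous W := continuous_iff_continuousAt.2 fun z =>
      (hasFDerivAt_wave _ _ z).continuousAt
    have hψc := X.isProperMap.continuous
    have huc := hu.continuous
    -- The estimate is known off the cuts, a dense set. With only two values of ε the alternative is
    -- a closed condition, hence it holds everywhere.
    have hcl : IsClosed {a | ∃ ε : ℂ, (ε = 0 ∨ ε = 1) ∧
        ‖u a - ε * W (X.ψ a)‖ ≤ K * Real.exp (-δ * ‖X.ψ a‖)} := by
      have h1 : ∀ ε : ℂ, IsClosed {a | ‖u a - ε * W (X.ψ a)‖ ≤ K * Real.exp (-δ * ‖X.ψ a‖)} :=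
        fun ε => isClosed_le (by fun_prop) (by fun_prop)
      simp only [or_and_right, exists_or, exists_eq_left]
      exact (h1 0).union (h1 1)
    have hd : Dense (X.ψ ⁻¹' ((⋃ i, X.cut i) ∪ range X.P)ᶜ) := X.dense_compl_cuts.preimage X.isOpenMap_ψ
    refine hcl.closure_subset_iff.2 (fun a ha => ?_) (hd a)
    obtain ⟨s, hs⟩ := X.exists_sheet s₀ ha
    refine ⟨if s = s₀ then 1 else 0, by split_ifs <;> simp, ?_⟩
    have := hK s (X.ψ a) fun h => ha (Or.inl h)
    rwa [hs, incident_eq] at this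
  · set W := wave (-(I * k / 2) * exp (-I * φ)) (-(I * k / 2) * exp (I * φ)) with hW
    have hWc : Continuous W := continuous_iff_continuousAt.2 fun z =>
      (hasFDerivAt_wave _ _ z).continuousAt
    -- In the direction φ the incident wave has modulus e^{t Im k}, while the errors on all sheets
    -- decay.
    have hWn : ∀ t : ℝ, 0 ≤ t → 1 ≤ ‖W (t * exp (I * φ))‖ := fun t ht => by
      have h1 : W (t * exp (I * φ)) = exp (-I * k * t) := by
        rw [hW, wave, map_mul, conj_ofReal, ← exp_conj, map_mul, conj_I, conj_ofReal]
        congr 1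
        have h1 : exp (-I * φ) * exp (I * φ) = 1 := by rw [← exp_add]; simp
        linear_combination (-(I * k) * t) * h1
      rw [h1, norm_exp]
      refine Real.one_le_exp ?_
      have : (-I * k * t).re = k.im * t := by simp
      rw [this]; positivity
    have hlim : Tendsto (fun t : ℝ => 2 * K * Real.exp (-δ * t)) atTop (𝓝 0) := by
      have h1 : Tendsto (fun t : ℝ => -δ * t) atTop atBot :=
        tendsto_id.const_mul_atTop_of_neg (neg_lt_zero.2 hδ)
      simpa using (Real.tendsto_exp_atBot.comp h1).const_mul (2 * K)
    obtain ⟨t, ht1, ht2, ht3⟩ := ((hlim.eventually (gt_mem_nhds one_pos)).and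
      ((eventually_ge_atTop 0).and (eventually_gt_atTop R))).exists
    have hO1 : IsOpen {x : ℂ | R < ‖x‖} := isOpen_lt (by fun_prop) (by fun_prop)
    -- The factor 2 covers the errors on two sheets. Openness allows the point to be moved off the
    -- cuts.
    have hO2 : IsOpen {x : ℂ | 2 * K * Real.exp (-δ * ‖x‖) < ‖W x‖} :=
      isOpen_lt (by fun_prop) (by fun_prop)
    have hO : IsOpen {x : ℂ | R < ‖x‖ ∧ 2 * K * Real.exp (-δ * ‖x‖) < ‖W x‖} := hO1.inter hO2
    have hnt : ‖(t * exp (I * φ) : ℂ)‖ = t := by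
      rw [norm_mul, mul_comm I, norm_exp_ofReal_mul_I, mul_one, norm_real, Real.norm_of_nonneg ht2]
    obtain ⟨x, ⟨hx1, hx2⟩, hx3⟩ := X.dense_compl_cuts.inter_open_nonempty _ hO
      ⟨t * exp (I * φ), by rw [hnt]; exact ht3, by rw [hnt]; exact ht1.trans_le (hWn t ht2)⟩
    have hcut : x ∉ ⋃ i, X.cut i := fun h => hx3 (Or.inl h)
    have hψs := X.ψ_sheet s₀ x hcut
    refine ⟨X.sheet s₀ x, by rwa [hψs], by rw [hψs]; exact fun h => hx3 (Or.inr h),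
      fun a' hne hψ heq => ?_⟩
    rw [hψs] at hψ
    obtain ⟨s, hs⟩ := X.exists_sheet s₀ (a := a') (by rwa [hψ])
    rw [hψ] at hs
    have hss : s ≠ s₀ := by rintro rfl; exact hne hs.symm
    have h1 := hK s₀ x hcut
    have h2 := hK s x hcut
    rw [incident_eq, if_pos rfl, one_mul] at h1
    rw [incident_eq, if_neg hss, zero_mul, sub_zero, hs, heq] at h2
    have h3 : ‖W x‖ ≤ ‖u (X.sheet s₀ x)‖ + ‖u (X.sheet s₀ x) - W x‖ := by
      calc ‖W x‖ = ‖u (X.sheet s₀ x) - (u (X.sheet s₀ x) - W x)‖ := by congr 1; ring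
        _ ≤ _ := norm_sub_le _ _
    linarith

theorem IsDiffractionSolution.scatteringData_conj (hk_re : 0 < k.re) (hk_im : 0 < k.im)
    (hu : X.IsDiffractionSolution k φ s₀ u) :
    ScatteringData ((starRingEnd ℂ) '' range X.P) (fun a => (starRingEnd ℂ) (X.ψ a)) (k ^ 2 / 4)
      (-(I * k / 2) * exp (I * φ)) (-(I * k / 2) * exp (-I * φ)) u := by
  refine (hu.scatteringData hk_re hk_im).conj fun U g hU hd hg hψ => ?_
  have hU' : IsOpen (conjCLE ⁻¹' U) := hU.preimage conjCLE.continuous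
  obtain ⟨h1, h2⟩ := hu.helmholtz (conjCLE ⁻¹' U) (g ∘ conjCLE) hU'
    (disjoint_left.2 fun z hz hzP => disjoint_left.1 hd hz ⟨z, hzP, rfl⟩)
    ⟨hg.comp conjCLE.continuous.continuousOn fun z hz => hz, fun z hz => by
      have := hψ _ hz
      rw [← Complex.conj_conj (X.ψ _)]
      exact (congrArg (starRingEnd ℂ) this).trans (Complex.conj_conj z)⟩
  obtain ⟨h3, h4⟩ := helmholtz_conj h1 h2
  have e1 : (u ∘ g ∘ conjCLE) ∘ conjCLE = u ∘ g := by ext z; simp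
  have e2 : conjCLE ⁻¹' (conjCLE ⁻¹' U) = U := by ext z; simp
  rw [e1, e2] at h3 h4
  exact sol_of_helmholtz hU h3 h4

end SommerfeldSurface

/-! ## Characteristic coordinates -/

/-- Linear coordinates on the domain of analytic continuation, applied to a path. -/
noncomputable def mapPath (Φ : (ℂ × ℂ) ≃L[ℂ] (ℂ × ℂ)) (σ : C(unitInterval, ℂ × ℂ)) : C(unitInterval, ℂ × ℂ) :=
  ⟨fun t => Φ (σ t), Φ.continuous.comp σ.continuous⟩

theorem Filter.EventuallyEq.comp_equiv {f g : ℂ × ℂ → ℂ} {B : ℂ × ℂ} (h : f =ᶠ[𝓝 B] g)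
    (Φ : (ℂ × ℂ) ≃L[ℂ] (ℂ × ℂ)) : f ∘ Φ.symm =ᶠ[𝓝 (Φ B)] g ∘ Φ.symm := by
  have := Φ.symm.continuous.tendsto (Φ B)
  rw [Φ.symm_apply_apply] at this
  exact h.comp_tendsto this

theorem AnalyticAt.comp_equiv {f : ℂ × ℂ → ℂ} {B : ℂ × ℂ} (h : AnalyticAt ℂ f B)
    (Φ : (ℂ × ℂ) ≃L[ℂ] (ℂ × ℂ)) : AnalyticAt ℂ (f ∘ Φ.symm) (Φ B) :=
  h.comp_of_eq ((Φ.symm : (ℂ × ℂ) →L[ℂ] (ℂ × ℂ)).analyticAt _) (Φ.symm_apply_apply B)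

theorem ContinuesAlong.map {σ : C(unitInterval, ℂ × ℂ)} {f g : ℂ × ℂ → ℂ}
    (h : ContinuesAlong σ f g) (Φ : (ℂ × ℂ) ≃L[ℂ] (ℂ × ℂ)) :
    ContinuesAlong (mapPath Φ σ) (f ∘ Φ.symm) (g ∘ Φ.symm) := by
  obtain ⟨F, h0, h1, ha, hc⟩ := h
  exact ⟨fun t => F t ∘ Φ.symm, h0.comp_equiv Φ, h1.comp_equiv Φ, fun t => (ha t).comp_equiv Φ,
    fun t => (hc t).mono fun s hs => hs.comp_equiv Φ⟩

namespace SommerfeldSurface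

variable {S : Type*} [TopologicalSpace S] {N M : ℕ} {X : SommerfeldSurface S N M} {u : S → ℂ}
  {l : Fin 2} {j : Fin N} {n : ℕ} {C : ℂ × ℂ} {κ α β : ℂ}

/-- `Φ` are characteristic coordinates of `ℂ²`, the first of which is `charCoord l`. On the real
plane they restrict to a coordinate `c` and its conjugate. -/
structure IsCharEquiv (l : Fin 2) (Φ : (ℂ × ℂ) ≃L[ℂ] (ℂ × ℂ)) (c : ℂ → ℂ) : Prop where
  injective : Function.Injective c
  realPoint : ∀ x, Φ (realPoint x) = (c x, (starRingEnd ℂ) (c x))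
  fst : ∀ A, charCoord l A = (Φ A).1
  snd : ∀ A, charCoord (1 - l) A = (Φ A).2

variable {Φ : (ℂ × ℂ) ≃L[ℂ] (ℂ × ℂ)} {c : ℂ → ℂ}

theorem IsCharEquiv.mem_twoLine (h : IsCharEquiv l Φ c) {A : ℂ × ℂ} :
    A ∈ X.twoLine l j ↔ (Φ A).1 = c (X.P j) := by
  rw [twoLine, Set.mem_ofPred_eq, h.fst, h.fst, h.realPoint]

theorem IsCharEquiv.mem_twoLine' (h : IsCharEquiv l Φ c) {A : ℂ × ℂ} :
    A ∈ X.twoLine (1 - l) j ↔ (starRingEnd ℂ) (Φ A).2 = c (X.P j) := by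
  rw [twoLine, Set.mem_ofPred_eq, h.snd, h.snd, h.realPoint]
  exact ⟨fun h => by rw [h, Complex.conj_conj], fun h => by rw [← h, Complex.conj_conj]⟩

theorem IsCharEquiv.notMem_T (h : IsCharEquiv l Φ c) {A : ℂ × ℂ} :
    A ∉ X.T ↔ Avoids (c '' range X.P) (Φ A) := by
  have hl : ∀ l l' : Fin 2, l' = l ∨ l' = 1 - l := by decide
  have h1 : A ∈ X.T ↔ (∃ j, A ∈ X.twoLine l j) ∨ ∃ j, A ∈ X.twoLine (1 - l) j := by
    simp only [T, mem_iUnion]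
    refine ⟨fun ⟨l', j, hA⟩ => ?_, fun hA => hA.elim (fun h => ⟨_, h⟩) fun h => ⟨_, h⟩⟩
    rcases hl l l' with rfl | rfl
    · exact Or.inl ⟨j, hA⟩
    · exact Or.inr ⟨j, hA⟩
  rw [h1, not_or, Avoids]
  refine and_congr (not_congr ?_) (not_congr ?_)
  · simp only [h.mem_twoLine, mem_image, exists_range_iff, eq_comm]
  · simp only [h.mem_twoLine', mem_image, exists_range_iff, eq_comm]

theorem IsCharEquiv.mem_image (h : IsCharEquiv l Φ c) {x : ℂ} :
    c x ∈ c '' range X.P ↔ x ∈ range X.P := h.injective.mem_set_image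

theorem IsBranch.isCharBranch (h : IsCharEquiv l Φ c) {B : ℂ × ℂ} {f : ℂ × ℂ → ℂ}
    (hb : X.IsBranch u B f) :
    IsCharBranch (c '' range X.P) (fun a => c (X.ψ a)) u (Φ B) (f ∘ Φ.symm) := by
  obtain ⟨A₀, hA, f₀, h1, h2, σ, h3, rfl, h5, h6⟩ := hb
  refine ⟨A₀, fun hA' => hA (h.mem_image.1 hA'), f₀ ∘ Φ.symm, ?_, ?_, mapPath Φ σ, ?_, rfl,
    fun t => h.notMem_T.1 (h5 t), h6.map Φ⟩
  · rw [← h.realPoint]; exact h1.comp_equiv Φ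
  · filter_upwards [h2] with A hA
    rw [← h.realPoint, Function.comp, Φ.symm_apply_apply, hA]
  · rw [← h.realPoint, ← h3]; rfl

theorem _root_.IsCharBranch.isBranch (h : IsCharEquiv l Φ c) {B : ℂ × ℂ} {f : ℂ × ℂ → ℂ}
    (hb : IsCharBranch (c '' range X.P) (fun a => c (X.ψ a)) u B f) :
    X.IsBranch u (Φ.symm B) (f ∘ Φ) := by
  obtain ⟨A₀, hA, f₀, h1, h2, σ, h3, rfl, h5, h6⟩ := hb
  refine ⟨A₀, fun hA' => hA (h.mem_image.2 hA'), f₀ ∘ Φ, ?_, ?_, mapPath Φ.symm σ, ?_, rfl,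
    fun t => h.notMem_T.2 ?_, h6.map Φ.symm⟩
  · have := h1.comp_equiv Φ.symm
    rwa [← h.realPoint, Φ.symm_apply_apply] at this
  · filter_upwards [h2] with A hA
    rw [Function.comp, h.realPoint, hA]
  · change Φ.symm (σ 0) = _
    rw [h3, ← h.realPoint, Φ.symm_apply_apply]
  · change Avoids _ (Φ (Φ.symm (σ t)))
    rw [Φ.apply_symm_apply]; exact h5 t

theorem bypassReturns_iff (h : IsCharEquiv l Φ c) (hC : C ∈ X.twoLine l j) :
    X.BypassReturns u l j C n ↔
      CharBypassReturns (c '' range X.P) (fun a => c (X.ψ a)) u (Φ C) n := by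
  have hCj : charCoord l (realPoint (X.P j)) = (Φ C).1 := by rw [← h.fst]; exact hC.symm
  constructor
  · rintro ⟨U, hU, hret⟩
    refine ⟨Φ.symm ⁻¹' U, Φ.symm.continuous.continuousAt.preimage_mem_nhds
      (by rwa [Φ.symm_apply_apply]), fun B f hB σ h0 h1 hσ hw => ?_⟩
    have := hret _ _ (hB.isBranch h) (mapPath Φ.symm σ) (congrArg Φ.symm h0) (congrArg Φ.symm h1)
      (fun t => ⟨(hσ t).1, h.notMem_T.2 (by
        change Avoids _ (Φ (Φ.symm (σ t)))
        rw [Φ.apply_symm_apply]; exact (hσ t).2)⟩) (by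
        have e : ∀ t, charCoord l (mapPath Φ.symm σ t) = (σ t).1 := fun t => by
          rw [h.fst]
          change (Φ (Φ.symm (σ t))).1 = _
          rw [Φ.apply_symm_apply]
        simpa only [e, hCj] using hw)
    have h2 := this.map Φ
    have e1 : mapPath Φ (mapPath Φ.symm σ) = σ := by
      ext1 t; exact Φ.apply_symm_apply (σ t)
    have e2 : (f ∘ Φ) ∘ Φ.symm = f := by ext q; simp
    rwa [e1, e2] at h2
  · rintro ⟨U, hU, hret⟩
    refine ⟨Φ ⁻¹' U, Φ.continuous.continuousAt.preimage_mem_nhds hU,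
      fun B f hB σ h0 h1 hσ hw => ?_⟩
    have := hret _ _ (hB.isCharBranch h) (mapPath Φ σ) (congrArg Φ h0) (congrArg Φ h1)
      (fun t => ⟨(hσ t).1, h.notMem_T.1 (hσ t).2⟩) (by
        simp only [h.fst (σ _), hCj] at hw
        exact hw)
    have h2 := this.map Φ.symm
    have e1 : mapPath Φ.symm (mapPath Φ σ) = σ := by
      ext1 t; exact Φ.symm_apply_apply (σ t)
    have e2 : (f ∘ Φ.symm) ∘ Φ.symm.symm = f := by ext q; simp
    rwa [e1, e2] at h2

/-- A positive number of bypasses returns all branches exactly when it is a common multiple of the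
orders of branching over P_j; the two minima therefore coincide. As C lies on no 2-line of the other
family, its second coordinate is regular. -/
theorem IsBranchPointOfOrder.isBranchTwoLineOfOrder [T2Space S] [ConnectedSpace S] {p : ℕ}
    (hp : X.IsBranchPointOfOrder j p) (h : IsCharEquiv l Φ c)
    (D : ScatteringData (c '' range X.P) (fun a => c (X.ψ a)) κ α β u)
    (ho : ∀ Q m, HasBranchingOrder (fun a => c (X.ψ a)) Q m ↔ HasBranchingOrder X.ψ Q m) :
    X.IsBranchTwoLineOfOrder u l j p := by
  intro C hC hne
  have hΦC := h.mem_twoLine.1 hC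
  have hw : (starRingEnd ℂ) (Φ C).2 ∉ c '' range X.P := by
    rintro ⟨_, ⟨i, rfl⟩, hi⟩
    refine hne (1 - l) i (fun h => ?_) (h.mem_twoLine'.2 hi.symm)
    have : ∀ l : Fin 2, 1 - l ≠ l := by decide
    exact this l (Prod.ext_iff.1 h).1
  have hcP : c (X.P j) ∈ c '' range X.P := mem_image_of_mem _ (mem_range_self j)
  have hCe : Φ C = (c (X.P j), (Φ C).2) := Prod.ext hΦC rfl
  refine ⟨⟨hp.1.1, ?_⟩, fun n hn => hp.2 ⟨hn.1, fun Q hQ m hm => ?_⟩⟩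
  · rw [bypassReturns_iff h hC, hCe]
    exact D.charBypassReturns hcP hw fun Q hQ m hm => hp.1.2 Q (h.injective hQ) m ((ho Q m).1 hm)
  · have h1 := hn.2
    rw [bypassReturns_iff h hC, hCe] at h1
    exact D.dvd_of_charBypassReturns hw h1 hcP (Q := Q) (congrArg c hQ) ((ho Q m).2 hm)

end SommerfeldSurface

/-- The linear coordinates `x₁ + s x₂` and `x₁ - s x₂` for a square root `s` of `-1`. -/
noncomputable def charEquiv (s : ℂ) (hs : s * s = -1) : (ℂ × ℂ) ≃L[ℂ] (ℂ × ℂ) :=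
  LinearEquiv.toContinuousLinearEquiv
    { toFun := fun A => (A.1 + s * A.2, A.1 - s * A.2)
      invFun := fun q => ((q.1 + q.2) / 2, -s * (q.1 - q.2) / 2)
      map_add' := fun A B => by ext <;> simp <;> ring
      map_smul' := fun a A => by ext <;> simp <;> ring
      left_inv := fun A => Prod.ext (by ring) (by linear_combination -A.2 * hs)
      right_inv := fun q => Prod.ext (by linear_combination -(q.1 - q.2) / 2 * hs)
        (by linear_combination (q.1 - q.2) / 2 * hs) }

theorem charEquiv_apply {s : ℂ} (hs : s * s = -1) (A : ℂ × ℂ) :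
    charEquiv s hs A = (A.1 + s * A.2, A.1 - s * A.2) := rfl

theorem conj_eq_re_sub_im (x : ℂ) : (starRingEnd ℂ) x = x.re - I * x.im := by
  apply Complex.ext <;> simp

theorem isCharEquiv_zero :
    SommerfeldSurface.IsCharEquiv 0 (charEquiv I I_mul_I) fun z => z where
  injective := Function.injective_id
  realPoint x := by
    rw [charEquiv_apply, realPoint, conj_eq_re_sub_im]
    exact Prod.ext (by simp [mul_comm I]) rfl
  fst A := by simp [charEquiv_apply, charCoord]
  snd A := by simp [charEquiv_apply, charCoord]

theorem isCharEquiv_one :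
    SommerfeldSurface.IsCharEquiv 1 (charEquiv (-I) (by simp)) (starRingEnd ℂ) where
  injective := (starRingEnd ℂ).injective
  realPoint x := by
    rw [charEquiv_apply, realPoint, Complex.conj_conj, conj_eq_re_sub_im]
    exact Prod.ext (by simp [sub_eq_add_neg]) (by simp [mul_comm I])
  fst A := by simp [charEquiv_apply, charCoord, sub_eq_add_neg]
  snd A := by simp [charEquiv_apply, charCoord]

theorem mainTheorem2 {S : Type*} [TopologicalSpace S] [T2Space S] [ConnectedSpace S] {N M : ℕ}
    (X : SommerfeldSurface S N M) (k : ℂ) (hk_re : 0 < k.re) (hk_im : 0 < k.im)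
    (φ : ℝ) (s₀ : Fin M) (u : S → ℂ) (hu : X.IsDiffractionSolution k φ s₀ u)
    (j : Fin N) (p : ℕ) (hp : X.IsBranchPointOfOrder j p) :
    X.IsBranchTwoLineOfOrder u 0 j p ∧ X.IsBranchTwoLineOfOrder u 1 j p := by
  refine ⟨hp.isBranchTwoLineOfOrder isCharEquiv_zero (by
    rw [image_id']; exact hu.scatteringData hk_re hk_im) fun _ _ => Iff.rfl,
    hp.isBranchTwoLineOfOrder isCharEquiv_one (hu.scatteringData_conj hk_re hk_im)
      fun _ _ => hasBranchingOrder_conj_iff⟩
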